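/- Let $K$ be a commutative ring, $q\in K$ invertible, and let $W_q$ be the associative $K$-algebra with generators $u,u^{-1},v,v^{-1}$ and relations $uu^{-1}=u^{-1}u=vv^{-1}=v^{-1}v=1$, $uv-qvu=1$. Put $$A=v^{-1}u^{-1},\qquad B=u,\qquad C=q\,uvu^{-1}v^{-1}u^{-1}v^{-1}u^{-1}vu,\qquad D=1-q-u^{-1}v^{-1}.$$ A link diagram $L$ on a compact oriented surface $\Sigma$ without boundary is a finite family of oriented closed curves on $\Sigma$ in general position, whose only multiple points are finitely many transverse double points (crossings), with a choice of over branch and under branch at each crossing. Its arcs are the connected components of the diagram with the crossings removed. Each crossing has a left and a right input arc $x_l,x_r$ and a left and a right output arc $y_l,y_r$, where left and right are taken with respect to the common direction of travel of the two branches and the orientation of $\Sigma$. The crossing is positive if the over branch runs from the left input to the right output, and negative otherwise. The left $W_q$-module $M_{A,B,C,D}(L)$ is generated by the arcs, with two relations for each crossing: $$y_l=Ax_l+Bx_r,\quad y_r=Cx_l+Dx_r\quad\text{(positive crossing)},\qquad x_l=Ay_l+By_r,\quad x_r=Cy_l+Dy_r\quad\text{(negative crossing)}.$$ Two link diagrams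 on compact oriented surfaces are stably equivalent if they are related by a finite sequence of the following operations: (i) Reidemeister moves on the surface; (ii) transfer by an orientation preserving homeomorphism of surfaces (the parametrizations of the oriented curves are immaterial); (iii) attaching a 1-handle to the surface away from the diagram, compatibly with the orientation, or removing such a handle. A virtual link is a stable equivalence class of link diagrams. **Theorem.** If the link diagrams $L$ and $L'$ are stably equivalent, then the $W_q$-modules $M_{A,B,C,D}(L)$ and $M_{A,B,C,D}(L')$ are isomorphic. Hence $M_{A,B,C,D}(L)$ is an invariant of the virtual link $L$. -/

import Mathlib

open Set Filter Topology

universe u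

/-! ## The quantum Weyl algebra -/

/-- The four generators `u`, `u⁻¹`, `v`, `v⁻¹`. -/
inductive WeylGen : Type
  | u
  | uInv
  | v
  | vInv

/-- The defining relations of the quantum Weyl algebra: `u`, `v` are invertible, `uv - qvu = 1`. -/
inductive WeylRel (K : Type*) [CommRing K] (q : K) :
    FreeAlgebra K WeylGen → FreeAlgebra K WeylGen → Prop
  | u_uInv : WeylRel K q (FreeAlgebra.ι K WeylGen.u * FreeAlgebra.ι K WeylGen.uInv) 1
  | uInv_u : WeylRel K q (FreeAlgebra.ι K WeylGen.uInv * FreeAlgebra.ι K WeylGen.u) 1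
  | v_vInv : WeylRel K q (FreeAlgebra.ι K WeylGen.v * FreeAlgebra.ι K WeylGen.vInv) 1
  | vInv_v : WeylRel K q (FreeAlgebra.ι K WeylGen.vInv * FreeAlgebra.ι K WeylGen.v) 1
  | weyl : WeylRel K q
      (FreeAlgebra.ι K WeylGen.u * FreeAlgebra.ι K WeylGen.v
        - q • (FreeAlgebra.ι K WeylGen.v * FreeAlgebra.ι K WeylGen.u)) 1

/-- The quantum Weyl algebra `W_q` over `K`. -/
abbrev QuantumWeyl (K : Type*) [CommRing K] (q : K) : Type _ := RingQuot (WeylRel K q)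

namespace QuantumWeyl

/-- The image of a generator in `W_q`. -/
noncomputable def gen (K : Type*) [CommRing K] (q : K) (g : WeylGen) : QuantumWeyl K q :=
  RingQuot.mkAlgHom K (WeylRel K q) (FreeAlgebra.ι K g)

/-- `A = v⁻¹ u⁻¹`. -/
noncomputable def A (K : Type*) [CommRing K] (q : K) : QuantumWeyl K q :=
  gen K q WeylGen.vInv * gen K q WeylGen.uInv

/-- `B = u`. -/
noncomputable def B (K : Type*) [CommRing K] (q : K) : QuantumWeyl K q :=
  gen K q WeylGen.u

/-- `C = q u v u⁻¹ v⁻¹ u⁻¹ v⁻¹ u⁻¹ v u`. -/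
noncomputable def C (K : Type*) [CommRing K] (q : K) : QuantumWeyl K q :=
  q • (gen K q WeylGen.u * gen K q WeylGen.v * gen K q WeylGen.uInv * gen K q WeylGen.vInv
    * gen K q WeylGen.uInv * gen K q WeylGen.vInv * gen K q WeylGen.uInv * gen K q WeylGen.v
    * gen K q WeylGen.u)

/-- `D = 1 - q - u⁻¹ v⁻¹`. -/
noncomputable def D (K : Type*) [CommRing K] (q : K) : QuantumWeyl K q :=
  1 - algebraMap K (QuantumWeyl K q) q - gen K q WeylGen.uInv * gen K q WeylGen.vInv

end QuantumWeyl

/-! ## Oriented surfaces -/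

/-- A map of the plane, injective and continuous near `z`, preserves the orientation at `z`: the
image of every small positively oriented circle around `z` winds exactly once, in the positive
direction, around the image of `z` (`θ` is a continuous choice of the argument). -/
def OrientationPreservingAt (f : ℂ → ℂ) (z : ℂ) : Prop :=
  ∀ᶠ r : ℝ in 𝓝[>] 0, ∃ θ : ℝ → ℝ, Continuous θ ∧ θ (2 * Real.pi) = θ 0 + 2 * Real.pi ∧
    ∀ t ∈ Icc (0 : ℝ) (2 * Real.pi),
      f (z + r * Complex.exp (t * Complex.I)) - f z =
        ‖f (z + r * Complex.exp (t * Complex.I)) - f z‖ * Complex.exp (θ t * Complex.I)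

/-- A compact oriented surface without boundary (not necessarily connected): a compact Hausdorff
space with a maximal oriented atlas of charts with values in the plane `ℂ`. -/
structure OrientedSurface : Type (u + 1) where
  carrier : Type u
  [top : TopologicalSpace carrier]
  [compact : CompactSpace carrier]
  [hausdorff : T2Space carrier]
  /-- the positively oriented charts -/
  charts : Set (OpenPartialHomeomorph carrier ℂ)
  cover : ∀ p : carrier, ∃ e ∈ charts, p ∈ e.source
  compatible : ∀ e ∈ charts, ∀ e' ∈ charts, ∀ p ∈ e.source ∩ e'.source,
    OrientationPreservingAt (e' ∘ e.symm) (e p)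
  maximal : ∀ e : OpenPartialHomeomorph carrier ℂ,
    (∀ e' ∈ charts, ∀ p ∈ e.source ∩ e'.source,
      OrientationPreservingAt (e' ∘ e.symm) (e p) ∧
      OrientationPreservingAt (e ∘ e'.symm) (e' p)) → e ∈ charts

instance : CoeSort OrientedSurface.{u} (Type u) := ⟨OrientedSurface.carrier⟩

instance (X : OrientedSurface.{u}) : TopologicalSpace X := X.top

instance (X : OrientedSurface.{u}) : CompactSpace X := X.compact

instance (X : OrientedSurface.{u}) : T2Space X := X.hausdorff

/-- `f` is orientation preserving on `V`: on every open set in `V` where it is injective it carries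
positive charts to positive charts. -/
def OrientationPreservingOn {X X' : OrientedSurface.{u}} (f : X → X') (V : Set X) : Prop :=
  ∀ e ∈ X.charts, e.source ⊆ V → InjOn f e.source →
    ∃ e' ∈ X'.charts, e'.source = f '' e.source ∧ ∀ p ∈ e.source, e' (f p) = e p

/-! ## Link diagrams on surfaces -/

/-- The disjoint union of `n` circles, each oriented counterclockwise. -/
abbrev Circles (n : ℕ) : Type := Fin n × Circle

/-- Move the point `x` by the angle `s` along its circle, in the positive direction if `0 < s`. -/
noncomputable def advance {n : ℕ} (x : Circles n) (s : ℝ) : Circles n :=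
  (x.1, Circle.exp s * x.2)

/-- The points of the circles that are sent to the double points of `γ`. -/
def doublePreimages {X : OrientedSurface.{u}} {n : ℕ} (γ : Circles n → X) : Set (Circles n) :=
  {x | ∃ y, y ≠ x ∧ γ y = γ x}

/-- The branches of `γ` at `x` and at `y` meet transversely in the point `γ x = γ y`, and the pair
(direction at `x`, direction at `y`) is positively oriented: in some positive chart the two
branches are straight, with directions `a` and `b` such that `(a, b)` is a positive basis of the
plane. So the branch at `y` crosses the branch at `x` from the right to the left. -/
def PositivelyTransverse {X : OrientedSurface.{u}} {n : ℕ} (γ : Circles n → X)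
    (x y : Circles n) : Prop :=
  x ≠ y ∧ γ x = γ y ∧ ∃ e ∈ X.charts, γ x ∈ e.source ∧
    ∃ a b : ℂ, 0 < a.re * b.im - a.im * b.re ∧
    ∃ α β : ℝ → ℝ, StrictMono α ∧ StrictMono β ∧ ∀ᶠ s : ℝ in 𝓝 0,
      e (γ (advance x s)) = e (γ x) + α s * a ∧ e (γ (advance y s)) = e (γ x) + β s * b

/-- An oriented link diagram with `n` components on the surface `X`: `n` closed curves in general
position, whose only multiple points are finitely many transverse double points, with the
information which of the two branches at each double point is the over branch. -/
structure LinkDiagram (X : OrientedSurface.{u}) (n : ℕ) : Type u where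
  γ : Circles n → X
  continuous_γ : Continuous γ
  finite_double : (doublePreimages γ).Finite
  no_triple : ∀ x y z, γ x = γ y → γ y = γ z → x = y ∨ y = z ∨ x = z
  transverse : ∀ x y, x ≠ y → γ x = γ y →
    PositivelyTransverse γ x y ∨ PositivelyTransverse γ y x
  /-- the preimages of the double points that lie on the over branch -/
  overPass : Set (Circles n)
  overPass_subset : overPass ⊆ doublePreimages γ
  overPass_iff : ∀ x y, x ≠ y → γ x = γ y → (x ∈ overPass ↔ y ∉ overPass)

/-! ## Stable equivalence -/

/-- The closed square `[-1, 1]²`. -/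
def square : Set ℂ := {z | |z.re| ≤ 1 ∧ |z.im| ≤ 1}

/-- The point at time `t ∈ [-1, 1]` of the segment of a circle with centre `x` and signed radius
`r`; for `r < 0` the segment is traversed against the orientation of the circle. -/
noncomputable def segmentPoint {n : ℕ} (x : Circles n) (r t : ℝ) : Circles n := advance x (r * t)

/-- `L` and `L'` coincide outside a closed disc of the surface, which a positive chart `e` maps to
the square, and inside the disc they are the pictures `T` and `T'`, each made of `k` strands,
parametrized by `[-1, 1]`. The strands may have any orientations (the signs of the `r i`), and
at a crossing of two different strands `i`, `j` the one with the greater height is the over strand.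
At a self-crossing of a strand the over branch is arbitrary. -/
def LocalMove {X : OrientedSurface.{u}} {n k : ℕ} (T T' : Fin k → ℝ → ℂ)
    (L L' : LinkDiagram X n) : Prop :=
  ∃ e ∈ X.charts, ∃ (c : Fin k → Circles n) (r : Fin k → ℝ) (height : Equiv.Perm (Fin k)),
    square ⊆ e.target ∧
    (∀ i, r i ≠ 0 ∧ |r i| < Real.pi) ∧
    (∀ i j, ∀ s ∈ Icc (-1 : ℝ) 1, ∀ t ∈ Icc (-1 : ℝ) 1,
      segmentPoint (c i) (r i) s = segmentPoint (c j) (r j) t → i = j) ∧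
    (∀ x, L.γ x ∈ e.symm '' square ↔ ∃ i, ∃ t ∈ Icc (-1 : ℝ) 1, x = segmentPoint (c i) (r i) t) ∧
    (∀ x, L'.γ x ∈ e.symm '' square ↔ ∃ i, ∃ t ∈ Icc (-1 : ℝ) 1, x = segmentPoint (c i) (r i) t) ∧
    (∀ i, ∀ t ∈ Icc (-1 : ℝ) 1,
      L.γ (segmentPoint (c i) (r i) t) = e.symm (T i t) ∧
      L'.γ (segmentPoint (c i) (r i) t) = e.symm (T' i t)) ∧
    (∀ x, L.γ x ∉ e.symm '' square → L.γ x = L'.γ x ∧ (x ∈ L.overPass ↔ x ∈ L'.overPass)) ∧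
    (∀ i j, i ≠ j → ∀ s ∈ Icc (-1 : ℝ) 1, ∀ t ∈ Icc (-1 : ℝ) 1,
      (T i s = T j t → (segmentPoint (c i) (r i) s ∈ L.overPass ↔ height j < height i)) ∧
      (T' i s = T' j t → (segmentPoint (c i) (r i) s ∈ L'.overPass ↔ height j < height i)))

/-- One strand without crossings. -/
noncomputable def reidemeisterOne : Fin 1 → ℝ → ℂ := fun _ t => ⟨t / 2, |t|⟩

/-- One strand with a kink; its self-crossing `i / 2` is passed at the times `± 1 / 2`. -/
noncomputable def reidemeisterOne' : Fin 1 → ℝ → ℂ :=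
  fun _ t => ⟨t - |t + 1 / 4| + |t - 1 / 4|, |t|⟩

/-- Two disjoint strands. -/
noncomputable def reidemeisterTwo : Fin 2 → ℝ → ℂ :=
  ![fun t => ⟨t, (1 + |t|) / 2⟩, fun t => ⟨t, 0⟩]

/-- Two strands that cross in the two points `± 1 / 2` and bound a bigon. -/
noncomputable def reidemeisterTwo' : Fin 2 → ℝ → ℂ :=
  ![fun t => ⟨t, 2 * |t| - 1⟩, fun t => ⟨t, 0⟩]

/-- The two diagonals of the square and a third strand, which passes above the centre. -/
noncomputable def reidemeisterThree : Fin 3 → ℝ → ℂ :=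
  ![fun t => ⟨t, (1 - |t|) / 2⟩, fun t => ⟨t, t⟩, fun t => ⟨t, -t⟩]

/-- The two diagonals of the square and a third strand, which passes below the centre. -/
noncomputable def reidemeisterThree' : Fin 3 → ℝ → ℂ :=
  ![fun t => ⟨t, -((1 - |t|) / 2)⟩, fun t => ⟨t, t⟩, fun t => ⟨t, -t⟩]

/-- The three Reidemeister moves (in one direction). -/
def ReidemeisterMove {X : OrientedSurface.{u}} {n : ℕ} (L L' : LinkDiagram X n) : Prop :=
  LocalMove reidemeisterOne reidemeisterOne' L L' ∨
  LocalMove reidemeisterTwo reidemeisterTwo' L L' ∨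
  LocalMove reidemeisterThree reidemeisterThree' L L'

/-- `L'` is the image of `L` under an orientation preserving homeomorphism `h` of the surfaces, up
to a reparametrization `ψ` of the circles which preserves their orientations. -/
def Transfer {X X' : OrientedSurface.{u}} {n n' : ℕ} (L : LinkDiagram X n)
    (L' : LinkDiagram X' n') : Prop :=
  ∃ (h : X ≃ₜ X') (ψ : Circles n ≃ₜ Circles n'),
    OrientationPreservingOn h univ ∧
    (∀ x, ∃ α : ℝ → ℝ, Continuous α ∧ StrictMono α ∧
      ∀ s, ψ (advance x s) = advance (ψ x) (α s)) ∧
    (∀ x, L'.γ (ψ x) = h (L.γ x)) ∧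
    (∀ x, x ∈ L.overPass ↔ ψ x ∈ L'.overPass)

/-- The surface `X'` is obtained from `X` by attaching a 1-handle away from the diagram `L`, and
`L'` is the diagram `L` in `X'`. In the disjoint discs `|z| ≤ 2` of two positive charts `e₀`, `e₁`,
which do not meet `L`, one removes the smaller discs `|z| ≤ 1 / 2` and glues the remaining annuli by
the orientation preserving homeomorphism `z ↦ 1 / z`; the result is `X'`, with quotient map `π`. -/
def AttachHandle {X X' : OrientedSurface.{u}} {n : ℕ} (L : LinkDiagram X n)
    (L' : LinkDiagram X' n) : Prop :=
  ∃ e₀ ∈ X.charts, ∃ e₁ ∈ X.charts, ∃ (π : X → X') (V : Set X),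
    Metric.closedBall 0 2 ⊆ e₀.target ∧ Metric.closedBall 0 2 ⊆ e₁.target ∧
    Disjoint (e₀.symm '' Metric.closedBall 0 2) (e₁.symm '' Metric.closedBall 0 2) ∧
    V = (e₀.symm '' Metric.closedBall 0 (1 / 2) ∪ e₁.symm '' Metric.closedBall 0 (1 / 2))ᶜ ∧
    ContinuousOn π V ∧ (∀ U ⊆ V, IsOpen U → IsOpen (π '' U)) ∧ π '' V = univ ∧
    (∀ p ∈ V, ∀ p' ∈ V, π p = π p' ↔ p = p' ∨ ∃ z : ℂ, 1 / 2 < ‖z‖ ∧ ‖z‖ < 2 ∧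
      ((p = e₀.symm z ∧ p' = e₁.symm z⁻¹) ∨ (p' = e₀.symm z ∧ p = e₁.symm z⁻¹))) ∧
    OrientationPreservingOn π V ∧
    (∀ x, L.γ x ∉ e₀.symm '' Metric.closedBall 0 2 ∪ e₁.symm '' Metric.closedBall 0 2) ∧
    (∀ x, L'.γ x = π (L.γ x)) ∧
    L'.overPass = L.overPass

/-- A link diagram on some compact oriented surface. -/
structure SurfaceLink : Type (u + 1) where
  surface : OrientedSurface.{u}
  components : ℕ
  diagram : LinkDiagram surface components

/-- One elementary operation on link diagrams on surfaces. -/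
inductive StableStep : SurfaceLink.{u} → SurfaceLink.{u} → Prop
  | reidemeister {X : OrientedSurface.{u}} {n : ℕ} (L L' : LinkDiagram X n) :
      ReidemeisterMove L L' → StableStep ⟨X, n, L⟩ ⟨X, n, L'⟩
  | transfer {X X' : OrientedSurface.{u}} {n n' : ℕ} (L : LinkDiagram X n)
      (L' : LinkDiagram X' n') : Transfer L L' → StableStep ⟨X, n, L⟩ ⟨X', n', L'⟩
  | handle {X X' : OrientedSurface.{u}} {n : ℕ} (L : LinkDiagram X n)
      (L' : LinkDiagram X' n) : AttachHandle L L' → StableStep ⟨X, n, L⟩ ⟨X', n, L'⟩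

/-- Stable equivalence: a finite sequence of elementary operations and their inverses. A virtual
link is a stable equivalence class. -/
def StablyEquivalent : SurfaceLink.{u} → SurfaceLink.{u} → Prop := Relation.EqvGen StableStep

/-! ## The module of a link diagram -/

namespace LinkDiagram

/-- The arcs: the components of the diagram with the double points removed. The circles without
the preimages of the double points are homeomorphic, by `γ`, to the diagram without the double
points, so that the components are taken there. -/
def Arc {X : OrientedSurface.{u}} {n : ℕ} (L : LinkDiagram X n) : Type :=
  ConnectedComponents {x : Circles n // x ∉ doublePreimages L.γ}

/-- The arc `c` ends at the point `x` (an input arc of the crossing `γ x`). -/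
def IsInput {X : OrientedSurface.{u}} {n : ℕ} (L : LinkDiagram X n) (x : Circles n)
    (c : L.Arc) : Prop :=
  ∀ᶠ s : ℝ in 𝓝[>] 0, ∃ h : advance x (-s) ∉ doublePreimages L.γ,
    (ConnectedComponents.mk ⟨advance x (-s), h⟩ : L.Arc) = c

/-- The arc `c` starts at the point `x` (an output arc of the crossing `γ x`). -/
def IsOutput {X : OrientedSurface.{u}} {n : ℕ} (L : LinkDiagram X n) (x : Circles n)
    (c : L.Arc) : Prop :=
  ∀ᶠ s : ℝ in 𝓝[>] 0, ∃ h : advance x s ∉ doublePreimages L.γ,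
    (ConnectedComponents.mk ⟨advance x s, h⟩ : L.Arc) = c

/-- The relations of the crossings. For a positively transverse pair `(x, y)` the branch at `x`
arrives from the left and leaves to the right, the branch at `y` arrives from the right and leaves
to the left. The crossing is positive if the branch at `x` is the over branch. With
`S = (A, B; C, D)`, the pair (left output, right output) is `S` applied to
(left input, right input) at a positive crossing, and the pair of inputs is `S` applied to the
pair of outputs at a negative crossing. -/
inductive IsRelation {X : OrientedSurface.{u}} {n : ℕ} {R : Type*} [Ring R] (A B C D : R)
    (L : LinkDiagram X n) : (L.Arc →₀ R) → Prop
  | pos_left (x y : Circles n) (inL inR outL outR : L.Arc) :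
      PositivelyTransverse L.γ x y → x ∈ L.overPass →
      L.IsInput x inL → L.IsInput y inR → L.IsOutput y outL → L.IsOutput x outR →
      IsRelation A B C D L (A • Finsupp.single inL 1 + B • Finsupp.single inR 1
        - Finsupp.single outL 1)
  | pos_right (x y : Circles n) (inL inR outL outR : L.Arc) :
      PositivelyTransverse L.γ x y → x ∈ L.overPass →
      L.IsInput x inL → L.IsInput y inR → L.IsOutput y outL → L.IsOutput x outR →
      IsRelation A B C D L (C • Finsupp.single inL 1 + D • Finsupp.single inR 1
        - Finsupp.single outR 1)
  | neg_left (x y : Circles n) (inL inR outL outR : L.Arc) :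
      PositivelyTransverse L.γ x y → y ∈ L.overPass →
      L.IsInput x inL → L.IsInput y inR → L.IsOutput y outL → L.IsOutput x outR →
      IsRelation A B C D L (A • Finsupp.single outL 1 + B • Finsupp.single outR 1
        - Finsupp.single inL 1)
  | neg_right (x y : Circles n) (inL inR outL outR : L.Arc) :
      PositivelyTransverse L.γ x y → y ∈ L.overPass →
      L.IsInput x inL → L.IsInput y inR → L.IsOutput y outL → L.IsOutput x outR →
      IsRelation A B C D L (C • Finsupp.single outL 1 + D • Finsupp.single outR 1
        - Finsupp.single inR 1)

/-- The left `R`-module `M_{A,B,C,D}(L)`: the free module on the arcs modulo the relations of the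
crossings. -/
abbrev LinkModule {X : OrientedSurface.{u}} {n : ℕ} {R : Type*} [Ring R] (A B C D : R)
    (L : LinkDiagram X n) : Type _ :=
  (L.Arc →₀ R) ⧸ Submodule.span R {w | IsRelation A B C D L w}

end LinkDiagram

/-!
The module `M_{A,B,C,D}(L)` represents the colourings of `L`: a linear map from it to a module `N` is
a function on the arcs with values in `N` that satisfies the relation `switchRel` at all crossings.
So it is enough to match the colourings of two diagrams in an arbitrary module, which is made
precise in `LinkDiagram.nonempty_linkModule_equiv`. A colouring is treated as a function on the
circles which is locally constant away from the preimages of the double points.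

Whether a crossing is positive, and which of its arcs are the left ones, depends on the order of the
two branches that is positively transverse in some chart. This order is unique
(`PositivelyTransverse.asymm`): a change of charts preserves the orientation in the sense of winding
numbers and carries two transverse straight branches to straight branches, and counting how often
the image of a small circle meets the line of the first branch shows that the direction of the
second branch stays on the same side (`OrientationPreservingAt.det_pos`). Consequently a homeomorphism
that preserves the orientation, and equally the attachment of a handle away from the diagram, carries
crossings with their relations to each other (`Transfer.nonempty_linkModule_equiv`,
`AttachHandle.nonempty_linkModule_equiv`); a curve may be traversed with another parametrization,
since a colouring has a value immediately before and after every point.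

A Reidemeister move replaces one picture in a disc by another. Restricting a colouring to the disc
gives a colouring of the picture, and a colouring of the other picture with the same values at the
ends of the strands can be glued in (`LinkDiagram.IsColouring.exists_glue`). Hence the move leaves the
module unchanged as soon as the colourings of the two pictures have the same boundary values and are
determined by them (`LocalMove.nonempty_linkModule_equiv`). For the three pairs of pictures this is
a statement about the relation of a crossing, collected in `CrossingRel.IsBiquandle`: it is a bijection
from each pair of adjacent ends to the opposite pair, kinks can be inserted in a unique way, and the
Yang–Baxter equation holds. All orientations and heights of the strands in the third move follow from
a single one, by rotating the picture, turning strands around and exchanging the heights of strands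
(`CrossingRel.IsBiquandle.yangBaxter_cross`).

It remains to see that the switch of the quantum Weyl algebra has these properties
(`QuantumWeyl.isBiquandle`). With `x = u⁻¹ v⁻¹` the relation `u v - q v u = 1` yields
`A (q + x) = x`, `u x u⁻¹ = A`, `D = 1 - q - x` and `C = (q + x) (1 - x) u⁻¹`. Every condition becomes,
after moving all powers of `u` to one side, an identity between the commuting elements `uⁿ x u⁻ⁿ`.
-/

/-! ### Crossing relations and the third Reidemeister move -/

namespace CrossingRel

variable {N : Type*}

/-- The relation `F x y x' y'` is the graph of a bijection `(x, y) ↦ (x', y')`. -/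
structure IsBijective (F : N → N → N → N → Prop) : Prop where
  exists_right : ∀ x y, ∃ x' y', F x y x' y'
  exists_left : ∀ x' y', ∃ x y, F x y x' y'
  unique_right : ∀ {x y a b c d}, F x y a b → F x y c d → a = c ∧ b = d
  unique_left : ∀ {x y a b c d}, F a b x y → F c d x y → a = c ∧ b = d

/-- The Yang–Baxter equation `H₀₁ ∘ G₂₁ ∘ F₂₀ = F₂₀ ∘ G₂₁ ∘ H₀₁` for relations, on three strands
which are called `2`, `0`, `1` from top to bottom at their left ends `l` and which have the right
ends `r`. -/
def YangBaxter (F G H : N → N → N → N → Prop) : Prop :=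
  ∀ l₂ l₀ l₁ r₂ r₀ r₁,
    (∃ z₂ z₀ z₁, F l₂ l₀ z₂ z₀ ∧ G z₂ l₁ r₂ z₁ ∧ H z₀ z₁ r₀ r₁) ↔
    (∃ z₂ z₀ z₁, H l₀ l₁ z₀ z₁ ∧ G l₂ z₁ z₂ r₁ ∧ F z₂ z₀ r₂ r₀)

/-- Rotating the picture of the Yang–Baxter equation by 60 degrees exchanges its two sides. -/
theorem YangBaxter.rotate {F G H : N → N → N → N → Prop} (h : YangBaxter F G H) :
    YangBaxter H (fun x y x' y' => F y' x y x') (fun x y x' y' => G y' x y x') := by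
  intro l₂ l₀ l₁ r₂ r₀ r₁
  have := h r₁ l₂ l₀ l₁ r₂ r₀
  constructor
  · rintro ⟨z₂, z₀, z₁, h1, h2, h3⟩
    obtain ⟨a, b, c, h4, h5, h6⟩ := this.2 ⟨z₁, z₂, z₀, h1, h3, h2⟩
    exact ⟨b, c, a, h5, h4, h6⟩
  · rintro ⟨z₂, z₀, z₁, h1, h2, h3⟩
    obtain ⟨a, b, c, h4, h5, h6⟩ := this.1 ⟨z₁, z₂, z₀, h2, h1, h3⟩
    exact ⟨b, c, a, h4, h6, h5⟩

/-- Turning around the strand `2`: the relation `H` is carried over to the other side of the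
equations. -/
theorem YangBaxter.flip {F G H : N → N → N → N → Prop} (h : YangBaxter F G H)
    (hH : IsBijective H) :
    YangBaxter (fun x y x' y' => F x y' x' y) (fun x y x' y' => G x y' x' y) H := by
  intro l₂ l₀ l₁ r₂ r₀ r₁
  constructor
  · rintro ⟨z₂, z₀, z₁, h1, h2, h3⟩
    obtain ⟨a, b, h4⟩ := hH.exists_right l₀ l₁
    obtain ⟨w₂, w₀, w₁, h5, h6, h7⟩ := (h l₂ z₀ z₁ r₂ a b).1 ⟨z₂, l₀, l₁, h1, h2, h4⟩
    obtain ⟨rfl, rfl⟩ := hH.unique_right h3 h5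
    exact ⟨w₂, a, b, h4, h6, h7⟩
  · rintro ⟨z₂, z₀, z₁, h1, h2, h3⟩
    obtain ⟨a, b, h4⟩ := hH.exists_left r₀ r₁
    obtain ⟨w₂, w₀, w₁, h5, h6, h7⟩ := (h l₂ a b r₂ z₀ z₁).2 ⟨z₂, r₀, r₁, h4, h2, h3⟩
    obtain ⟨rfl, rfl⟩ := hH.unique_left h1 h7
    exact ⟨w₂, a, b, h5, h6, h4⟩

/-- Exchanging the heights of the strands `2` and `0`: the relation `F` is replaced by its
inverse. -/
theorem YangBaxter.swap {F G H : N → N → N → N → Prop} (h : YangBaxter F G H)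
    (hF : IsBijective F) : YangBaxter (fun x y x' y' => F y' x' y x) H G := by
  intro l₂ l₀ l₁ r₂ r₀ r₁
  constructor
  · rintro ⟨z₂, z₀, z₁, h1, h2, h3⟩
    obtain ⟨a, b, h4⟩ := hF.exists_right r₀ r₂
    obtain ⟨w₂, w₀, w₁, h5, h6, h7⟩ := (h z₀ z₂ l₁ a b r₁).2 ⟨r₀, r₂, z₁, h2, h3, h4⟩
    obtain ⟨rfl, rfl⟩ := hF.unique_right h1 h5
    exact ⟨b, a, w₁, h6, h7, h4⟩
  · rintro ⟨z₂, z₀, z₁, h1, h2, h3⟩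
    obtain ⟨a, b, h4⟩ := hF.exists_left l₀ l₂
    obtain ⟨w₂, w₀, w₁, h5, h6, h7⟩ := (h a b l₁ z₀ z₂ r₁).1 ⟨l₀, l₂, z₁, h4, h1, h2⟩
    obtain ⟨rfl, rfl⟩ := hF.unique_left h3 h7
    exact ⟨b, a, w₁, h4, h5, h6⟩

/-- The properties of the relation `P a b a' b'` between the colours `a`, `a'` of the input and the
output of the over strand and the colours `b`, `b'` of the input and the output of the under strand
at a positive crossing which make the colourings of diagrams invariant under Reidemeister moves. -/
structure IsBiquandle (P : N → N → N → N → Prop) : Prop where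
  bijective : IsBijective P
  bijective_sideways : IsBijective fun x y x' y' => P x y' x' y
  yangBaxter : YangBaxter P P P
  exists_kink_under : ∀ a, ∃ l, P a l l a
  exists_kink_over : ∀ a, ∃ l, P l a a l
  kink_under : ∀ {a b l}, P a l l b → a = b
  kink_over : ∀ {a b l}, P l a b l → a = b
  kink_under_unique : ∀ {a l m}, P a l l a → P a m m a → l = m
  kink_over_unique : ∀ {a l m}, P l a a l → P m a a m → l = m

/-- The relation between the colours at a crossing of two unoriented strands, the first of which
comes from the upper left and the second of which comes from the lower left. The colours of the left
ends are `x`, `y`, those of the right ends are `x'`, `y'`; the flags `ex` and `ey` say whether the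
strands are oriented to the right, and the flag `o` says whether the first strand is the over
strand. The crossing is positive if exactly one or all three of the flags hold, and a negative
crossing has the relation `P` with the roles of inputs and outputs exchanged. -/
def cross (P : N → N → N → N → Prop) : (ex ey o : Bool) → N → N → N → N → Prop
  | true, true, true, x, y, x', y' => P x y x' y'
  | true, true, false, x, y, x', y' => P y' x' y x
  | false, false, true, x, y, x', y' => P x' y' x y
  | false, false, false, x, y, x', y' => P y x y' x'
  | true, false, false, x, y, x', y' => P y' x y x'
  | true, false, true, x, y, x', y' => P x' y x y'
  | false, true, false, x, y, x', y' => P y x' y' x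
  | false, true, true, x, y, x', y' => P x y' x' y

variable {P : N → N → N → N → Prop}

theorem cross_rotate (ex ey o : Bool) :
    cross P ey (!ex) (!o) = fun x y x' y' => cross P ex ey o y' x y x' := by
  cases ex <;> cases ey <;> cases o <;> rfl

theorem cross_flip (ex ey o : Bool) :
    cross P (!ex) ey o = fun x y x' y' => cross P ex ey o x y' x' y := by
  cases ex <;> cases ey <;> cases o <;> rfl

theorem cross_swap (ex ey o : Bool) :
    cross P ey ex (!o) = fun x y x' y' => cross P ex ey o y' x' y x := by
  cases ex <;> cases ey <;> cases o <;> rfl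

theorem IsBijective.symm {F : N → N → N → N → Prop} (h : IsBijective F) :
    IsBijective fun x y x' y' => F x' y' x y :=
  ⟨h.exists_left, h.exists_right, h.unique_left, h.unique_right⟩


theorem IsBijective.comm {F : N → N → N → N → Prop} (h : IsBijective F) :
    IsBijective fun x y x' y' => F y x y' x' where
  exists_right x y := (h.exists_right y x).elim fun a ⟨b, hb⟩ => ⟨b, a, hb⟩
  exists_left x y := (h.exists_left y x).elim fun a ⟨b, hb⟩ => ⟨b, a, hb⟩
  unique_right h1 h2 := (h.unique_right h1 h2).symm
  unique_left h1 h2 := (h.unique_left h1 h2).symm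

theorem IsBiquandle.cross_bijective (hP : IsBiquandle P) (ex ey o : Bool) :
    IsBijective (cross P ex ey o) := by
  have h1 := hP.bijective
  have h2 := hP.bijective_sideways
  cases ex <;> cases ey <;> cases o
  · exact h1.comm
  · exact h1.symm
  · exact h2.comm
  · exact h2
  · exact h2.symm.comm
  · exact h2.symm
  · exact h1.symm.comm
  · exact h1

theorem IsBiquandle.exists_cross_kink (hP : IsBiquandle P) (e o : Bool) (a : N) :
    ∃ l, cross P e e o a l l a := by
  cases e <;> cases o
  · exact hP.exists_kink_over a
  · exact hP.exists_kink_over a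
  · exact hP.exists_kink_under a
  · exact hP.exists_kink_under a

theorem IsBiquandle.cross_kink (hP : IsBiquandle P) {e o : Bool} {a b l : N}
    (h : cross P e e o a l l b) : a = b := by
  cases e <;> cases o
  · exact hP.kink_over h
  · exact (hP.kink_over h).symm
  · exact (hP.kink_under h).symm
  · exact hP.kink_under h

theorem IsBiquandle.cross_kink_unique (hP : IsBiquandle P) {e o : Bool} {a l m : N}
    (h : cross P e e o a l l a) (h' : cross P e e o a m m a) : l = m := by
  cases e <;> cases o
  · exact hP.kink_over_unique h h'
  · exact hP.kink_over_unique h h'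
  · exact hP.kink_under_unique h h'
  · exact hP.kink_under_unique h h'

/-- The Yang–Baxter equation of a biquandle holds for all orientations of the three strands and for
all heights; the condition on the flags `o` excludes that they are cyclic. It is obtained from the
equation for `P` by rotating the picture, turning around strands and exchanging heights. -/
theorem IsBiquandle.yangBaxter_cross (hP : IsBiquandle P) (e₂ e₀ e₁ o₂₀ o₂₁ o₀₁ : Bool)
    (ho : o₂₀ = o₀₁ → o₂₁ = o₂₀) :
    YangBaxter (cross P e₂ e₀ o₂₀) (cross P e₂ e₁ o₂₁) (cross P e₀ e₁ o₀₁) := by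
  have hrot : ∀ e₂ e₀ e₁ o₂₀ o₂₁ o₀₁,
      YangBaxter (cross P e₂ e₀ o₂₀) (cross P e₂ e₁ o₂₁) (cross P e₀ e₁ o₀₁) →
      YangBaxter (cross P e₀ e₁ o₀₁) (cross P e₀ (!e₂) (!o₂₀)) (cross P e₁ (!e₂) (!o₂₁)) := by
    intro e₂ e₀ e₁ o₂₀ o₂₁ o₀₁ h
    rw [cross_rotate, cross_rotate]
    exact h.rotate
  have hflip₂ : ∀ e₂ e₀ e₁ o₂₀ o₂₁ o₀₁,
      YangBaxter (cross P e₂ e₀ o₂₀) (cross P e₂ e₁ o₂₁) (cross P e₀ e₁ o₀₁) →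
      YangBaxter (cross P (!e₂) e₀ o₂₀) (cross P (!e₂) e₁ o₂₁) (cross P e₀ e₁ o₀₁) := by
    intro e₂ e₀ e₁ o₂₀ o₂₁ o₀₁ h
    rw [cross_flip, cross_flip]
    exact h.flip (hP.cross_bijective _ _ _)
  -- six rotations by 60 degrees are the identity; turn around a strand after one or two of them
  have hflip₀ : ∀ e₂ e₀ e₁ o₂₀ o₂₁ o₀₁,
      YangBaxter (cross P e₂ e₀ o₂₀) (cross P e₂ e₁ o₂₁) (cross P e₀ e₁ o₀₁) →
      YangBaxter (cross P e₂ (!e₀) o₂₀) (cross P e₂ e₁ o₂₁) (cross P (!e₀) e₁ o₀₁) := by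
    intro e₂ e₀ e₁ o₂₀ o₂₁ o₀₁ h
    simpa using hrot _ _ _ _ _ _ <| hrot _ _ _ _ _ _ <| hrot _ _ _ _ _ _ <| hrot _ _ _ _ _ _ <|
      hrot _ _ _ _ _ _ <| hflip₂ _ _ _ _ _ _ <| hrot _ _ _ _ _ _ h
  have hflip₁ : ∀ e₂ e₀ e₁ o₂₀ o₂₁ o₀₁,
      YangBaxter (cross P e₂ e₀ o₂₀) (cross P e₂ e₁ o₂₁) (cross P e₀ e₁ o₀₁) →
      YangBaxter (cross P e₂ e₀ o₂₀) (cross P e₂ (!e₁) o₂₁) (cross P e₀ (!e₁) o₀₁) := by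
    intro e₂ e₀ e₁ o₂₀ o₂₁ o₀₁ h
    simpa using hrot _ _ _ _ _ _ <| hrot _ _ _ _ _ _ <| hrot _ _ _ _ _ _ <| hrot _ _ _ _ _ _ <|
      hflip₂ _ _ _ _ _ _ <| hrot _ _ _ _ _ _ <| hrot _ _ _ _ _ _ h
  have hall : ∀ o₂₀ o₂₁ o₀₁,
      YangBaxter (cross P true true o₂₀) (cross P true true o₂₁) (cross P true true o₀₁) →
      ∀ e₂ e₀ e₁,
      YangBaxter (cross P e₂ e₀ o₂₀) (cross P e₂ e₁ o₂₁) (cross P e₀ e₁ o₀₁) := by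
    intro o₂₀ o₂₁ o₀₁ h
    have h₁ : ∀ e₁, YangBaxter (cross P true true o₂₀) (cross P true e₁ o₂₁)
        (cross P true e₁ o₀₁) := by
      rintro (_ | _)
      exacts [hflip₁ _ _ _ _ _ _ h, h]
    have h₀ : ∀ e₀ e₁, YangBaxter (cross P true e₀ o₂₀) (cross P true e₁ o₂₁)
        (cross P e₀ e₁ o₀₁) := by
      rintro (_ | _) e₁
      exacts [hflip₀ _ _ _ _ _ _ (h₁ e₁), h₁ e₁]
    rintro (_ | _) e₀ e₁
    exacts [hflip₂ _ _ _ _ _ _ (h₀ e₀ e₁), h₀ e₀ e₁]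
  have b1 : ∀ e₂ e₀ e₁,
      YangBaxter (cross P e₂ e₀ true) (cross P e₂ e₁ true) (cross P e₀ e₁ true) :=
    hall _ _ _ hP.yangBaxter
  have b2 : ∀ e₂ e₀ e₁,
      YangBaxter (cross P e₂ e₀ false) (cross P e₂ e₁ true) (cross P e₀ e₁ true) :=
    hall _ _ _ <| by
      have := (b1 true true true).swap (hP.cross_bijective _ _ _)
      rw [← cross_swap] at this
      exact this
  have b3 := hall _ _ _ <| hrot false true true true true true (b1 _ _ _)
  have b4 := hall _ _ _ <| hrot false true true _ _ _ (b3 _ _ _)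
  have b5 := hall _ _ _ <| hrot false true true _ _ _ (b2 _ _ _)
  have b6 := hall _ _ _ <| hrot false true true _ _ _ (b5 _ _ _)
  simp only [Bool.not_true, Bool.not_false] at b3 b4 b5 b6
  cases o₂₀ <;> cases o₂₁ <;> cases o₀₁ <;> simp at ho <;> first
    | exact b1 _ _ _ | exact b2 _ _ _ | exact b3 _ _ _ | exact b4 _ _ _ | exact b5 _ _ _
    | exact b6 _ _ _

end CrossingRel

/-! ### The switch of the quantum Weyl algebra -/

/-- The relation of a positive crossing for colours in a module: `b' = A a + B b` and
`a' = C a + D b`, where the over strand passes from `a` to `a'` and the under strand passes from `b`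
to `b'`. -/
def switchRel {R : Type*} [Ring R] (A B C D : R) {N : Type*} [AddCommGroup N] [Module R N]
    (a b a' b' : N) : Prop :=
  b' = A • a + B • b ∧ a' = C • a + D • b

/-- Conditions on the entries of a switch over a noncommutative ring under which it is a biquandle
on every module: it and its sideways map are bijective if `B`, `C` and `C - D B⁻¹ A` are invertible,
`h1`–`h7` are the entries of the Yang–Baxter equation, and the last two conditions say that the
two ends of a kink have the same colour. -/
theorem isBiquandle_switchRel {R : Type*} [Ring R] {A B C D : R} (hC : IsUnit C)
    (hA1 : IsUnit (1 - A)) (hD1 : IsUnit (1 - D)) {Bi : R} (hBi : Bi * B = 1) (hBr : B * Bi = 1)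
    (hdet : IsUnit (C - D * Bi * A))
    (h1 : A * A + B * A * C = A) (h2 : A * B + B * A * D = B * A)
    (h3 : C * A + D * A * C = A * C) (h4 : C * B + D * A * D = A * D * A + B * C)
    (h5 : D * B = A * D * B + B * D) (h6 : C * D = C * D * A + D * C)
    (h7 : D = C * D * B + D * D)
    (hk1 : ∀ k : R, (1 - D) * k = C → A + B * k = 1)
    (hk2 : ∀ k : R, (1 - A) * k = B → C * k + D = 1)
    {N : Type*} [AddCommGroup N] [Module R N] :
    CrossingRel.IsBiquandle (switchRel A B C D (N := N)) := by
  obtain ⟨Ci, hCr, hCl⟩ := isUnit_iff_exists.1 hC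
  obtain ⟨E, hEr, hEl⟩ := isUnit_iff_exists.1 hdet
  obtain ⟨F, hFr, hFl⟩ := isUnit_iff_exists.1 hA1
  obtain ⟨G, hGr, hGl⟩ := isUnit_iff_exists.1 hD1
  -- solving the equations of the switch for two of the colours
  have solveB : ∀ {a b b' : N}, b' = A • a + B • b ↔ b = Bi • (b' - A • a) := by
    intro a b b'
    constructor
    · rintro rfl
      rw [add_sub_cancel_left, smul_smul, hBi, one_smul]
    · rintro rfl
      rw [smul_smul, hBr, one_smul, add_sub_cancel]
  have solveC : ∀ {a b a' : N}, a' = C • a + D • b ↔ a = Ci • (a' - D • b) := by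
    intro a b a'
    constructor
    · rintro rfl
      rw [add_sub_cancel_right, smul_smul, hCl, one_smul]
    · rintro rfl
      rw [smul_smul, hCr, one_smul, sub_add_cancel]
  have solve : ∀ {a b a' b' : N}, switchRel A B C D a b a' b' ↔
      a = E • (a' - D • Bi • b') ∧ b = Bi • (b' - A • a) := by
    intro a b a' b'
    rw [switchRel, solveB, and_comm]
    refine and_congr_left fun hb => ?_
    have key : C • a + D • b = (C - D * Bi * A) • a + D • Bi • b' := by
      rw [hb, sub_smul, smul_sub, smul_sub, mul_smul, mul_smul]
      abel
    rw [key]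
    constructor
    · rintro rfl
      rw [add_sub_cancel_right, smul_smul, hEl, one_smul]
    · rintro rfl
      rw [smul_smul, hEr, one_smul, sub_add_cancel]
  have fixD : ∀ {a l : N}, l = C • a + D • l ↔ l = G • C • a := by
    intro a l
    have : l = C • a + D • l ↔ (1 - D) • l = C • a := by
      rw [sub_smul, one_smul, sub_eq_iff_eq_add]
    rw [this]
    constructor
    · intro h
      rw [← h, smul_smul, hGl, one_smul]
    · rintro rfl
      rw [smul_smul, hGr, one_smul]
  have fixA : ∀ {a l : N}, l = A • l + B • a ↔ l = F • B • a := by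
    intro a l
    have : l = A • l + B • a ↔ (1 - A) • l = B • a := by
      rw [sub_smul, one_smul, sub_eq_iff_eq_add']
    rw [this]
    constructor
    · intro h
      rw [← h, smul_smul, hFl, one_smul]
    · rintro rfl
      rw [smul_smul, hFr, one_smul]
  have kinkD : ∀ a : N, A • a + B • G • C • a = a := by
    intro a
    rw [smul_smul G, smul_smul B, ← add_smul, hk1 (G * C) (by rw [← mul_assoc, hGr, one_mul]),
      one_smul]
  have kinkA : ∀ a : N, C • F • B • a + D • a = a := by
    intro a
    rw [smul_smul F, smul_smul C, ← add_smul, hk2 (F * B) (by rw [← mul_assoc, hFr, one_mul]),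
      one_smul]
  refine ⟨⟨fun x y => ⟨_, _, rfl, rfl⟩, fun x y => ⟨_, _, solve.2 ⟨rfl, rfl⟩⟩, ?_, ?_⟩,
    ⟨fun x y' => ⟨_, _, solveB.2 rfl, rfl⟩, fun x' y => ⟨_, _, rfl, solveC.2 rfl⟩, ?_, ?_⟩,
    ?_, fun a => ⟨G • C • a, (kinkD a).symm, fixD.2 rfl⟩,
    fun a => ⟨F • B • a, fixA.2 rfl, (kinkA a).symm⟩, ?_, ?_, ?_, ?_⟩
  · rintro x y a b c d ⟨rfl, rfl⟩ ⟨rfl, rfl⟩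
    exact ⟨rfl, rfl⟩
  · intro x y a b c d h h'
    obtain ⟨rfl, rfl⟩ := solve.1 h
    obtain ⟨rfl, rfl⟩ := solve.1 h'
    exact ⟨rfl, rfl⟩
  · rintro x y a b c d ⟨h, rfl⟩ ⟨h', rfl⟩
    rw [solveB] at h h'
    rw [h, h']
    exact ⟨rfl, rfl⟩
  · rintro x y a b c d ⟨rfl, h⟩ ⟨rfl, h'⟩
    rw [solveC] at h h'
    rw [h, h']
    exact ⟨rfl, rfl⟩
  · -- both sides of the Yang–Baxter equation are graphs of linear maps; their coordinates agree
    intro l₂ l₀ l₁ r₂ r₀ r₁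
    have e1 := fun x : N => congrArg (fun r : R => r • x) h1
    have e2 := fun x : N => congrArg (fun r : R => r • x) h2
    have e3 := fun x : N => congrArg (fun r : R => r • x) h3
    have e4 := fun x : N => congrArg (fun r : R => r • x) h4
    have e5 := fun x : N => congrArg (fun r : R => r • x) h5
    have e6 := fun x : N => congrArg (fun r : R => r • x) h6
    have e7 := fun x : N => congrArg (fun r : R => r • x) h7
    simp only [add_smul, mul_smul] at e1 e2 e3 e4 e5 e6 e7
    have c1 : A • (A • l₂ + B • l₀) + B • (A • (C • l₂ + D • l₀) + B • l₁) =
        A • l₂ + B • (A • l₀ + B • l₁) := by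
      simp only [smul_add]
      calc _ = (A • A • l₂ + B • A • C • l₂) + (A • B • l₀ + B • A • D • l₀) + B • B • l₁ := by abel
        _ = A • l₂ + B • A • l₀ + B • B • l₁ := by rw [e1, e2]
        _ = _ := by abel
    have c0 : C • (A • l₂ + B • l₀) + D • (A • (C • l₂ + D • l₀) + B • l₁) =
        A • (C • l₂ + D • (A • l₀ + B • l₁)) + B • (C • l₀ + D • l₁) := by
      simp only [smul_add]
      calc _ = (C • A • l₂ + D • A • C • l₂) + (C • B • l₀ + D • A • D • l₀) + D • B • l₁ := by
            abel
        _ = A • C • l₂ + (A • D • A • l₀ + B • C • l₀) + (A • D • B • l₁ + B • D • l₁) := by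
            rw [e3, e4, ← e5]
        _ = _ := by abel
    have c2 : C • (C • l₂ + D • l₀) + D • l₁ =
        C • (C • l₂ + D • (A • l₀ + B • l₁)) + D • (C • l₀ + D • l₁) := by
      simp only [smul_add]
      calc _ = C • C • l₂ + C • D • l₀ + D • l₁ := by abel
        _ = C • C • l₂ + (C • D • A • l₀ + D • C • l₀) + (C • D • B • l₁ + D • D • l₁) := by
          rw [← e6 l₀, ← e7 l₁]
        _ = _ := by abel
    constructor
    · rintro ⟨z₂, z₀, z₁, ⟨rfl, rfl⟩, ⟨rfl, rfl⟩, rfl, rfl⟩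
      exact ⟨_, _, _, ⟨rfl, rfl⟩, ⟨c1, rfl⟩, c0, c2⟩
    · rintro ⟨z₂, z₀, z₁, ⟨rfl, rfl⟩, ⟨rfl, rfl⟩, rfl, rfl⟩
      exact ⟨_, _, _, ⟨rfl, rfl⟩, ⟨rfl, c2.symm⟩, c1.symm, c0.symm⟩
  · rintro a b l ⟨rfl, h⟩
    rw [fixD.1 h, kinkD]
  · rintro a b l ⟨h, rfl⟩
    rw [fixA.1 h, kinkA]
  · rintro a l m ⟨-, h⟩ ⟨-, h'⟩
    rw [fixD.1 h, fixD.1 h']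
  · rintro a l m ⟨h, -⟩ ⟨h', -⟩
    rw [fixA.1 h, fixA.1 h']

namespace QuantumWeyl

variable {K : Type*} [CommRing K] {q : K}

theorem gen_u_uInv : gen K q .u * gen K q .uInv = 1 := by
  rw [gen, gen, ← map_mul, RingQuot.mkAlgHom_rel K WeylRel.u_uInv, map_one]

theorem gen_uInv_u : gen K q .uInv * gen K q .u = 1 := by
  rw [gen, gen, ← map_mul, RingQuot.mkAlgHom_rel K WeylRel.uInv_u, map_one]

theorem gen_v_vInv : gen K q .v * gen K q .vInv = 1 := by
  rw [gen, gen, ← map_mul, RingQuot.mkAlgHom_rel K WeylRel.v_vInv, map_one]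

theorem gen_vInv_v : gen K q .vInv * gen K q .v = 1 := by
  rw [gen, gen, ← map_mul, RingQuot.mkAlgHom_rel K WeylRel.vInv_v, map_one]

theorem gen_weyl : gen K q .u * gen K q .v = 1 + q • (gen K q .v * gen K q .u) := by
  have := RingQuot.mkAlgHom_rel K (WeylRel.weyl (K := K) (q := q))
  rw [map_sub, map_smul, map_mul, map_mul, map_one] at this
  exact eq_add_of_sub_eq this

/-- The switch of a ring with elements that satisfy the relations of the quantum Weyl algebra is a
biquandle on every module. With `x = u⁻¹ v⁻¹` one has `A (q + x) = x`, `u x u⁻¹ = A`,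
`D = 1 - q - x` and `C = (q + x) (1 - x) u⁻¹`, so that all conditions become identities between the
commuting elements `uⁿ x u⁻ⁿ` after all powers of `u` are moved to one side. -/
theorem isBiquandle_of_relations {W : Type*} [Ring W] {Q u ui v vi A C D : W} (hQ : IsUnit Q)
    (hcomm : ∀ y, Q * y = y * Q) (huui : u * ui = 1) (huiu : ui * u = 1) (hvvi : v * vi = 1)
    (hviv : vi * v = 1) (hweyl : u * v = 1 + Q * (v * u)) (hA : A = vi * ui)
    (hC : C = Q * (u * v * ui * vi * ui * vi * ui * v * u)) (hD : D = 1 - Q - ui * vi)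
    {N : Type*} [AddCommGroup N] [Module W N] :
    CrossingRel.IsBiquandle (switchRel A u C D (N := N)) := by
  obtain ⟨x, hx⟩ : ∃ x, x = ui * vi := ⟨_, rfl⟩
  have hxunit : u * v * x = Q + x := by
    rw [hweyl, add_mul, one_mul, hx]
    have : v * u * (ui * vi) = 1 := by
      rw [mul_assoc, ← mul_assoc u, huui, one_mul, hvvi]
    rw [mul_assoc, this, mul_one, add_comm]
  have hxunit' : x * (u * v) = Q + x := by
    rw [hweyl, mul_add, mul_one, ← mul_assoc, ← hcomm, mul_assoc, hx]
    have : ui * vi * (v * u) = 1 := by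
      rw [mul_assoc, ← mul_assoc vi, hviv, one_mul, huiu]
    rw [this, mul_one, add_comm]
  have hAuv : A * (u * v) = 1 := by
    rw [hA, mul_assoc, ← mul_assoc ui, huiu, one_mul, hviv]
  have huvA : u * v * A = 1 := by
    rw [hA, mul_assoc, ← mul_assoc v, hvvi, one_mul, huui]
  have hAx : A * (Q + x) = x := by rw [← hxunit, ← mul_assoc, hAuv, one_mul]
  have hxA : (Q + x) * A = x := by rw [← hxunit', mul_assoc, huvA, mul_one]
  have hux : u * x = A * u := by
    calc u * x = u * ui * vi := by rw [hx, mul_assoc]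
      _ = vi * (ui * u) := by rw [huui, one_mul, huiu, mul_one]
      _ = A * u := by rw [hA, mul_assoc]
  have huiA : ui * A = x * ui := by rw [hA, hx, mul_assoc]
  have hCx : C = (Q + x) * (1 - x) * ui := by
    have h1 : Q * (ui * vi * ui * v * u) = (1 - x) * ui := by
      calc _ = ui * vi * ui * (Q * (v * u)) := by rw [← mul_assoc _ Q, ← hcomm]; noncomm_ring
        _ = ui * vi * ui * (u * v - 1) := by rw [hweyl, add_sub_cancel_left]
        _ = ui * vi * (ui * u) * v - ui * vi * ui := by noncomm_ring
        _ = (1 - x) * ui := by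
          rw [huiu, mul_one, mul_assoc ui, hviv, hx]; noncomm_ring
    calc C = u * v * (ui * vi) * (Q * (ui * vi * ui * v * u)) := by
          rw [hC, ← mul_assoc _ Q, ← hcomm]; noncomm_ring
      _ = _ := by rw [h1, ← hx, hxunit]; noncomm_ring
  rw [← hx] at hD
  have hu : IsUnit u := ⟨⟨u, ui, huui, huiu⟩, rfl⟩
  have hui : IsUnit ui := ⟨⟨ui, u, huiu, huui⟩, rfl⟩
  have hv : IsUnit v := ⟨⟨v, vi, hvvi, hviv⟩, rfl⟩
  have hvi : IsUnit vi := ⟨⟨vi, v, hviv, hvvi⟩, rfl⟩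
  have hQx : IsUnit (Q + x) := by
    rw [← hxunit, hx]
    exact (hu.mul hv).mul (hui.mul hvi)
  have hCunit : IsUnit C := by
    rw [hC]
    exact hQ.mul <| (((((((hu.mul hv).mul hui).mul hvi).mul hui).mul hvi).mul hui).mul hv).mul hu
  have hxQ := hcomm x
  have hDA : D * A = A - x := by rw [hD, sub_sub, sub_mul, hxA, one_mul]
  have hAD : A * D = A - x := by rw [hD, sub_sub, mul_sub, hAx, mul_one]
  have hCA : C * A = x * C := by
    calc C * A = (Q + x) * (1 - x) * (ui * A) := by rw [hCx, mul_assoc]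
      _ = (x * Q + x * x) * (1 - x) * ui := by rw [huiA, ← hxQ]; noncomm_ring
      _ = x * C := by rw [hCx]; noncomm_ring
  have hA1x : A * u * ui = A := by rw [mul_assoc, huui, mul_one]
  have huC : u * C = (Q + A) * (1 - A) := by
    calc u * C = (u * Q + u * x) * (1 - x) * ui := by rw [hCx]; noncomm_ring
      _ = (Q + A) * u * (1 - x) * ui := by rw [← hcomm, hux]; noncomm_ring
      _ = (Q + A) * (u - u * x) * ui := by noncomm_ring
      _ = (Q + A) * (u * ui - A * u * ui) := by rw [hux]; noncomm_ring
      _ = _ := by rw [hA1x, huui]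
  have hy : x * (Q + ui * x * u) = ui * x * u := by
    calc x * (Q + ui * x * u) = x * (Q * (ui * u)) + x * ui * x * u := by
          rw [huiu]; noncomm_ring
      _ = x * ui * Q * u + x * ui * x * u := by rw [← mul_assoc Q, hcomm ui]; noncomm_ring
      _ = ui * (A * (Q + x)) * u := by rw [← huiA]; noncomm_ring
      _ = ui * x * u := by rw [hAx]
  have hAQ : A * Q = Q * A := (hcomm A).symm
  have hAxA : A * x = x - Q * A := by
    rw [← hAQ]
    exact eq_sub_of_add_eq' (by rw [← mul_add, hAx])
  refine isBiquandle_switchRel hCunit ?_ ?_ huiu huui ?_ ?_ ?_ ?_ ?_ ?_ ?_ ?_ ?_ ?_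
  · have : 1 - A = A * (Q * (v * u)) := by
      rw [← hAuv, hweyl]; noncomm_ring
    rw [this, hA]
    exact (hvi.mul hui).mul (hQ.mul (hv.mul hu))
  · rw [hD, sub_sub, sub_sub_cancel]
    exact hQx
  · have : C - D * ui * A = Q * ui := by
      rw [mul_assoc, huiA, hCx, hD]
      calc _ = (Q + x * Q - Q * x) * ui := by rw [← hxQ]; noncomm_ring
        _ = Q * ui := by rw [hxQ, add_sub_cancel_right]
    rw [this]
    exact hQ.mul hui
  · calc A * A + u * A * C = A * A + u * (A * (Q + x)) * (1 - x) * ui := by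
          rw [hCx]; noncomm_ring
      _ = A * A + A * u * (1 - x) * ui := by rw [hAx, hux]
      _ = A * A + A * (u - u * x) * ui := by noncomm_ring
      _ = A * A + A * (u * ui - A * u * ui) := by rw [hux]; noncomm_ring
      _ = A := by rw [hA1x, huui]; noncomm_ring
  · rw [mul_assoc, hAD, mul_sub, hux, add_sub_cancel]
  · rw [hDA, hCA]; noncomm_ring
  · rw [huC, mul_assoc A D A, hDA, hCx, mul_assoc _ ui, huiu, mul_one, mul_sub A, hAxA, sub_mul,
      hAD, hD]
    calc _ = Q + A + x * Q - Q * x - x := by noncomm_ring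
      _ = Q + A - x := by rw [hxQ, add_sub_cancel_right]
      _ = (Q + A) - A * Q + Q * A - x := by rw [hAQ]; noncomm_ring
      _ = _ := by rw [hAQ]; noncomm_ring
  · rw [hAD, hD, mul_sub, mul_sub, hux, ← hcomm]; noncomm_ring
  · have h : C * D = C - Q * C - C * x := by rw [hD, hcomm]; noncomm_ring
    rw [mul_assoc C D, hDA, mul_sub, hCA, h, hD]; noncomm_ring
  · -- here the commuting elements are `x` and `u⁻¹ x u`
    have : C * D * u = (Q + x) * D := by
      calc C * D * u = (Q + x) * (1 - x) * (ui * u - ui * Q * u - ui * x * u) := by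
            rw [hCx, hD]; noncomm_ring
        _ = (Q + x) * ((1 - x) * (1 - Q - ui * x * u)) := by
            rw [← hcomm, mul_assoc Q, huiu, mul_one, mul_assoc]
        _ = (Q + x) * (1 - Q - x + (x * (Q + ui * x * u) - ui * x * u)) := by noncomm_ring
        _ = (Q + x) * D := by rw [hy, sub_self, add_zero, hD]
    rw [this, ← add_mul, hD]; noncomm_ring
  · intro k hk
    rw [hD, sub_sub, sub_sub_cancel, hCx, mul_assoc] at hk
    rw [hQx.mul_left_cancel hk, ← mul_assoc, mul_sub, mul_one, hux, sub_mul, huui, hA1x]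
    noncomm_ring
  · intro k hk
    have : (1 - x) * ui = ui * (1 - A) := by rw [mul_sub, huiA]; noncomm_ring
    rw [hCx, mul_assoc (Q + x), this, mul_assoc, mul_assoc, hk, huiu, hD]
    noncomm_ring

theorem isBiquandle (hq : IsUnit q) {N : Type*} [AddCommGroup N] [Module (QuantumWeyl K q) N] :
    CrossingRel.IsBiquandle (switchRel (A K q) (B K q) (C K q) (D K q) (N := N)) :=
  isBiquandle_of_relations (hq.map (algebraMap K (QuantumWeyl K q))) (Algebra.commutes q)
    gen_u_uInv gen_uInv_u gen_v_vInv gen_vInv_v (by rw [gen_weyl, Algebra.smul_def]) rfl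
    (by rw [C, Algebra.smul_def]) rfl

end QuantumWeyl

/-! ### Motion along the circles -/

section Advance

variable {n : ℕ}

theorem advance_zero (x : Circles n) : advance x 0 = x := by simp [advance]

theorem advance_advance (x : Circles n) (s t : ℝ) :
    advance (advance x s) t = advance x (s + t) := by
  simp [advance, Circle.exp_add, mul_comm, mul_left_comm]

theorem continuous_advance (x : Circles n) : Continuous (advance x) := by
  unfold advance
  fun_prop

theorem advance_eq_iff {x : Circles n} {s t : ℝ} :
    advance x s = advance x t ↔ ∃ m : ℤ, s = t + m * (2 * Real.pi) := by
  simp [advance, Circle.exp_eq_exp]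

theorem advance_add_two_pi (x : Circles n) (s : ℝ) :
    advance x (s + 2 * Real.pi) = advance x s :=
  advance_eq_iff.2 ⟨1, by simp⟩

theorem advance_inj {x : Circles n} {s t : ℝ} (h : advance x s = advance x t)
    (hst : |s - t| < 2 * Real.pi) : s = t := by
  obtain ⟨m, hm⟩ := advance_eq_iff.1 h
  have hpi := Real.pi_pos
  have : s - t = m * (2 * Real.pi) := by linarith
  rw [this, abs_mul, abs_of_pos (show 0 < 2 * Real.pi by positivity),
    mul_lt_iff_lt_one_left (by positivity)] at hst
  have : m = 0 := Int.abs_lt_one_iff.1 (by exact_mod_cast hst)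
  simp [hm, this]

theorem tendsto_advance (x : Circles n) : Tendsto (advance x) (𝓝 0) (𝓝 x) := by
  have := (continuous_advance x).tendsto 0
  rwa [advance_zero] at this

/-- The points near `x` are those reached from `x` by small motions. -/
theorem map_advance_nhds (x : Circles n) : map (advance x) (𝓝 0) = 𝓝 x := by
  have h1 : map Circle.exp (𝓝 0) = 𝓝 (1 : Circle) := by
    rw [isLocalHomeomorph_circleExp.map_nhds_eq, Circle.exp_zero]
  have h2 : map (fun z : Circle => z * x.2) (𝓝 1) = 𝓝 x.2 := by
    simp
  have h3 : map (Prod.mk x.1) (𝓝 x.2) = 𝓝 x := by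
    rw [← Prod.mk.eta (p := x), nhds_prod_eq, nhds_discrete (Fin n), pure_prod]
  rw [← h3, ← h2, ← h1, map_map, map_map]
  rfl

theorem eventually_nhds_iff_advance {x : Circles n} {p : Circles n → Prop} :
    (∀ᶠ y in 𝓝 x, p y) ↔ ∀ᶠ s in 𝓝 (0 : ℝ), p (advance x s) := by
  rw [← map_advance_nhds x, eventually_map]

/-- Near any point a finite set contains at most the point itself. -/
theorem Set.Finite.eventually_advance_notMem {D : Set (Circles n)} (hD : D.Finite)
    (x : Circles n) : ∀ᶠ s in 𝓝[≠] (0 : ℝ), advance x s ∉ D := by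
  have h1 : ∀ᶠ y in 𝓝 x, y ∉ D \ {x} :=
    (hD.subset sdiff_subset).isClosed.isOpen_compl.mem_nhds (by simp)
  rw [eventually_nhds_iff_advance] at h1
  have h2 : ∀ᶠ s in 𝓝 (0 : ℝ), |s| < 2 * Real.pi :=
    (continuous_abs.tendsto 0).eventually_lt_const (by simpa using Real.pi_pos)
  filter_upwards [nhdsWithin_le_nhds h1, nhdsWithin_le_nhds h2, self_mem_nhdsWithin] with s h1 h2 h3
  intro h
  refine h1 ⟨h, fun h4 => h3 (advance_inj (x := x) ?_ (by simpa using h2))⟩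
  rw [advance_zero]
  exact h4

theorem tendsto_neg_nhdsGT_zero : Tendsto (fun s : ℝ => -s) (𝓝[>] 0) (𝓝[<] 0) := by
  simpa using tendsto_neg_nhdsGT (a := (0 : ℝ))

theorem Set.Finite.eventually_advance_pos {D : Set (Circles n)} (hD : D.Finite)
    (x : Circles n) : ∀ᶠ s in 𝓝[>] (0 : ℝ), advance x s ∉ D :=
  nhdsGT_le_nhdsNE 0 (hD.eventually_advance_notMem x)

theorem Set.Finite.eventually_advance_neg {D : Set (Circles n)} (hD : D.Finite)
    (x : Circles n) : ∀ᶠ s in 𝓝[>] (0 : ℝ), advance x (-s) ∉ D :=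
  (tendsto_neg_nhdsGT_zero.mono_right (nhdsLT_le_nhdsNE 0)).eventually
    (hD.eventually_advance_notMem x)

end Advance

/-! ### The orientation of a crossing is well defined -/

/-- A germ of a map of the plane that preserves the orientation, that maps the rays in the directions
`a` and `b` to the rays in the directions `a'` and `b'`, and that maps nothing outside of the line
`ℝ a` to the line `ℝ a'`, carries positive bases `(a, b)` to positive bases `(a', b')`. On a small
circle the continuous argument `θ` of the image grows by `2 π` and meets the direction of the line
`ℝ a'` only at the direction of `± a`; so it grows by `π` between `a` and `-a`, and takes its value
at `b` strictly between. -/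
theorem OrientationPreservingAt.det_pos {f : ℂ → ℂ} {z a b a' b' : ℂ}
    (hf : OrientationPreservingAt f z)
    (ha : ∀ᶠ c : ℝ in 𝓝[>] 0, ∃ k : ℝ, 0 < k ∧ f (z + c * a) - f z = k * a')
    (hb : ∀ᶠ c : ℝ in 𝓝[>] 0, ∃ k : ℝ, 0 < k ∧ f (z + c * b) - f z = k * b')
    (hline : ∀ᶠ w in 𝓝 z, ∀ k : ℝ, f w - f z = k * a' → ∃ c : ℝ, w - z = c * a)
    (hab : 0 < a.re * b.im - a.im * b.re) (ha' : a' ≠ 0) (hb' : b' ≠ 0) :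
    0 < a'.re * b'.im - a'.im * b'.re := by
  have ha0 : a ≠ 0 := by rintro rfl; simp at hab
  have hb0 : b ≠ 0 := by rintro rfl; simp at hab
  have hna : 0 < ‖a‖ := norm_pos_iff.2 ha0
  have hnb : 0 < ‖b‖ := norm_pos_iff.2 hb0
  have hpi := Real.pi_pos
  -- angles `ta` of `a` and `ta + φ` of `b`
  obtain ⟨ta, hta, hta'⟩ : ∃ t ∈ Ico 0 (2 * Real.pi), a = ‖a‖ * Complex.exp (t * Complex.I) := by
    rcases le_or_gt 0 a.arg with h | h
    · exact ⟨a.arg, ⟨h, by linarith [a.arg_le_pi]⟩, a.norm_mul_exp_arg_mul_I.symm⟩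
    · refine ⟨a.arg + 2 * Real.pi, ⟨by linarith [a.neg_pi_lt_arg], by linarith⟩, ?_⟩
      push_cast
      rw [add_mul, Complex.exp_add, Complex.exp_two_pi_mul_I, mul_one, a.norm_mul_exp_arg_mul_I]
  obtain ⟨φ, hφ, hφ'⟩ : ∃ φ ∈ Ioo 0 Real.pi,
      b = ‖b‖ * Complex.exp ((ta + φ : ℝ) * Complex.I) := by
    have him : 0 < (b / a).im := by
      rw [Complex.div_im]
      have : 0 < Complex.normSq a := Complex.normSq_pos.2 ha0
      rw [← sub_div]
      exact div_pos (by linarith) this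
    refine ⟨(b / a).arg, ⟨lt_of_le_of_ne (Complex.arg_nonneg_iff.2 him.le) fun h => ?_,
      lt_of_le_of_ne (Complex.arg_le_pi _) fun h => ?_⟩, ?_⟩
    · exact him.ne' (Complex.arg_eq_zero_iff.1 h.symm).2
    · exact him.ne' (Complex.arg_eq_pi_iff.1 h).2
    · push_cast
      rw [add_mul, Complex.exp_add]
      calc b = a * (b / a) := by field_simp
        _ = ‖a‖ * Complex.exp (ta * Complex.I) *
            (‖b / a‖ * Complex.exp ((b / a).arg * Complex.I)) := by
          rw [← hta', Complex.norm_mul_exp_arg_mul_I]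
        _ = _ := by
          rw [norm_div]
          have : (‖a‖ : ℂ) ≠ 0 := by exact_mod_cast hna.ne'
          push_cast
          field_simp
  -- a small radius `r`
  have hline' : ∀ᶠ r : ℝ in 𝓝[>] 0, ∀ t : ℝ, ∀ k : ℝ,
      f (z + r * Complex.exp (t * Complex.I)) - f z = k * a' →
      ∃ c : ℝ, r * Complex.exp (t * Complex.I) = c * a := by
    obtain ⟨ε, hε, h⟩ := Metric.eventually_nhds_iff_ball.1 hline
    filter_upwards [Ioo_mem_nhdsGT hε] with r hr t k hk
    obtain ⟨c, hc⟩ := h (z + r * Complex.exp (t * Complex.I)) (by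
      simpa [Complex.norm_exp_ofReal_mul_I, abs_of_pos hr.1] using hr.2) k hk
    exact ⟨c, by rw [← hc, add_sub_cancel_left]⟩
  have hdiv : ∀ {m : ℝ}, 0 < m → Tendsto (fun r : ℝ => r / m) (𝓝[>] 0) (𝓝[>] 0) := by
    intro m hm
    refine tendsto_nhdsWithin_iff.2 ⟨?_, ?_⟩
    · have : Tendsto (fun r : ℝ => r / m) (𝓝 0) (𝓝 (0 / m)) := tendsto_id.div_const m
      rw [zero_div] at this
      exact this.mono_left nhdsWithin_le_nhds
    · filter_upwards [self_mem_nhdsWithin] with r hr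
      exact div_pos hr hm
  obtain ⟨r, ⟨θ, hθ, hθ2, hθF⟩, ⟨k, hk, hkF⟩, ⟨l, hl, hlF⟩, hr, hr0⟩ :=
    (hf.and (((hdiv hna).eventually ha).and (((hdiv hnb).eventually hb).and
      (hline'.and self_mem_nhdsWithin)))).exists
  have hr0 : 0 < r := hr0
  obtain ⟨F, hF⟩ : ∃ F : ℝ → ℂ, ∀ t, F t = f (z + r * Complex.exp (t * Complex.I)) - f z :=
    ⟨_, fun _ => rfl⟩
  simp only [← hF] at hθF hr
  have hFa : F ta = k * a' := by
    rw [← hkF, hF]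
    congr 3
    have : (‖a‖ : ℂ) ≠ 0 := by exact_mod_cast hna.ne'
    rw [Complex.ofReal_div, div_mul_eq_mul_div, eq_div_iff this, mul_assoc,
      mul_comm (Complex.exp _), ← hta']
  have hFb : F (ta + φ) = l * b' := by
    rw [← hlF, hF]
    congr 3
    have : (‖b‖ : ℂ) ≠ 0 := by exact_mod_cast hnb.ne'
    rw [Complex.ofReal_div, div_mul_eq_mul_div, eq_div_iff this, mul_assoc,
      mul_comm (Complex.exp _), ← hφ']
  -- the argument is continued to two turns
  obtain ⟨Θ, hΘc, hΘ2, hΘF⟩ : ∃ Θ : ℝ → ℝ, Continuous Θ ∧ Θ (ta + 2 * Real.pi) = Θ ta + 2 * Real.pi ∧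
      ∀ t ∈ Icc ta (ta + 2 * Real.pi), F t = ‖F t‖ * Complex.exp (Θ t * Complex.I) := by
    refine ⟨fun t => if t ≤ 2 * Real.pi then θ t else θ (t - 2 * Real.pi) + 2 * Real.pi,
      ?_, ?_, ?_⟩
    · refine Continuous.if_le hθ (by fun_prop) continuous_id continuous_const ?_
      rintro t rfl
      simp [hθ2]
    · rcases hta.1.eq_or_lt with h | h
      · simp [← h, hθ2, hpi.le]
      · simp [hta.2.le, h]
    · intro t ht
      by_cases h : t ≤ 2 * Real.pi
      · simp only [h, if_true]
        exact hθF t ⟨hta.1.trans ht.1, h⟩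
      · have hper : F t = F (t - 2 * Real.pi) := by
          rw [hF, hF]
          push_cast
          rw [sub_mul, Complex.exp_sub, Complex.exp_two_pi_mul_I, div_one]
        simp only [h, if_false]
        rw [hper]
        push_cast
        rw [add_mul, Complex.exp_add, Complex.exp_two_pi_mul_I, mul_one]
        exact hθF _ ⟨by linarith, by linarith [ht.2, hta.2]⟩
  obtain ⟨ρ, hρ, hρa⟩ : ∃ ρ : ℝ, 0 < ρ ∧ a' = ρ * Complex.exp (Θ ta * Complex.I) := by
    have h := hΘF ta ⟨le_rfl, by linarith⟩
    have hF0 : F ta ≠ 0 := by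
      rw [hFa]
      exact mul_ne_zero (by exact_mod_cast hk.ne') ha'
    refine ⟨‖F ta‖ / k, div_pos (norm_pos_iff.2 hF0) hk, ?_⟩
    have hk' : (k : ℂ) ≠ 0 := by exact_mod_cast hk.ne'
    push_cast
    rw [div_mul_eq_mul_div, ← h, hFa, mul_div_cancel_left₀ _ hk']
  obtain ⟨ρ', hρ', hρb⟩ : ∃ ρ : ℝ, 0 < ρ ∧ b' = ρ * Complex.exp (Θ (ta + φ) * Complex.I) := by
    have h := hΘF (ta + φ) ⟨by linarith [hφ.1], by linarith [hφ.2]⟩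
    have hF0 : F (ta + φ) ≠ 0 := by
      rw [hFb]
      exact mul_ne_zero (by exact_mod_cast hl.ne') hb'
    refine ⟨‖F (ta + φ)‖ / l, div_pos (norm_pos_iff.2 hF0) hl, ?_⟩
    have hl' : (l : ℂ) ≠ 0 := by exact_mod_cast hl.ne'
    push_cast
    rw [div_mul_eq_mul_div, ← h, hFb, mul_div_cancel_left₀ _ hl']
  -- the line `ℝ a'` is met only at the angle `ta + π`
  have hzero : ∀ t ∈ Ioo ta (ta + 2 * Real.pi), Real.sin (Θ t - Θ ta) = 0 → t = ta + Real.pi := by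
    intro t ht hsin
    have h1 : F t = (‖F t‖ * Real.cos (Θ t - Θ ta) / ρ : ℝ) * a' := by
      have : Complex.exp ((Θ t - Θ ta : ℝ) * Complex.I) = Real.cos (Θ t - Θ ta) := by
        rw [Complex.exp_mul_I, ← Complex.ofReal_sin, hsin]
        simp
      have h2 : Complex.exp (Θ t * Complex.I) =
          Complex.exp (Θ ta * Complex.I) * Real.cos (Θ t - Θ ta) := by
        rw [← this, ← Complex.exp_add]
        congr 1
        push_cast
        ring
      have h3 : (ρ : ℂ) ≠ 0 := by exact_mod_cast hρ.ne'
      rw [hρa, hΘF t ⟨ht.1.le, ht.2.le⟩, h2]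
      simp only [norm_mul, Complex.norm_real, Complex.norm_exp_ofReal_mul_I, norm_norm]
      have h4 : |Real.cos (Θ t - Θ ta)| = 1 := by
        have := Real.sin_sq_add_cos_sq (Θ t - Θ ta)
        rw [hsin] at this
        rw [← sq_eq_sq₀ (abs_nonneg _) zero_le_one, sq_abs]
        linarith
      rw [Real.norm_eq_abs, h4]
      push_cast
      field_simp
    obtain ⟨c, hc⟩ := hr t _ h1
    have h2 : Real.sin (t - ta) = 0 := by
      have h3 : Complex.exp ((t - ta : ℝ) * Complex.I) = (c * ‖a‖ / r : ℝ) := by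
        have hr' : (r : ℂ) ≠ 0 := by exact_mod_cast hr0.ne'
        push_cast
        rw [sub_mul, Complex.exp_sub, div_eq_iff (Complex.exp_ne_zero _), div_mul_eq_mul_div,
          mul_assoc (c : ℂ), ← hta', ← hc, mul_div_cancel_left₀ _ hr']
      have := congrArg Complex.im h3
      rwa [Complex.exp_ofReal_mul_I_im, Complex.ofReal_im] at this
    obtain ⟨m, hm⟩ := Real.sin_eq_zero_iff.1 h2
    have hm0 : (0 : ℝ) < m := by
      by_contra h
      nlinarith [ht.1]
    have hm2 : (m : ℝ) < 2 := by
      by_contra h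
      nlinarith [ht.2]
    have : m = 1 := by
      have h1 : (0 : ℤ) < m := by exact_mod_cast hm0
      have h2 : m < (2 : ℤ) := by exact_mod_cast hm2
      omega
    rw [this] at hm
    push_cast at hm
    linarith
  -- the argument grows by `2 π` in one turn, and attains `Θ ta + π` on the way
  have hmid : Θ (ta + Real.pi) = Θ ta + Real.pi := by
    obtain ⟨t, ht, h⟩ := intermediate_value_Icc (show ta ≤ ta + 2 * Real.pi by linarith)
      hΘc.continuousOn (show Θ ta + Real.pi ∈ Icc (Θ ta) (Θ (ta + 2 * Real.pi)) by
        rw [hΘ2]; constructor <;> linarith)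
    have h1 : ta ≠ t := by rintro rfl; linarith
    have h2 : t ≠ ta + 2 * Real.pi := by rintro rfl; rw [hΘ2] at h; linarith
    rw [← hzero t ⟨lt_of_le_of_ne ht.1 h1, lt_of_le_of_ne ht.2 h2⟩ (by rw [h]; simp), h]
  have hsin : 0 < Real.sin (Θ (ta + φ) - Θ ta) := by
    -- otherwise the line `ℝ a'` would be met at an angle other than `ta + π`
    apply Real.sin_pos_of_pos_of_lt_pi
    · by_contra! hneg
      obtain ⟨t, ht, h⟩ := intermediate_value_Icc (show ta + φ ≤ ta + Real.pi by linarith [hφ.2])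
        hΘc.continuousOn (show Θ ta ∈ Icc (Θ (ta + φ)) (Θ (ta + Real.pi)) by
          rw [hmid]; constructor <;> linarith)
      have := hzero t ⟨by linarith [ht.1, hφ.1], by linarith [ht.2]⟩ (by rw [h]; simp)
      rw [this] at h
      linarith
    · by_contra! hneg
      obtain ⟨t, ht, h⟩ := intermediate_value_Icc (show ta ≤ ta + φ by linarith [hφ.1])
        hΘc.continuousOn (show Θ ta + Real.pi ∈ Icc (Θ ta) (Θ (ta + φ)) by
          constructor <;> linarith)
      have h1 : ta ≠ t := by rintro rfl; linarith
      have := hzero t ⟨lt_of_le_of_ne ht.1 h1, by linarith [ht.2, hφ.2]⟩ (by rw [h]; simp)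
      linarith [ht.2, hφ.2]
  have hdet : a'.re * b'.im - a'.im * b'.re = ρ * ρ' * Real.sin (Θ (ta + φ) - Θ ta) := by
    rw [hρa, hρb, Complex.re_ofReal_mul, Complex.im_ofReal_mul, Complex.re_ofReal_mul,
      Complex.im_ofReal_mul, Complex.exp_ofReal_mul_I_re, Complex.exp_ofReal_mul_I_im,
      Complex.exp_ofReal_mul_I_re, Complex.exp_ofReal_mul_I_im, Real.sin_sub]
    ring
  rw [hdet]
  positivity

/-- A continuous strictly increasing germ that fixes `0` attains all values near `0`. -/
theorem StrictMono.eventually_exists_eq {α : ℝ → ℝ} (hα : StrictMono α) (h0 : α 0 = 0)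
    (hc : ∀ᶠ s in 𝓝 (0 : ℝ), ContinuousAt α s) {V : Set ℝ} (hV : V ∈ 𝓝 (0 : ℝ)) :
    ∀ᶠ c : ℝ in 𝓝 0, ∃ s ∈ V, α s = c := by
  obtain ⟨ε, hε, h⟩ := Metric.eventually_nhds_iff_ball.1 (hc.and hV)
  have hsub : Icc (-(ε / 2)) (ε / 2) ⊆ Metric.ball 0 ε := by
    intro s hs
    rw [Metric.mem_ball, Real.dist_0_eq_abs, abs_lt]
    constructor <;> linarith [hs.1, hs.2]
  have hiv := intermediate_value_Icc (show -(ε / 2) ≤ ε / 2 by linarith)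
    (f := α) fun s hs => (h s (hsub hs)).1.continuousWithinAt
  have h1 : α (-(ε / 2)) < 0 := by rw [← h0]; exact hα (by linarith)
  have h2 : 0 < α (ε / 2) := by rw [← h0]; exact hα (by linarith)
  filter_upwards [Icc_mem_nhds h1 h2] with c hc
  obtain ⟨s, hs, rfl⟩ := hiv hc
  exact ⟨s, (h s (hsub hs)).2, rfl⟩

/-- The branch of `γ` at `x` is straight in the chart `e`, with the direction `a`. -/
def StraightAt {X : OrientedSurface.{u}} {n : ℕ} (γ : Circles n → X)
    (e : OpenPartialHomeomorph X ℂ) (x : Circles n) (a : ℂ) : Prop :=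
  ∃ α : ℝ → ℝ, StrictMono α ∧ α 0 = 0 ∧
    ∀ᶠ s : ℝ in 𝓝 0, e (γ (advance x s)) = e (γ x) + α s * a

section Straight

variable {X : OrientedSurface.{u}} {n : ℕ} {γ : Circles n → X}
  {e e' : OpenPartialHomeomorph X ℂ} {x y : Circles n} {a b : ℂ}

theorem straightAt_of_eventually {α : ℝ → ℝ} (hα : StrictMono α) (ha : a ≠ 0)
    (h : ∀ᶠ s : ℝ in 𝓝 0, e (γ (advance x s)) = e (γ x) + α s * a) : StraightAt γ e x a := by
  refine ⟨α, hα, ?_, h⟩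
  have := h.self_of_nhds
  rw [advance_zero] at this
  simpa [ha] using this

theorem eventually_mem_source (hγ : Continuous γ) (hx : γ x ∈ e.source) :
    ∀ᶠ s : ℝ in 𝓝 0, γ (advance x s) ∈ e.source :=
  ((hγ.tendsto x).comp (tendsto_advance x)).eventually (e.open_source.mem_nhds hx)

/-- Near `0` the point `c a` of the line is reached by the branch, at a small time of the same
sign as `c`. -/
theorem StraightAt.eventually_exists (h : StraightAt γ e x a) (hγ : Continuous γ)
    (hx : γ x ∈ e.source) (ha : a ≠ 0) {V : Set ℝ} (hV : V ∈ 𝓝 (0 : ℝ)) :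
    ∀ᶠ c : ℝ in 𝓝 0, ∃ s ∈ V, (0 < s ↔ 0 < c) ∧ γ (advance x s) ∈ e.source ∧
      e (γ (advance x s)) = e (γ x) + c * a := by
  obtain ⟨α, hα, h0, h⟩ := h
  have hsrc := eventually_mem_source hγ hx
  have hcont : ∀ᶠ s in 𝓝 (0 : ℝ), ContinuousAt α s := by
    filter_upwards [h.eventually_nhds, hsrc] with s h1 h2
    have h3 : ContinuousAt (fun s => e (γ (advance x s))) s :=
      ContinuousAt.comp (e.continuousAt h2) (hγ.comp (continuous_advance x)).continuousAt
    have h4 : ContinuousAt (fun s => ((e (γ (advance x s)) - e (γ x)) / a).re) s :=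
      Complex.continuous_re.continuousAt.comp ((h3.sub continuousAt_const).div_const a)
    refine h4.congr ?_
    filter_upwards [h1] with t ht
    rw [ht, add_sub_cancel_left, mul_div_cancel_right₀ _ ha, Complex.ofReal_re]
  filter_upwards [hα.eventually_exists_eq h0 hcont (inter_mem hV (hsrc.and h))]
  rintro c ⟨s, ⟨hs1, hs2, hs3⟩, rfl⟩
  refine ⟨s, hs1, ?_, hs2, hs3⟩
  conv_rhs => rw [← h0]
  exact (hα.lt_iff_lt).symm

/-- A change of charts maps the ray of a straight branch to the ray of this branch. -/
theorem StraightAt.eventually_ray {a' : ℂ} (h : StraightAt γ e x a) (h' : StraightAt γ e' x a')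
    (hγ : Continuous γ) (hx : γ x ∈ e.source) (ha : a ≠ 0) :
    ∀ᶠ c : ℝ in 𝓝[>] 0, ∃ k : ℝ, 0 < k ∧
      (e' ∘ e.symm) (e (γ x) + c * a) - (e' ∘ e.symm) (e (γ x)) = k * a' := by
  obtain ⟨α, hα, h0, h'⟩ := h'
  filter_upwards [nhdsWithin_le_nhds (h.eventually_exists hγ hx ha h'), self_mem_nhdsWithin]
  rintro c ⟨s, hs1, hs2, hs3, hs4⟩ hc
  refine ⟨α s, ?_, ?_⟩
  · rw [← h0]
    exact hα (hs2.2 hc)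
  · rw [Function.comp_apply, Function.comp_apply, ← hs4, e.left_inv hs3, e.left_inv hx]
    rw [show e' (γ (advance x s)) = e' (γ x) + α s * a' from hs1, add_sub_cancel_left]

/-- A change of charts maps only the line of a straight branch to the line of this branch. -/
theorem StraightAt.eventually_line {a' : ℂ} (h : StraightAt γ e x a) (h' : StraightAt γ e' x a')
    (hγ : Continuous γ) (hx : γ x ∈ e.source) (hx' : γ x ∈ e'.source) (ha' : a' ≠ 0) :
    ∀ᶠ w in 𝓝 (e (γ x)), ∀ k : ℝ, (e' ∘ e.symm) w - (e' ∘ e.symm) (e (γ x)) = k * a' →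
      ∃ c : ℝ, w - e (γ x) = c * a := by
  obtain ⟨α, hα, h0, h⟩ := h
  have hz := e.map_source hx
  have hsym : ContinuousAt e.symm (e (γ x)) := e.symm.continuousAt hz
  have hcomp : ContinuousAt (fun w => (((e' ∘ e.symm) w - (e' ∘ e.symm) (e (γ x))) / a').re)
      (e (γ x)) := by
    have : ContinuousAt (e' ∘ e.symm) (e (γ x)) :=
      ContinuousAt.comp (by rw [e.left_inv hx]; exact e'.continuousAt hx') hsym
    exact Complex.continuous_re.continuousAt.comp ((this.sub continuousAt_const).div_const a')
  have hlim := hcomp.tendsto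
  simp only [sub_self, zero_div, Complex.zero_re] at hlim
  have hsrc : ∀ᶠ w in 𝓝 (e (γ x)), e.symm w ∈ e'.source :=
    hsym.eventually (by rw [e.left_inv hx]; exact e'.open_source.mem_nhds hx')
  filter_upwards [hlim.eventually (h'.eventually_exists hγ hx' ha' h), hsrc,
    e.open_target.mem_nhds hz] with w h1 h2 h3 k hk
  rw [hk, mul_div_cancel_right₀ _ ha', Complex.ofReal_re] at h1
  obtain ⟨s, hs1, -, hs3, hs4⟩ := h1
  rw [← hk, Function.comp_apply, Function.comp_apply, e.left_inv hx, add_sub_cancel] at hs4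
  refine ⟨α s, ?_⟩
  rw [← e.right_inv h3, ← e'.injOn hs3 h2 hs4,
    show e (γ (advance x s)) = e (γ x) + α s * a from hs1, add_sub_cancel_left]

end Straight

/-- The two orders of the branches at a crossing cannot both be positively oriented. -/
theorem PositivelyTransverse.asymm {X : OrientedSurface.{u}} {n : ℕ} {γ : Circles n → X}
    (hγ : Continuous γ) {x y : Circles n} (h : PositivelyTransverse γ x y) :
    ¬ PositivelyTransverse γ y x := by
  rintro ⟨-, -, e', he', hx', b', a', hab', β', α', hβ', hα', h'⟩
  obtain ⟨-, hxy, e, he, hx, a, b, hab, α, β, hα, hβ, h⟩ := h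
  rw [← hxy] at hx'
  have ha : a ≠ 0 := by rintro rfl; simp at hab
  have hb : b ≠ 0 := by rintro rfl; simp at hab
  have ha' : a' ≠ 0 := by rintro rfl; simp at hab'
  have hb' : b' ≠ 0 := by rintro rfl; simp at hab'
  have sx : StraightAt γ e x a := straightAt_of_eventually hα ha (h.mono fun _ h => h.1)
  have sy : StraightAt γ e y b := straightAt_of_eventually hβ hb
    (h.mono fun _ h => by rw [← hxy]; exact h.2)
  have sx' : StraightAt γ e' x a' := straightAt_of_eventually hα' ha'
    (h'.mono fun _ h => by rw [hxy]; exact h.2)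
  have sy' : StraightAt γ e' y b' := straightAt_of_eventually hβ' hb' (h'.mono fun _ h => h.1)
  have := (X.compatible e he e' he' (γ x) ⟨hx, hx'⟩).det_pos (sx.eventually_ray sx' hγ hx ha)
    (by rw [hxy]; exact sy.eventually_ray sy' hγ (by rwa [← hxy]) hb)
    (sx.eventually_line sx' hγ hx hx' ha') hab ha' hb'
  linarith

/-! ### Colourings -/

section HasInput

variable {n : ℕ} {N : Type*}

/-- The function `f` has the value `a` immediately before the point `x`. -/
def HasInput (f : Circles n → N) (x : Circles n) (a : N) : Prop :=
  ∀ᶠ s : ℝ in 𝓝[>] 0, f (advance x (-s)) = a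

/-- The function `f` has the value `a` immediately after the point `x`. -/
def HasOutput (f : Circles n → N) (x : Circles n) (a : N) : Prop :=
  ∀ᶠ s : ℝ in 𝓝[>] 0, f (advance x s) = a

variable {f : Circles n → N} {x : Circles n} {a b : N}

theorem HasInput.unique (ha : HasInput f x a) (hb : HasInput f x b) : a = b := by
  obtain ⟨s, h1, h2⟩ := (ha.and hb).exists
  exact h1.symm.trans h2

theorem HasOutput.unique (ha : HasOutput f x a) (hb : HasOutput f x b) : a = b := by
  obtain ⟨s, h1, h2⟩ := (ha.and hb).exists
  exact h1.symm.trans h2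

theorem HasInput.map {N' : Type*} (ha : HasInput f x a) (φ : N → N') :
    HasInput (fun y => φ (f y)) x (φ a) :=
  Eventually.mono ha fun _ h => congrArg φ h

theorem HasOutput.map {N' : Type*} (ha : HasOutput f x a) (φ : N → N') :
    HasOutput (fun y => φ (f y)) x (φ a) :=
  Eventually.mono ha fun _ h => congrArg φ h

end HasInput

namespace LinkDiagram

variable {X : OrientedSurface.{u}} {n : ℕ} {N : Type*}

/-- A colouring of the arcs of `L` which satisfies the relation `P` at the crossings (in the form
`P a b a' b'` of `CrossingRel.IsBiquandle`). It is given by a function on the circles, whose values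
at the preimages of the double points are immaterial. -/
structure IsColouring (P : N → N → N → N → Prop) (L : LinkDiagram X n) (f : Circles n → N) :
    Prop where
  eventually_eq : ∀ x ∉ doublePreimages L.γ, ∀ᶠ s : ℝ in 𝓝 0, f (advance x s) = f x
  crossing : ∀ x y (o : Bool), PositivelyTransverse L.γ x y → (o = true ↔ x ∈ L.overPass) →
    ∀ a b a' b', HasInput f x a → HasInput f y b → HasOutput f x a' → HasOutput f y b' →
      CrossingRel.cross P true true o a b a' b'

section Arcs

variable {L : LinkDiagram X n} {P : N → N → N → N → Prop} {f : Circles n → N}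

theorem mem_overPass_iff_of_positivelyTransverse {x y : Circles n}
    (h : PositivelyTransverse L.γ x y) : y ∈ L.overPass ↔ x ∉ L.overPass := by
  rw [L.overPass_iff x y h.1 h.2.1, not_not]

/-- The arc of a point which is not a double point. -/
noncomputable def arcOf (L : LinkDiagram X n) {x : Circles n} (hx : x ∉ doublePreimages L.γ) :
    L.Arc :=
  ConnectedComponents.mk ⟨x, hx⟩

/-- A motion along a circle which does not meet double points stays in one arc. -/
theorem arcOf_eq {x : Circles n} {I : Set ℝ} (hI : IsPreconnected I)
    (h : ∀ s ∈ I, advance x s ∉ doublePreimages L.γ) {s t : ℝ} (hs : s ∈ I) (ht : t ∈ I) :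
    L.arcOf (h s hs) = L.arcOf (h t ht) := by
  have : PreconnectedSpace I := isPreconnected_iff_preconnectedSpace.1 hI
  let φ : I → {x : Circles n // x ∉ doublePreimages L.γ} := fun s => ⟨advance x s, h s s.2⟩
  have hφ : Continuous φ :=
    ((continuous_advance x).comp continuous_subtype_val).subtype_mk _
  exact ConnectedComponents.coe_eq_coe'.2 <|
    (isPreconnected_range hφ).subset_connectedComponent ⟨⟨t, ht⟩, rfl⟩ ⟨⟨s, hs⟩, rfl⟩

theorem exists_isOutput (L : LinkDiagram X n) (x : Circles n) : ∃ c, L.IsOutput x c := by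
  obtain ⟨ε, hε, h⟩ := (mem_nhdsGT_iff_exists_Ioo_subset (α := ℝ)).1
    (L.finite_double.eventually_advance_pos x)
  have hε : 0 < ε := hε
  refine ⟨L.arcOf (x := advance x (ε / 2)) (h ⟨by linarith, by linarith⟩), ?_⟩
  filter_upwards [Ioo_mem_nhdsGT hε] with s hs
  exact ⟨h hs, arcOf_eq isPreconnected_Ioo (fun _ h' => h h') hs ⟨by linarith, by linarith⟩⟩

theorem exists_isInput (L : LinkDiagram X n) (x : Circles n) : ∃ c, L.IsInput x c := by
  obtain ⟨ε, hε, h⟩ := (mem_nhdsGT_iff_exists_Ioo_subset (α := ℝ)).1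
    (L.finite_double.eventually_advance_neg x)
  have hε : 0 < ε := hε
  have h' : ∀ s ∈ Ioo (-ε) 0, advance x s ∉ doublePreimages L.γ := by
    intro s hs
    have : advance x (- -s) ∉ doublePreimages L.γ :=
      h ⟨by linarith [hs.2], by linarith [hs.1]⟩
    rwa [neg_neg] at this
  refine ⟨L.arcOf (h' (-(ε / 2)) ⟨by linarith, by linarith⟩), ?_⟩
  filter_upwards [Ioo_mem_nhdsGT hε] with s hs
  exact ⟨h hs, arcOf_eq isPreconnected_Ioo h' ⟨by linarith [hs.2], by linarith [hs.1]⟩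
    ⟨by linarith, by linarith⟩⟩

theorem IsInput.hasInput {x : Circles n} {c : L.Arc} (h : L.IsInput x c) (g : L.Arc → N)
    (hf : ∀ y (hy : y ∉ doublePreimages L.γ), f y = g (L.arcOf hy)) :
    HasInput f x (g c) :=
  Eventually.mono h fun _ ⟨h, h'⟩ => (hf _ h).trans (congrArg g h')

theorem IsOutput.hasOutput {x : Circles n} {c : L.Arc} (h : L.IsOutput x c) (g : L.Arc → N)
    (hf : ∀ y (hy : y ∉ doublePreimages L.γ), f y = g (L.arcOf hy)) :
    HasOutput f x (g c) :=
  Eventually.mono h fun _ ⟨h, h'⟩ => (hf _ h).trans (congrArg g h')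

/-- A colouring is a function on the set of arcs. -/
theorem IsColouring.exists_arc (h : L.IsColouring P f) : ∃ g : L.Arc → N,
    ∀ y (hy : y ∉ doublePreimages L.γ), f y = g (L.arcOf hy) := by
  have hloc : IsLocallyConstant
      fun y : {x : Circles n // x ∉ doublePreimages L.γ} => f y := by
    rw [IsLocallyConstant.iff_eventually_eq]
    intro y
    rw [nhds_subtype_eq_comap]
    exact (eventually_nhds_iff_advance (p := fun z => f z = f y).2
      (h.eventually_eq y y.2)).comap _
  refine ⟨Quotient.lift (fun y : {x : Circles n // x ∉ doublePreimages L.γ} => f y) ?_,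
    fun _ _ => rfl⟩
  intro y z hyz
  have hyz : connectedComponent y = connectedComponent z := hyz
  exact hloc.apply_eq_of_isPreconnected isPreconnected_connectedComponent
    mem_connectedComponent (hyz ▸ mem_connectedComponent)

theorem IsColouring.exists_hasInput (h : L.IsColouring P f) (x : Circles n) :
    ∃ a, HasInput f x a := by
  obtain ⟨g, hg⟩ := h.exists_arc
  obtain ⟨c, hc⟩ := L.exists_isInput x
  exact ⟨_, hc.hasInput g hg⟩

theorem IsColouring.exists_hasOutput (h : L.IsColouring P f) (x : Circles n) :
    ∃ a, HasOutput f x a := by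
  obtain ⟨g, hg⟩ := h.exists_arc
  obtain ⟨c, hc⟩ := L.exists_isOutput x
  exact ⟨_, hc.hasOutput g hg⟩

/-- A map that carries the relation `P` to `P'` carries colourings to colourings. -/
theorem IsColouring.map {N' : Type*} {P' : N' → N' → N' → N' → Prop} (h : L.IsColouring P f)
    (φ : N → N') (hφ : ∀ a b a' b', P a b a' b' → P' (φ a) (φ b) (φ a') (φ b')) :
    L.IsColouring P' fun x => φ (f x) := by
  refine ⟨fun x hx => (h.eventually_eq x hx).mono fun _ h => congrArg φ h, ?_⟩
  intro x y o hxy ho a b a' b' ha hb ha' hb'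
  obtain ⟨c, hc⟩ := h.exists_hasInput x
  obtain ⟨d, hd⟩ := h.exists_hasInput y
  obtain ⟨c', hc'⟩ := h.exists_hasOutput x
  obtain ⟨d', hd'⟩ := h.exists_hasOutput y
  rw [ha.unique (hc.map φ), hb.unique (hd.map φ), ha'.unique (hc'.map φ), hb'.unique (hd'.map φ)]
  have := h.crossing x y o hxy ho c d c' d' hc hd hc' hd'
  cases o
  · exact hφ _ _ _ _ this
  · exact hφ _ _ _ _ this

end Arcs

/-! ### The module of a link diagram represents its colourings -/

section Module

variable {R : Type*} [Ring R] (A B C D : R) (L : LinkDiagram X n)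

open scoped Classical in
/-- The colouring of the diagram by the generators of its module; the value `0` at the preimages of
the double points is immaterial. -/
noncomputable def universalColouring (x : Circles n) : LinkModule A B C D L :=
  if hx : x ∉ doublePreimages L.γ then
    Submodule.Quotient.mk (Finsupp.single (L.arcOf hx) (1 : R)) else 0

theorem universalColouring_apply {x : Circles n} (hx : x ∉ doublePreimages L.γ) :
    universalColouring A B C D L x =
      Submodule.Quotient.mk (Finsupp.single (L.arcOf hx) (1 : R)) := by
  rw [universalColouring, dif_pos hx]

theorem isColouring_universalColouring :
    L.IsColouring (switchRel A B C D) (universalColouring A B C D L) := by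
  let generator (c : L.Arc) : LinkModule A B C D L :=
    Submodule.Quotient.mk (Finsupp.single c (1 : R))
  have happly : ∀ y (hy : y ∉ doublePreimages L.γ), universalColouring A B C D L y =
      generator (L.arcOf hy) :=
    fun y hy => universalColouring_apply A B C D L hy
  constructor
  · intro x hx
    have h1 : ∀ᶠ s in 𝓝 (0 : ℝ), advance x s ∉ doublePreimages L.γ :=
      (tendsto_advance x).eventually (L.finite_double.isClosed.isOpen_compl.mem_nhds hx)
    obtain ⟨ε, hε, h⟩ := Metric.eventually_nhds_iff_ball.1 h1
    filter_upwards [Metric.ball_mem_nhds 0 hε] with s hs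
    rw [universalColouring_apply A B C D L (h s hs), universalColouring_apply A B C D L hx]
    have := arcOf_eq (L := L) (convex_ball (0 : ℝ) ε).isPreconnected h hs
      (Metric.mem_ball_self hε)
    simp only [advance_zero] at this
    rw [this]
  · intro x y o hxy ho a b a' b' ha hb ha' hb'
    obtain ⟨c, hc⟩ := L.exists_isInput x
    obtain ⟨d, hd⟩ := L.exists_isInput y
    obtain ⟨c', hc'⟩ := L.exists_isOutput x
    obtain ⟨d', hd'⟩ := L.exists_isOutput y
    rw [ha.unique (hc.hasInput generator happly), hb.unique (hd.hasInput generator happly),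
      ha'.unique (hc'.hasOutput generator happly), hb'.unique (hd'.hasOutput generator happly)]
    have key : ∀ w z : L.Arc →₀ R, IsRelation A B C D L (w - z) →
        (Submodule.Quotient.mk z : LinkModule A B C D L) = Submodule.Quotient.mk w :=
      fun w z h => ((Submodule.Quotient.eq _).2 (Submodule.subset_span h)).symm
    cases o
    · have hy : y ∈ L.overPass := by
        rw [mem_overPass_iff_of_positivelyTransverse hxy, ← ho]
        simp
      exact ⟨key _ _ (.neg_left x y _ _ _ _ hxy hy hc hd hd' hc'),
        key _ _ (.neg_right x y _ _ _ _ hxy hy hc hd hd' hc')⟩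
    · exact ⟨key _ _ (.pos_left x y _ _ _ _ hxy (ho.1 rfl) hc hd hd' hc'),
        key _ _ (.pos_right x y _ _ _ _ hxy (ho.1 rfl) hc hd hd' hc')⟩

variable {A B C D L} [AddCommGroup N] [Module R N] {f : Circles n → N}

/-- Every colouring with values in a module comes from the universal one by a linear map. -/
theorem IsColouring.exists_linearMap (h : L.IsColouring (switchRel A B C D) f) :
    ∃ φ : LinkModule A B C D L →ₗ[R] N, ∀ x ∉ doublePreimages L.γ,
      φ (universalColouring A B C D L x) = f x := by
  obtain ⟨g, hg⟩ := h.exists_arc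
  have hspan : Submodule.span R {w | IsRelation A B C D L w} ≤
      LinearMap.ker (Finsupp.linearCombination R g) := by
    rw [Submodule.span_le]
    rintro w hw
    rw [SetLike.mem_coe, LinearMap.mem_ker]
    have pos : ∀ (x y : Circles n) (inL inR outL outR : L.Arc),
        PositivelyTransverse L.γ x y → x ∈ L.overPass →
        L.IsInput x inL → L.IsInput y inR → L.IsOutput y outL → L.IsOutput x outR →
        switchRel A B C D (g inL) (g inR) (g outR) (g outL) :=
      fun x y _ _ _ _ hxy hx h1 h2 h3 h4 => h.crossing x y true hxy (by simpa using hx) _ _ _ _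
        (h1.hasInput g hg) (h2.hasInput g hg) (h4.hasOutput g hg) (h3.hasOutput g hg)
    have neg : ∀ (x y : Circles n) (inL inR outL outR : L.Arc),
        PositivelyTransverse L.γ x y → y ∈ L.overPass →
        L.IsInput x inL → L.IsInput y inR → L.IsOutput y outL → L.IsOutput x outR →
        switchRel A B C D (g outL) (g outR) (g inR) (g inL) :=
      fun x y _ _ _ _ hxy hy h1 h2 h3 h4 => h.crossing x y false hxy
        (by simpa using (mem_overPass_iff_of_positivelyTransverse hxy).1 hy) _ _ _ _
        (h1.hasInput g hg) (h2.hasInput g hg) (h4.hasOutput g hg) (h3.hasOutput g hg)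
    rcases hw with ⟨x, y, inL, inR, outL, outR, hxy, ho, h1, h2, h3, h4⟩ |
      ⟨x, y, inL, inR, outL, outR, hxy, ho, h1, h2, h3, h4⟩ |
      ⟨x, y, inL, inR, outL, outR, hxy, ho, h1, h2, h3, h4⟩ |
      ⟨x, y, inL, inR, outL, outR, hxy, ho, h1, h2, h3, h4⟩
    · simp [(pos x y _ _ _ _ hxy ho h1 h2 h3 h4).1]
    · simp [(pos x y _ _ _ _ hxy ho h1 h2 h3 h4).2]
    · simp [(neg x y _ _ _ _ hxy ho h1 h2 h3 h4).1]
    · simp [(neg x y _ _ _ _ hxy ho h1 h2 h3 h4).2]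
  refine ⟨Submodule.liftQ _ _ hspan, fun x hx => ?_⟩
  rw [universalColouring_apply A B C D L hx, hg x hx, Submodule.liftQ_apply]
  simp

theorem linearMap_ext {φ ψ : LinkModule A B C D L →ₗ[R] N}
    (h : ∀ x ∉ doublePreimages L.γ,
      φ (universalColouring A B C D L x) = ψ (universalColouring A B C D L x)) : φ = ψ := by
  refine Submodule.linearMap_qext _ (Finsupp.lhom_ext' fun c => LinearMap.ext_ring ?_)
  obtain ⟨⟨x, hx⟩, rfl⟩ := ConnectedComponents.surjective_coe c
  have := h x hx
  rwa [universalColouring_apply A B C D L hx] at this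

theorem isColouring_comp (φ : LinkModule A B C D L →ₗ[R] N) :
    L.IsColouring (switchRel A B C D) fun x => φ (universalColouring A B C D L x) :=
  (isColouring_universalColouring A B C D L).map φ <| by
    rintro a b a' b' ⟨rfl, rfl⟩
    simp [switchRel]

end Module

/-- Two diagrams have isomorphic modules if the colourings of the one correspond to the colourings
of the other. The correspondence is given by a relation `ρ` between points of the circles: every
colouring of one diagram has a partner for the other with the same values at related points, and a
colouring is determined by its values at the points that occur in the relation. -/
theorem nonempty_linkModule_equiv {R : Type*} [Ring R] {A B C D : R}
    {X' : OrientedSurface.{u}} {n' : ℕ} (L : LinkDiagram X n) (L' : LinkDiagram X' n')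
    (ρ : Circles n → Circles n' → Prop)
    (h : ∀ (f : Circles n → LinkModule A B C D L), L.IsColouring (switchRel A B C D) f →
      ∃ f', L'.IsColouring (switchRel A B C D) f' ∧ ∀ x x', ρ x x' → f x = f' x')
    (h' : ∀ (f' : Circles n' → LinkModule A B C D L'), L'.IsColouring (switchRel A B C D) f' →
      ∃ f, L.IsColouring (switchRel A B C D) f ∧ ∀ x x', ρ x x' → f x = f' x')
    (hu : ∀ (f g : Circles n → LinkModule A B C D L), L.IsColouring (switchRel A B C D) f →
      L.IsColouring (switchRel A B C D) g → (∀ x x', ρ x x' → f x = g x) →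
      ∀ x ∉ doublePreimages L.γ, f x = g x)
    (hu' : ∀ (f g : Circles n' → LinkModule A B C D L'), L'.IsColouring (switchRel A B C D) f →
      L'.IsColouring (switchRel A B C D) g → (∀ x x', ρ x x' → f x' = g x') →
      ∀ x ∉ doublePreimages L'.γ, f x = g x)
    (hρ : ∀ x x', ρ x x' → x ∉ doublePreimages L.γ ∧ x' ∉ doublePreimages L'.γ) :
    Nonempty (LinkModule A B C D L ≃ₗ[R] LinkModule A B C D L') := by
  obtain ⟨f', hf', hff'⟩ := h _ (isColouring_universalColouring A B C D L)
  obtain ⟨f, hf, hf'f⟩ := h' _ (isColouring_universalColouring A B C D L')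
  obtain ⟨ψ, hψ⟩ := hf'.exists_linearMap
  obtain ⟨φ, hφ⟩ := hf.exists_linearMap
  refine ⟨LinearEquiv.ofLinearMap φ ψ (linearMap_ext fun x hx => ?_) (linearMap_ext fun x hx => ?_)⟩
  · refine hu' (fun x => φ (ψ _)) (fun x => LinearMap.id _) (isColouring_comp (φ ∘ₗ ψ))
      (isColouring_comp _) (fun x x' hxx' => ?_) x hx
    rw [hψ x' (hρ _ _ hxx').2, ← hff' _ _ hxx', hφ x (hρ _ _ hxx').1, hf'f _ _ hxx']
    rfl
  · refine hu (fun x => ψ (φ _)) (fun x => LinearMap.id _) (isColouring_comp (ψ ∘ₗ φ))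
      (isColouring_comp _) (fun x x' hxx' => ?_) x hx
    rw [hφ x (hρ _ _ hxx').1, hf'f _ _ hxx', hψ x' (hρ _ _ hxx').2, ← hff' _ _ hxx']
    rfl

end LinkDiagram

/-! ### Homeomorphisms of surfaces -/

section Reparametrization

variable {n n' : ℕ}

/-- A map between families of circles which locally is strictly increasing for the orientations. -/
def IsReparametrization (ψ : Circles n → Circles n') : Prop :=
  ∀ x, ∃ α : ℝ → ℝ, Continuous α ∧ StrictMono α ∧ α 0 = 0 ∧
    ∀ s, ψ (advance x s) = advance (ψ x) (α s)

theorem isReparametrization_id : IsReparametrization (id : Circles n → Circles n) :=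
  fun _ => ⟨id, continuous_id, strictMono_id, rfl, fun _ => rfl⟩

theorem isReparametrization_of_continuous {ψ : Circles n → Circles n'}
    (h : ∀ x, ∃ α : ℝ → ℝ, Continuous α ∧ StrictMono α ∧
      ∀ s, ψ (advance x s) = advance (ψ x) (α s)) : IsReparametrization ψ := by
  intro x
  obtain ⟨α, hα, hα', h⟩ := h x
  refine ⟨fun s => α s - α 0, hα.sub continuous_const, fun s t hst => sub_lt_sub_right (hα' hst) _,
    sub_self _, fun s => ?_⟩
  have h0 := h 0
  rw [advance_zero] at h0
  conv_rhs => rw [h0, advance_advance]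
  rw [add_sub_cancel, h]

/-- The inverse of a bijective reparametrization is a reparametrization: a lift to the real line is
unbounded, since it increases by at least `2 π` with every turn, and so it is surjective. -/
theorem IsReparametrization.symm {ψ : Circles n ≃ Circles n'} (h : IsReparametrization ψ) :
    IsReparametrization ψ.symm := by
  intro x'
  obtain ⟨α, hc, hm, h0, h⟩ := h (ψ.symm x')
  rw [ψ.apply_symm_apply] at h
  have hpi := Real.pi_pos
  have hturn : ∀ s, α s + 2 * Real.pi ≤ α (s + 2 * Real.pi) := by
    intro s
    have h1 := h (s + 2 * Real.pi)
    rw [advance_add_two_pi, h s] at h1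
    obtain ⟨m, hm'⟩ := advance_eq_iff.1 h1.symm
    have h2 := hm (show s < s + 2 * Real.pi by linarith)
    have h3 : (0 : ℝ) < m := by
      by_contra h4
      nlinarith
    have h4 : (1 : ℝ) ≤ m := by
      have : (0 : ℤ) < m := by exact_mod_cast h3
      exact_mod_cast this
    nlinarith
  have hup : ∀ k : ℕ, k * (2 * Real.pi) ≤ α (k * (2 * Real.pi)) := by
    intro k
    induction k with
    | zero => simp [h0]
    | succ k ih =>
      have := hturn (k * (2 * Real.pi))
      push_cast
      rw [add_mul, one_mul]
      linarith
  have hdown : ∀ k : ℕ, α (-(k * (2 * Real.pi))) ≤ -(k * (2 * Real.pi)) := by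
    intro k
    induction k with
    | zero => simp [h0]
    | succ k ih =>
      have := hturn (-((k + 1 : ℕ) * (2 * Real.pi)))
      have h2 : -((k + 1 : ℕ) * (2 * Real.pi)) + 2 * Real.pi = -(k * (2 * Real.pi)) := by
        push_cast
        ring
      rw [h2] at this
      push_cast at this ⊢
      linarith
  have hsurj : Function.Surjective α := by
    intro c
    obtain ⟨k, hk⟩ := exists_nat_gt |c|
    have hk2 : (k : ℝ) ≤ k * (2 * Real.pi) := by
      have : (0 : ℝ) ≤ k := k.cast_nonneg
      nlinarith [Real.pi_gt_three]
    have hc' := abs_lt.1 hk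
    obtain ⟨s, -, hs⟩ := intermediate_value_Icc
      (show -(k * (2 * Real.pi)) ≤ k * (2 * Real.pi) by
        have : (0 : ℝ) ≤ k := k.cast_nonneg
        linarith) hc.continuousOn
      (show c ∈ Icc _ _ from ⟨by linarith [hdown k], by linarith [hup k]⟩)
    exact ⟨s, hs⟩
  let o := hm.orderIsoOfSurjective α hsurj
  refine ⟨o.symm, o.symm.continuous, o.symm.strictMono, ?_, fun s => ?_⟩
  · rw [OrderIso.symm_apply_eq]
    exact h0.symm
  · rw [Equiv.symm_apply_eq, h]
    congr 1
    exact (o.apply_symm_apply s).symm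

variable {N : Type*} {ψ : Circles n → Circles n'} {f : Circles n' → N} {x : Circles n} {a : N}

theorem HasOutput.comp (h : HasOutput f (ψ x) a) (hψ : IsReparametrization ψ) :
    HasOutput (fun y => f (ψ y)) x a := by
  obtain ⟨α, hc, hm, h0, hα⟩ := hψ x
  have : Tendsto α (𝓝[>] 0) (𝓝[>] 0) := by
    refine tendsto_nhdsWithin_iff.2 ⟨?_, ?_⟩
    · have := hc.tendsto 0
      rw [h0] at this
      exact this.mono_left nhdsWithin_le_nhds
    · filter_upwards [self_mem_nhdsWithin] with s hs
      rw [mem_Ioi, ← h0]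
      exact hm hs
  filter_upwards [this.eventually h] with s hs
  rw [hα]
  exact hs

theorem HasInput.comp (h : HasInput f (ψ x) a) (hψ : IsReparametrization ψ) :
    HasInput (fun y => f (ψ y)) x a := by
  obtain ⟨α, hc, hm, h0, hα⟩ := hψ x
  have : Tendsto (fun s => -α (-s)) (𝓝[>] 0) (𝓝[>] 0) := by
    refine tendsto_nhdsWithin_iff.2 ⟨?_, ?_⟩
    · have hc' : Continuous fun s => -α (-s) := by fun_prop
      have := hc'.tendsto 0
      simp only [neg_zero, h0] at this
      exact this.mono_left nhdsWithin_le_nhds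
    · filter_upwards [self_mem_nhdsWithin] with s hs
      rw [mem_Ioi, neg_pos, ← h0]
      exact hm (neg_lt_zero.2 hs)
  filter_upwards [this.eventually h] with s hs
  rw [neg_neg] at hs
  rw [hα]
  exact hs

end Reparametrization

/-- Transversality is transported by a map `g` of surfaces that carries charts near the crossing to
charts. -/
theorem PositivelyTransverse.transport {X X' : OrientedSurface.{u}} {n n' : ℕ} {γ : Circles n → X}
    {γ' : Circles n' → X'} {x y : Circles n} {x' y' : Circles n'}
    (h : PositivelyTransverse γ x y) (hγ : Continuous γ) (hne : x' ≠ y') (heq : γ' x' = γ' y')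
    (g : X → X') {α β : ℝ → ℝ} (hα : Continuous α) (hα' : StrictMono α) (hα0 : α 0 = 0)
    (hβ : Continuous β) (hβ' : StrictMono β) (hβ0 : β 0 = 0)
    (hx : ∀ᶠ s : ℝ in 𝓝 0, γ' (advance x' s) = g (γ (advance x (α s))))
    (hy : ∀ᶠ s : ℝ in 𝓝 0, γ' (advance y' s) = g (γ (advance y (β s))))
    (hg : ∀ e ∈ X.charts, γ x ∈ e.source → ∃ V ∈ 𝓝 (γ x), ∃ e' ∈ X'.charts,
      g (γ x) ∈ e'.source ∧ ∀ p ∈ V, e' (g p) = e p) :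
    PositivelyTransverse γ' x' y' := by
  obtain ⟨-, hxy, e, he, hxe, a, b, hab, α₀, β₀, hα₀, hβ₀, hlin⟩ := h
  obtain ⟨V, hV, e', he', hxe', hV'⟩ := hg e he hxe
  have hx0 := hx.self_of_nhds
  rw [hα0, advance_zero, advance_zero] at hx0
  have hαt : Tendsto α (𝓝 0) (𝓝 0) := by simpa [hα0] using hα.tendsto 0
  have hβt : Tendsto β (𝓝 0) (𝓝 0) := by simpa [hβ0] using hβ.tendsto 0
  have hxV : ∀ᶠ s : ℝ in 𝓝 0, γ (advance x (α s)) ∈ V :=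
    (((hγ.tendsto x).comp (tendsto_advance x)).comp hαt).eventually hV
  have hyV : ∀ᶠ s : ℝ in 𝓝 0, γ (advance y (β s)) ∈ V :=
    (((hγ.tendsto y).comp (tendsto_advance y)).comp hβt).eventually (by rwa [← hxy])
  refine ⟨hne, heq, e', he', by rwa [hx0], a, b, hab, α₀ ∘ α, β₀ ∘ β, hα₀.comp hα', hβ₀.comp hβ',
    ?_⟩
  filter_upwards [hx, hy, hxV, hyV, hαt.eventually hlin, hβt.eventually hlin]
    with s h1 h2 h3 h4 h5 h6
  rw [h1, h2, hx0, hV' _ h3, hV' _ h4, hV' _ (mem_of_mem_nhds hV)]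
  exact ⟨h5.1, h6.2⟩

namespace LinkDiagram

/-- A map that carries positively transverse pairs to such pairs also reflects them: one of the two
orders of the branches at a crossing is positively transverse, and not both are. -/
theorem positivelyTransverse_iff {X X' : OrientedSurface.{u}} {n n' : ℕ} {L : LinkDiagram X n}
    {L' : LinkDiagram X' n'} {ψ : Circles n → Circles n'}
    (hγ : ∀ x y, L.γ x = L.γ y ↔ L'.γ (ψ x) = L'.γ (ψ y))
    (h : ∀ x y, PositivelyTransverse L.γ x y → PositivelyTransverse L'.γ (ψ x) (ψ y))
    (x y : Circles n) :
    PositivelyTransverse L.γ x y ↔ PositivelyTransverse L'.γ (ψ x) (ψ y) := by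
  refine ⟨h x y, fun h' => ?_⟩
  refine (L.transverse x y (fun hxy => h'.1 (hxy ▸ rfl)) ((hγ x y).2 h'.2.1)).resolve_right ?_
  exact fun h'' => h'.asymm L'.continuous_γ (h y x h'')

theorem IsColouring.comp {X X' : OrientedSurface.{u}} {n n' : ℕ} {L : LinkDiagram X n}
    {L' : LinkDiagram X' n'} {N : Type*} {P : N → N → N → N → Prop} {f : Circles n' → N}
    (hf : L'.IsColouring P f) {ψ : Circles n → Circles n'} (hψ : IsReparametrization ψ)
    (hD : ∀ x, ψ x ∈ doublePreimages L'.γ → x ∈ doublePreimages L.γ)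
    (hover : ∀ x, x ∈ L.overPass ↔ ψ x ∈ L'.overPass)
    (hpt : ∀ x y, PositivelyTransverse L.γ x y → PositivelyTransverse L'.γ (ψ x) (ψ y)) :
    L.IsColouring P fun x => f (ψ x) := by
  constructor
  · intro x hx
    obtain ⟨α, hc, -, h0, hα⟩ := hψ x
    have : Tendsto α (𝓝 0) (𝓝 0) := by simpa [h0] using hc.tendsto 0
    filter_upwards [this.eventually (hf.eventually_eq (ψ x) (fun h => hx (hD x h)))] with s hs
    rw [hα, hs]
  · intro x y o hxy ho a b a' b' ha hb ha' hb'
    obtain ⟨c, hc⟩ := hf.exists_hasInput (ψ x)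
    obtain ⟨d, hd⟩ := hf.exists_hasInput (ψ y)
    obtain ⟨c', hc'⟩ := hf.exists_hasOutput (ψ x)
    obtain ⟨d', hd'⟩ := hf.exists_hasOutput (ψ y)
    rw [ha.unique (hc.comp hψ), hb.unique (hd.comp hψ), ha'.unique (hc'.comp hψ),
      hb'.unique (hd'.comp hψ)]
    exact hf.crossing (ψ x) (ψ y) o (hpt x y hxy) (ho.trans (hover x)) _ _ _ _ hc hd hc' hd'

/-- Diagrams on surfaces which correspond to each other under a reparametrization have isomorphic
modules. -/
theorem nonempty_linkModule_equiv_of_reparametrization {R : Type*} [Ring R] {A B C D : R}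
    {X X' : OrientedSurface.{u}} {n n' : ℕ} {L : LinkDiagram X n} {L' : LinkDiagram X' n'}
    (ψ : Circles n ≃ Circles n') (hψ : IsReparametrization ψ)
    (hγ : ∀ x y, L.γ x = L.γ y ↔ L'.γ (ψ x) = L'.γ (ψ y))
    (hover : ∀ x, x ∈ L.overPass ↔ ψ x ∈ L'.overPass)
    (hpt : ∀ x y, PositivelyTransverse L.γ x y → PositivelyTransverse L'.γ (ψ x) (ψ y)) :
    Nonempty (LinkModule A B C D L ≃ₗ[R] LinkModule A B C D L') := by
  have hD : ∀ x, x ∈ doublePreimages L.γ ↔ ψ x ∈ doublePreimages L'.γ := by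
    intro x
    constructor
    · rintro ⟨y, hy, h⟩
      exact ⟨ψ y, ψ.injective.ne hy, (hγ y x).1 h⟩
    · rintro ⟨y, hy, h⟩
      refine ⟨ψ.symm y, fun h' => hy (by rw [← h', ψ.apply_symm_apply]), ?_⟩
      rw [hγ, ψ.apply_symm_apply, h]
  refine nonempty_linkModule_equiv L L'
    (fun x x' => ψ x = x' ∧ x ∉ doublePreimages L.γ) (fun f hf => ?_)
    (fun f hf => ⟨_, hf.comp hψ (fun x => (hD x).2) hover hpt, ?_⟩) (fun f g _ _ h x hx => ?_)
    (fun f g _ _ h x hx => ?_) ?_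
  · refine ⟨_, hf.comp hψ.symm (fun x => ?_) (fun x => ?_) (fun x y => ?_), ?_⟩
    · rw [hD, ψ.apply_symm_apply]
      exact id
    · rw [hover, ψ.apply_symm_apply]
    · rw [positivelyTransverse_iff hγ hpt, ψ.apply_symm_apply, ψ.apply_symm_apply]
      exact id
    · rintro x x' ⟨rfl, -⟩
      rw [ψ.symm_apply_apply]
  · rintro x x' ⟨rfl, -⟩
    rfl
  · exact h x _ ⟨rfl, hx⟩
  · refine h (ψ.symm x) x ⟨ψ.apply_symm_apply x, ?_⟩
    rw [hD, ψ.apply_symm_apply]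
    exact hx
  · rintro x x' ⟨rfl, hx⟩
    exact ⟨hx, fun h => hx ((hD x).2 h)⟩

theorem _root_.Transfer.nonempty_linkModule_equiv {R : Type*} [Ring R] {A B C D : R}
    {X X' : OrientedSurface.{u}} {n n' : ℕ} {L : LinkDiagram X n} {L' : LinkDiagram X' n'}
    (h : Transfer L L') : Nonempty (LinkModule A B C D L ≃ₗ[R] LinkModule A B C D L') := by
  obtain ⟨h, ψ, hor, hψ, hγ, hover⟩ := h
  have hψ := isReparametrization_of_continuous hψ
  refine nonempty_linkModule_equiv_of_reparametrization ψ.toEquiv hψ (fun x y => ?_) hover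
    fun x y hxy => ?_
  · simp [hγ]
  · have key : ∀ x, ∃ α : ℝ → ℝ, Continuous α ∧ StrictMono α ∧ α 0 = 0 ∧
        ∀ s, L'.γ (advance (ψ x) s) = h (L.γ (advance x (α s))) := by
      intro x
      obtain ⟨α, h1, h2, h3, h4⟩ := hψ.symm (ψ.toEquiv x)
      refine ⟨α, h1, h2, h3, fun s => ?_⟩
      have := h4 s
      rw [ψ.toEquiv.symm_apply_apply] at this
      rw [← this, ← hγ]
      exact congrArg L'.γ (ψ.apply_symm_apply _).symm
    obtain ⟨α, h1, h2, h3, h4⟩ := key x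
    obtain ⟨β, g1, g2, g3, g4⟩ := key y
    refine hxy.transport L.continuous_γ (ψ.injective.ne hxy.1) ?_ h h1 h2 h3 g1 g2 g3
      (.of_forall h4) (.of_forall g4) fun e he hxe => ?_
    · simp [hγ, hxy.2.1]
    · obtain ⟨e', he', hs, hv⟩ := hor e he (subset_univ _) h.injective.injOn
      exact ⟨e.source, e.open_source.mem_nhds hxe, e', he', hs ▸ mem_image_of_mem _ hxe, hv⟩

/-! ### Handles -/

/-- The restriction of a positive chart to an open set is a positive chart. -/
theorem _root_.OrientedSurface.restr_mem_charts {X : OrientedSurface.{u}}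
    {e : OpenPartialHomeomorph X ℂ} (he : e ∈ X.charts) (W : Set X) : e.restr W ∈ X.charts := by
  refine X.maximal _ fun e' he' p hp => ?_
  rw [e.restr_source] at hp
  exact ⟨X.compatible e he e' he' p ⟨hp.1.1, hp.2⟩, X.compatible e' he' e he p ⟨hp.2, hp.1.1⟩⟩

/-- The map `π` to the surface with the handle is injective on the complement `W` of two closed discs,
which contains the diagram; the charts restricted to `W` are carried to charts. -/
theorem _root_.AttachHandle.nonempty_linkModule_equiv {R : Type*} [Ring R] {A B C D : R}
    {X X' : OrientedSurface.{u}} {n : ℕ} {L : LinkDiagram X n} {L' : LinkDiagram X' n}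
    (h : AttachHandle L L') : Nonempty (LinkModule A B C D L ≃ₗ[R] LinkModule A B C D L') := by
  obtain ⟨e₀, he₀, e₁, he₁, π, V, hb₀, hb₁, -, hV, -, -, -, hπ, hor, hL, hγ, hover⟩ := h
  set W : Set X := (e₀.symm '' Metric.closedBall 0 2 ∪ e₁.symm '' Metric.closedBall 0 2)ᶜ with hW
  have hclosed : ∀ e : OpenPartialHomeomorph X ℂ, Metric.closedBall 0 2 ⊆ e.target →
      IsClosed (e.symm '' Metric.closedBall 0 2) := fun e he =>
    ((isCompact_closedBall 0 2).image_of_continuousOn (e.continuousOn_symm.mono he)).isClosed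
  have hWo : IsOpen W := ((hclosed e₀ hb₀).union (hclosed e₁ hb₁)).isOpen_compl
  have hball : Metric.closedBall (0 : ℂ) (1 / 2) ⊆ Metric.closedBall 0 2 :=
    Metric.closedBall_subset_closedBall (by norm_num)
  have hWV : W ⊆ V := by
    rw [hW, hV]
    exact compl_subset_compl.2 (union_subset_union (image_mono hball) (image_mono hball))
  have hinj : InjOn π W := by
    intro p hp p' hp' hpp'
    refine ((hπ p (hWV hp) p' (hWV hp')).1 hpp').resolve_right ?_
    rintro ⟨z, -, hz, h | h⟩
    · exact hp (Or.inl ⟨z, by simpa using hz.le, h.1.symm⟩)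
    · exact hp' (Or.inl ⟨z, by simpa using hz.le, h.1.symm⟩)
  have hiff : ∀ x y, L.γ x = L.γ y ↔ L'.γ x = L'.γ y := fun x y => by
    rw [hγ, hγ]
    exact (hinj.eq_iff (hL x) (hL y)).symm
  refine nonempty_linkModule_equiv_of_reparametrization (.refl _) isReparametrization_id hiff
    (fun x => by rw [hover]; rfl) fun x y hxy => ?_
  refine hxy.transport L.continuous_γ hxy.1 ((hiff x y).1 hxy.2.1) π continuous_id strictMono_id
    rfl continuous_id strictMono_id rfl (.of_forall fun s => hγ _) (.of_forall fun s => hγ _)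
    fun e he hxe => ?_
  have hsrc : (e.restr W).source = e.source ∩ W := by rw [e.restr_source, hWo.interior_eq]
  obtain ⟨e', he', hs, hv⟩ := hor (e.restr W) (OrientedSurface.restr_mem_charts he W)
    (hsrc ▸ inter_subset_right.trans hWV) (hinj.mono (hsrc ▸ inter_subset_right))
  have hmem : L.γ x ∈ (e.restr W).source := hsrc ▸ ⟨hxe, hL x⟩
  exact ⟨(e.restr W).source, (e.restr W).open_source.mem_nhds hmem, e', he',
    hs ▸ mem_image_of_mem _ hmem, hv⟩

end LinkDiagram

/-! ### Pictures in a disc and their colourings -/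

/-- `Q` is the list of the crossings of the picture `T`, whose strands are parametrized by
`[-1, 1]`: for `Q i s j t` the strand `i` at the time `s` crosses the strand `j` at the time `t`,
both are straight there, and their directions form a positive basis of the plane. -/
structure IsCrossingList {k : ℕ} (T : Fin k → ℝ → ℂ) (Q : Fin k → ℝ → Fin k → ℝ → Prop) :
    Prop where
  mem_square : ∀ i, ∀ t ∈ Icc (-1 : ℝ) 1, T i t ∈ square
  of_eq : ∀ i, ∀ s ∈ Icc (-1 : ℝ) 1, ∀ j, ∀ t ∈ Icc (-1 : ℝ) 1, (i = j → s ≠ t) →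
    T i s = T j t → Q i s j t ∨ Q j t i s
  mem_left : ∀ {i s j t}, Q i s j t → s ∈ Ioo (-1 : ℝ) 1
  mem_right : ∀ {i s j t}, Q i s j t → t ∈ Ioo (-1 : ℝ) 1
  ne : ∀ {i s j t}, Q i s j t → i = j → s ≠ t
  eq : ∀ {i s j t}, Q i s j t → T i s = T j t
  straight : ∀ {i s j t}, Q i s j t → ∃ a b : ℂ, 0 < a.re * b.im - a.im * b.re ∧
    (∀ᶠ σ in 𝓝 s, T i σ = T i s + (σ - s : ℝ) * a) ∧
    ∀ᶠ σ in 𝓝 t, T j σ = T j t + (σ - t : ℝ) * b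

/-- Colours `g i t` along the strands of a picture with the list `Q` of crossings. The flag `ε i`
says that the strand `i` is oriented in the direction of its parametrization, and `o i s` that it is
the over strand at its crossing at the time `s`. -/
structure IsLocalColouring {k : ℕ} {N : Type*} (P : N → N → N → N → Prop)
    (Q : Fin k → ℝ → Fin k → ℝ → Prop) (ε : Fin k → Bool) (o : Fin k → ℝ → Bool)
    (g : Fin k → ℝ → N) : Prop where
  eventually_eq : ∀ i, ∀ t ∈ Icc (-1 : ℝ) 1, (∀ j s, ¬ Q i t j s ∧ ¬ Q j s i t) →
    ∀ᶠ σ in 𝓝 t, σ ∈ Icc (-1 : ℝ) 1 → g i σ = g i t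
  crossing : ∀ i s j t, Q i s j t → ∀ x y x' y', (∀ᶠ σ in 𝓝[<] s, g i σ = x) →
    (∀ᶠ σ in 𝓝[<] t, g j σ = y) → (∀ᶠ σ in 𝓝[>] s, g i σ = x') →
    (∀ᶠ σ in 𝓝[>] t, g j σ = y') → CrossingRel.cross P (ε i) (ε j) (o i s) x y x' y'

/-- The diagram `L` shows the picture `T` in the square of the chart `e`; the segments of the
circles that run there are given by their centres `c i` and signed radii `r i`. -/
structure LinkDiagram.Shows {X : OrientedSurface.{u}} {n k : ℕ} (L : LinkDiagram X n)
    (T : Fin k → ℝ → ℂ) (e : OpenPartialHomeomorph X ℂ) (c : Fin k → Circles n)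
    (r : Fin k → ℝ) : Prop where
  mem_charts : e ∈ X.charts
  square_subset : square ⊆ e.target
  r_ne : ∀ i, r i ≠ 0
  r_lt : ∀ i, |r i| < Real.pi
  disjoint : ∀ i j, ∀ s ∈ Icc (-1 : ℝ) 1, ∀ t ∈ Icc (-1 : ℝ) 1,
    segmentPoint (c i) (r i) s = segmentPoint (c j) (r j) t → i = j
  mem_iff : ∀ x, L.γ x ∈ e.symm '' square ↔
    ∃ i, ∃ t ∈ Icc (-1 : ℝ) 1, x = segmentPoint (c i) (r i) t
  eq_symm : ∀ i, ∀ t ∈ Icc (-1 : ℝ) 1, L.γ (segmentPoint (c i) (r i) t) = e.symm (T i t)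

theorem advance_segmentPoint {n : ℕ} (x : Circles n) {r : ℝ} (hr : r ≠ 0) (t s : ℝ) :
    advance (segmentPoint x r t) s = segmentPoint x r (r⁻¹ * s + t) := by
  rw [segmentPoint, segmentPoint, advance_advance]
  congr 1
  field_simp
  ring

theorem isCompact_square : IsCompact square := by
  have : square = Icc (-1 : ℝ) 1 ×ℂ Icc (-1) 1 := by
    ext z
    simp [square, Complex.mem_reProdIm, abs_le]
  rw [this]
  exact isCompact_Icc.reProdIm isCompact_Icc

theorem map_affine_nhds {m : ℝ} (hm : m ≠ 0) (t : ℝ) :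
    map (fun s => m * s + t) (𝓝 0) = 𝓝 t := by
  have := (affineHomeomorph m t hm).map_nhds_eq 0
  rwa [affineHomeomorph_apply, mul_zero, zero_add] at this

theorem map_affine_nhdsGT {m : ℝ} (hm : 0 < m) (t : ℝ) :
    map (fun s => m * s + t) (𝓝[>] 0) = 𝓝[>] t := by
  have := (affineHomeomorph m t hm.ne').isEmbedding.map_nhdsWithin_eq (Ioi 0) 0
  have h2 : (affineHomeomorph m t hm.ne') '' Ioi 0 = Ioi t := by
    ext s
    simp only [affineHomeomorph_apply, mem_image, mem_Ioi]
    constructor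
    · rintro ⟨a, ha, rfl⟩
      have := mul_pos hm ha
      linarith
    · intro h
      refine ⟨(s - t) / m, div_pos (by linarith) hm, ?_⟩
      field_simp
      ring
  rwa [h2, affineHomeomorph_apply, mul_zero, zero_add] at this

theorem map_affine_nhdsLT {m : ℝ} (hm : m < 0) (t : ℝ) :
    map (fun s => m * s + t) (𝓝[>] 0) = 𝓝[<] t := by
  have := (affineHomeomorph m t hm.ne).isEmbedding.map_nhdsWithin_eq (Ioi 0) 0
  have h2 : (affineHomeomorph m t hm.ne) '' Ioi 0 = Iio t := by
    ext s
    simp only [affineHomeomorph_apply, mem_image, mem_Ioi, mem_Iio]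
    constructor
    · rintro ⟨a, ha, rfl⟩
      have := mul_neg_of_neg_of_pos hm ha
      linarith
    · intro h
      refine ⟨(s - t) / m, div_pos_of_neg_of_neg (by linarith) hm, ?_⟩
      have := hm.ne
      field_simp
      ring
  rwa [h2, affineHomeomorph_apply, mul_zero, zero_add] at this

section Segment

variable {n : ℕ} {N : Type*} {x : Circles n} {r t : ℝ} {f : Circles n → N} {a : N}

theorem eventually_nhds_segmentPoint_iff (hr : r ≠ 0) {p : ℝ → Prop} :
    (∀ᶠ s in 𝓝 (0 : ℝ), p (r⁻¹ * s + t)) ↔ ∀ᶠ σ in 𝓝 t, p σ := by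
  rw [← map_affine_nhds (inv_ne_zero hr) t, eventually_map]

theorem hasOutput_segmentPoint_of_pos (hr : 0 < r) :
    HasOutput f (segmentPoint x r t) a ↔ ∀ᶠ σ in 𝓝[>] t, f (segmentPoint x r σ) = a := by
  rw [HasOutput, ← map_affine_nhdsGT (inv_pos.2 hr) t, eventually_map]
  simp only [advance_segmentPoint x hr.ne']

theorem hasInput_segmentPoint_of_pos (hr : 0 < r) :
    HasInput f (segmentPoint x r t) a ↔ ∀ᶠ σ in 𝓝[<] t, f (segmentPoint x r σ) = a := by
  rw [HasInput, ← map_affine_nhdsLT (neg_lt_zero.2 (inv_pos.2 hr)) t, eventually_map]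
  simp only [advance_segmentPoint x hr.ne', mul_neg, neg_mul]

theorem hasOutput_segmentPoint_of_neg (hr : r < 0) :
    HasOutput f (segmentPoint x r t) a ↔ ∀ᶠ σ in 𝓝[<] t, f (segmentPoint x r σ) = a := by
  rw [HasOutput, ← map_affine_nhdsLT (inv_lt_zero.2 hr) t, eventually_map]
  simp only [advance_segmentPoint x hr.ne]

theorem hasInput_segmentPoint_of_neg (hr : r < 0) :
    HasInput f (segmentPoint x r t) a ↔ ∀ᶠ σ in 𝓝[>] t, f (segmentPoint x r σ) = a := by
  rw [HasInput, ← map_affine_nhdsGT (neg_pos.2 (inv_lt_zero.2 hr)) t, eventually_map]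
  simp only [advance_segmentPoint x hr.ne, mul_neg, neg_mul]

end Segment

theorem IsLocalColouring.eq_of_isPreconnected {k : ℕ} {N : Type*} {P : N → N → N → N → Prop}
    {Q : Fin k → ℝ → Fin k → ℝ → Prop} {ε : Fin k → Bool} {o : Fin k → ℝ → Bool}
    {g : Fin k → ℝ → N} (hg : IsLocalColouring P Q ε o g) {i : Fin k} {I : Set ℝ}
    (hI : IsPreconnected I) (hsub : I ⊆ Icc (-1) 1)
    (hQ : ∀ t ∈ I, ∀ j s, ¬ Q i t j s ∧ ¬ Q j s i t) {s t : ℝ} (hs : s ∈ I) (ht : t ∈ I) :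
    g i s = g i t := by
  refine hI.induction₂ (fun s t => g i s = g i t) (fun t ht => ?_)
    (fun _ _ _ _ _ _ h h' => h.trans h') (fun _ _ _ _ h => h.symm) hs ht
  filter_upwards [nhdsWithin_le_nhds (hg.eventually_eq i t (hsub ht) (hQ t ht)),
    self_mem_nhdsWithin] with σ h hσ
  exact (h (hsub hσ)).symm

namespace LinkDiagram

variable {X : OrientedSurface.{u}} {n k : ℕ} {L : LinkDiagram X n} {T : Fin k → ℝ → ℂ}
  {e : OpenPartialHomeomorph X ℂ} {c : Fin k → Circles n} {r : Fin k → ℝ}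
  {Q : Fin k → ℝ → Fin k → ℝ → Prop} {N : Type*} {P : N → N → N → N → Prop} {f : Circles n → N}

/-- The relation of the crossing with the branches at `x` and `y`, if `(x, y)` is the positively
transverse order of the branches. -/
def CrossingRelation (P : N → N → N → N → Prop) (L : LinkDiagram X n) (f : Circles n → N)
    (x y : Circles n) : Prop :=
  ∀ o : Bool, (o = true ↔ x ∈ L.overPass) → ∀ a b a' b', HasInput f x a → HasInput f y b →
    HasOutput f x a' → HasOutput f y b' → CrossingRel.cross P true true o a b a' b'

namespace Shows

theorem injective (h : L.Shows T e c r) {i j : Fin k} {s t : ℝ} (hs : s ∈ Icc (-1 : ℝ) 1)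
    (ht : t ∈ Icc (-1 : ℝ) 1) (heq : segmentPoint (c i) (r i) s = segmentPoint (c j) (r j) t) :
    i = j ∧ s = t := by
  obtain rfl := h.disjoint i j s hs t ht heq
  refine ⟨rfl, mul_left_cancel₀ (h.r_ne i) (advance_inj heq ?_)⟩
  have h1 : |s - t| ≤ 2 := abs_le.2 ⟨by linarith [hs.1, ht.2], by linarith [hs.2, ht.1]⟩
  rw [← mul_sub, abs_mul]
  nlinarith [h.r_lt i, abs_nonneg (r i), abs_nonneg (s - t)]

theorem isClosed_preimage (h : L.Shows T e c r) : IsClosed {x | L.γ x ∈ e.symm '' square} :=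
  (isCompact_square.image_of_continuousOn
    (e.continuousOn_symm.mono h.square_subset)).isClosed.preimage L.continuous_γ

theorem segmentPoint_mem (h : L.Shows T e c r) (i : Fin k) {t : ℝ} (ht : t ∈ Icc (-1 : ℝ) 1) :
    L.γ (segmentPoint (c i) (r i) t) ∈ e.symm '' square :=
  (h.mem_iff _).2 ⟨i, t, ht, rfl⟩

theorem γ_eq_iff (h : L.Shows T e c r) (hQ : IsCrossingList T Q) {i j : Fin k} {s t : ℝ}
    (hs : s ∈ Icc (-1 : ℝ) 1) (ht : t ∈ Icc (-1 : ℝ) 1) :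
    L.γ (segmentPoint (c i) (r i) s) = L.γ (segmentPoint (c j) (r j) t) ↔ T i s = T j t := by
  rw [h.eq_symm i s hs, h.eq_symm j t ht]
  exact e.symm.injOn.eq_iff (h.square_subset (hQ.mem_square i s hs))
    (h.square_subset (hQ.mem_square j t ht))

/-- A double point in the square is a crossing of the picture. -/
theorem exists_crossing (h : L.Shows T e c r) (hQ : IsCrossingList T Q) {i : Fin k} {t : ℝ}
    (ht : t ∈ Icc (-1 : ℝ) 1) {y : Circles n} (hy : y ≠ segmentPoint (c i) (r i) t)
    (heq : L.γ y = L.γ (segmentPoint (c i) (r i) t)) :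
    ∃ j s, y = segmentPoint (c j) (r j) s ∧ s ∈ Icc (-1 : ℝ) 1 ∧ (Q i t j s ∨ Q j s i t) := by
  obtain ⟨j, s, hs, rfl⟩ := (h.mem_iff y).1 (heq ▸ h.segmentPoint_mem i ht)
  refine ⟨j, s, rfl, hs, hQ.of_eq i t ht j s hs ?_ ((h.γ_eq_iff hQ ht hs).1 heq.symm)⟩
  rintro rfl rfl
  exact hy rfl

theorem mem_doublePreimages_iff (h : L.Shows T e c r) (hQ : IsCrossingList T Q) {i : Fin k}
    {t : ℝ} (ht : t ∈ Icc (-1 : ℝ) 1) :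
    segmentPoint (c i) (r i) t ∈ doublePreimages L.γ ↔ ∃ j s, Q i t j s ∨ Q j s i t := by
  constructor
  · rintro ⟨y, hy, heq⟩
    obtain ⟨j, s, -, -, h'⟩ := h.exists_crossing hQ ht hy heq
    exact ⟨j, s, h'⟩
  · rintro ⟨j, s, h'⟩
    have hs : s ∈ Icc (-1 : ℝ) 1 := by
      rcases h' with h' | h'
      exacts [Ioo_subset_Icc_self (hQ.mem_right h'), Ioo_subset_Icc_self (hQ.mem_left h')]
    refine ⟨segmentPoint (c j) (r j) s, fun heq => ?_, (h.γ_eq_iff hQ hs ht).2 ?_⟩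
    · obtain ⟨h1, h2⟩ := h.injective hs ht heq
      rcases h' with h' | h'
      exacts [hQ.ne h' h1.symm h2.symm, hQ.ne h' h1 h2]
    · rcases h' with h' | h'
      exacts [(hQ.eq h').symm, hQ.eq h']

theorem end_notMem_doublePreimages (h : L.Shows T e c r) (hQ : IsCrossingList T Q) (i : Fin k)
    {t : ℝ} (ht : t = -1 ∨ t = 1) : segmentPoint (c i) (r i) t ∉ doublePreimages L.γ := by
  have ht' : t ∈ Icc (-1 : ℝ) 1 := by rcases ht with rfl | rfl <;> norm_num
  rw [h.mem_doublePreimages_iff hQ ht']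
  rintro ⟨j, s, h' | h'⟩
  · have := hQ.mem_left h'
    rcases ht with rfl | rfl <;> simp at this
  · have := hQ.mem_right h'
    rcases ht with rfl | rfl <;> simp at this

/-- A strand that is straight in the picture is straight in the chart `e`. -/
theorem eventually_straight (h : L.Shows T e c r) (hQ : IsCrossingList T Q) {i : Fin k} {s : ℝ}
    (hs : s ∈ Ioo (-1 : ℝ) 1) {a : ℂ} (ha : ∀ᶠ σ in 𝓝 s, T i σ = T i s + (σ - s : ℝ) * a) :
    ∀ᶠ τ : ℝ in 𝓝 0, e (L.γ (advance (segmentPoint (c i) (r i) s) τ)) =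
      e (L.γ (segmentPoint (c i) (r i) s)) + (τ : ℝ) * ((r i)⁻¹ * a) := by
  have hT : ∀ {σ : ℝ}, σ ∈ Ioo (-1 : ℝ) 1 → e (L.γ (segmentPoint (c i) (r i) σ)) = T i σ := by
    intro σ hσ
    have hσ := Ioo_subset_Icc_self hσ
    rw [h.eq_symm i σ hσ, e.right_inv (h.square_subset (hQ.mem_square i σ hσ))]
  have := (eventually_nhds_segmentPoint_iff (t := s) (h.r_ne i)).2
    (ha.and (isOpen_Ioo.mem_nhds hs))
  filter_upwards [this] with τ hτ
  rw [advance_segmentPoint _ (h.r_ne i), hT hτ.2, hT hs, hτ.1]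
  push_cast
  ring

/-- The positively transverse order of the branches at a crossing of the picture depends on whether
the parametrizations of the strands are compatible with the orientations. -/
theorem positivelyTransverse (h : L.Shows T e c r) (hQ : IsCrossingList T Q) {i j : Fin k}
    {s t : ℝ} (hst : Q i s j t) :
    (0 < r i * r j → PositivelyTransverse L.γ (segmentPoint (c i) (r i) s)
      (segmentPoint (c j) (r j) t)) ∧
    (r i * r j < 0 → PositivelyTransverse L.γ (segmentPoint (c j) (r j) t)
      (segmentPoint (c i) (r i) s)) := by
  obtain ⟨a, b, hab, ha, hb⟩ := hQ.straight hst
  have hs := hQ.mem_left hst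
  have ht := hQ.mem_right hst
  have hs' := Ioo_subset_Icc_self hs
  have ht' := Ioo_subset_Icc_self ht
  have hne : segmentPoint (c i) (r i) s ≠ segmentPoint (c j) (r j) t := fun heq =>
    hQ.ne hst (h.injective hs' ht' heq).1 (h.injective hs' ht' heq).2
  have heq := (h.γ_eq_iff hQ hs' ht').2 (hQ.eq hst)
  have hsrc : L.γ (segmentPoint (c i) (r i) s) ∈ e.source := by
    rw [h.eq_symm i s hs']
    exact e.map_target (h.square_subset (hQ.mem_square i s hs'))
  have hdet : ∀ p q : ℝ, ((p : ℂ) * a).re * ((q : ℂ) * b).im - ((p : ℂ) * a).im * ((q : ℂ) * b).re =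
      p * q * (a.re * b.im - a.im * b.re) := by
    intro p q
    rw [Complex.re_ofReal_mul, Complex.im_ofReal_mul, Complex.re_ofReal_mul, Complex.im_ofReal_mul]
    ring
  have h1 := h.eventually_straight hQ hs ha
  have h2 := h.eventually_straight hQ ht hb
  constructor
  · intro hr
    refine ⟨hne, heq, e, h.mem_charts, hsrc, _, _, ?_, id, id, strictMono_id, strictMono_id,
      h1.and (by rw [heq]; exact h2)⟩
    rw [hdet, ← mul_inv]
    exact mul_pos (inv_pos.2 hr) hab
  · intro hr
    refine ⟨hne.symm, heq.symm, e, h.mem_charts, heq ▸ hsrc, _, _, ?_, id, id, strictMono_id,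
      strictMono_id, h2.and (by rw [← heq]; exact h1)⟩
    have := mul_pos (neg_pos.2 (inv_lt_zero.2 hr)) hab
    have h3 := hdet (r i)⁻¹ (r j)⁻¹
    rw [← mul_inv] at h3
    linarith

/-- The relation at a crossing of the picture, in terms of the orientations of the strands relative
to their parametrizations. -/
theorem crossingRelation_iff (h : L.Shows T e c r) (hQ : IsCrossingList T Q) {i j : Fin k}
    {s t : ℝ} (hst : Q i s j t) (f : Circles n → N) {ε : Fin k → Bool}
    (hε : ∀ i, ε i = true ↔ 0 < r i) {o : Bool}
    (ho : o = true ↔ segmentPoint (c i) (r i) s ∈ L.overPass) :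
    (∀ x y x' y', (∀ᶠ σ in 𝓝[<] s, f (segmentPoint (c i) (r i) σ) = x) →
      (∀ᶠ σ in 𝓝[<] t, f (segmentPoint (c j) (r j) σ) = y) →
      (∀ᶠ σ in 𝓝[>] s, f (segmentPoint (c i) (r i) σ) = x') →
      (∀ᶠ σ in 𝓝[>] t, f (segmentPoint (c j) (r j) σ) = y') →
      CrossingRel.cross P (ε i) (ε j) o x y x' y') ↔
    (0 < r i * r j → CrossingRelation P L f (segmentPoint (c i) (r i) s)
      (segmentPoint (c j) (r j) t)) ∧
    (r i * r j < 0 → CrossingRelation P L f (segmentPoint (c j) (r j) t)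
      (segmentPoint (c i) (r i) s)) := by
  have hne : segmentPoint (c i) (r i) s ≠ segmentPoint (c j) (r j) t := fun heq =>
    hQ.ne hst (h.injective (Ioo_subset_Icc_self (hQ.mem_left hst))
      (Ioo_subset_Icc_self (hQ.mem_right hst)) heq).1
      (h.injective (Ioo_subset_Icc_self (hQ.mem_left hst))
      (Ioo_subset_Icc_self (hQ.mem_right hst)) heq).2
  have heq := (h.γ_eq_iff hQ (Ioo_subset_Icc_self (hQ.mem_left hst))
    (Ioo_subset_Icc_self (hQ.mem_right hst))).2 (hQ.eq hst)
  have hover := L.overPass_iff _ _ hne heq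
  have ho' : (!o) = true ↔ segmentPoint (c j) (r j) t ∈ L.overPass := by
    rw [Bool.not_eq_true', Bool.eq_false_iff, ne_eq, ho, hover, not_not]
  have flag : ∀ {p : Bool} {A : Prop}, (o = true ↔ A) → (p = true ↔ A) → p = o :=
    fun h1 h2 => Bool.eq_iff_iff.2 (h2.trans h1.symm)
  have flag' : ∀ {p : Bool} {A : Prop}, ((!o) = true ↔ A) → (p = true ↔ A) → p = !o :=
    fun h1 h2 => Bool.eq_iff_iff.2 (h2.trans h1.symm)
  rcases lt_or_gt_of_ne (h.r_ne i) with hi | hi <;> rcases lt_or_gt_of_ne (h.r_ne j) with hj | hj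
  · have hεi : ε i = false := by rw [Bool.eq_false_iff, ne_eq, hε]; exact hi.not_gt
    have hεj : ε j = false := by rw [Bool.eq_false_iff, ne_eq, hε]; exact hj.not_gt
    have hij := mul_pos_of_neg_of_neg hi hj
    simp only [hεi, hεj, hij, hij.not_gt, true_imp_iff, false_imp_iff, and_true, CrossingRelation,
      hasInput_segmentPoint_of_neg hi, hasInput_segmentPoint_of_neg hj,
      hasOutput_segmentPoint_of_neg hi, hasOutput_segmentPoint_of_neg hj]
    constructor
    · intro H p hp a b a' b' h1 h2 h3 h4
      have := H _ _ _ _ h3 h4 h1 h2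
      rw [flag ho hp]
      cases o <;> exact this
    · intro H x y x' y' h1 h2 h3 h4
      have := H o ho _ _ _ _ h3 h4 h1 h2
      cases o <;> exact this
  · have hεi : ε i = false := by rw [Bool.eq_false_iff, ne_eq, hε]; exact hi.not_gt
    have hεj : ε j = true := (hε j).2 hj
    have hij := mul_neg_of_neg_of_pos hi hj
    simp only [hεi, hεj, hij, hij.not_gt, true_imp_iff, false_imp_iff, true_and, CrossingRelation,
      hasInput_segmentPoint_of_neg hi, hasInput_segmentPoint_of_pos hj,
      hasOutput_segmentPoint_of_neg hi, hasOutput_segmentPoint_of_pos hj]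
    constructor
    · intro H p hp a b a' b' h1 h2 h3 h4
      have := H _ _ _ _ h4 h1 h2 h3
      rw [flag' ho' hp]
      cases o <;> exact this
    · intro H x y x' y' h1 h2 h3 h4
      have := H (!o) ho' _ _ _ _ h2 h3 h4 h1
      cases o <;> exact this
  · have hεi : ε i = true := (hε i).2 hi
    have hεj : ε j = false := by rw [Bool.eq_false_iff, ne_eq, hε]; exact hj.not_gt
    have hij := mul_neg_of_pos_of_neg hi hj
    simp only [hεi, hεj, hij, hij.not_gt, true_imp_iff, false_imp_iff, true_and, CrossingRelation,
      hasInput_segmentPoint_of_pos hi, hasInput_segmentPoint_of_neg hj,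
      hasOutput_segmentPoint_of_pos hi, hasOutput_segmentPoint_of_neg hj]
    constructor
    · intro H p hp a b a' b' h1 h2 h3 h4
      have := H _ _ _ _ h2 h3 h4 h1
      rw [flag' ho' hp]
      cases o <;> exact this
    · intro H x y x' y' h1 h2 h3 h4
      have := H (!o) ho' _ _ _ _ h4 h1 h2 h3
      cases o <;> exact this
  · have hεi : ε i = true := (hε i).2 hi
    have hεj : ε j = true := (hε j).2 hj
    have hij := mul_pos hi hj
    simp only [hεi, hεj, hij, hij.not_gt, true_imp_iff, false_imp_iff, and_true, CrossingRelation,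
      hasInput_segmentPoint_of_pos hi, hasInput_segmentPoint_of_pos hj,
      hasOutput_segmentPoint_of_pos hi, hasOutput_segmentPoint_of_pos hj]
    constructor
    · intro H p hp a b a' b' h1 h2 h3 h4
      have := H _ _ _ _ h1 h2 h3 h4
      rwa [flag ho hp]
    · intro H x y x' y' h1 h2 h3 h4
      exact H o ho _ _ _ _ h1 h2 h3 h4

end Shows

/-- A colouring of the diagram restricts to a colouring of the picture. -/
theorem IsColouring.isLocalColouring (hf : L.IsColouring P f) (h : L.Shows T e c r)
    (hQ : IsCrossingList T Q) {ε : Fin k → Bool} (hε : ∀ i, ε i = true ↔ 0 < r i)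
    {o : Fin k → ℝ → Bool} (ho : ∀ i s, o i s = true ↔ segmentPoint (c i) (r i) s ∈ L.overPass) :
    IsLocalColouring P Q ε o fun i t => f (segmentPoint (c i) (r i) t) := by
  constructor
  · intro i t ht hno
    have hD : segmentPoint (c i) (r i) t ∉ doublePreimages L.γ := by
      rw [h.mem_doublePreimages_iff hQ ht]
      rintro ⟨j, s, h' | h'⟩
      exacts [(hno j s).1 h', (hno j s).2 h']
    have := hf.eventually_eq _ hD
    simp only [advance_segmentPoint _ (h.r_ne i)] at this
    rw [eventually_nhds_segmentPoint_iff (h.r_ne i)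
      (p := fun σ => f (segmentPoint (c i) (r i) σ) = f (segmentPoint (c i) (r i) t))] at this
    exact this.mono fun _ h _ => h
  · intro i s j t hst
    refine (h.crossingRelation_iff hQ hst f hε (ho i s)).2 ⟨fun hr => ?_, fun hr => ?_⟩
    · exact fun o ho => hf.crossing _ _ o ((h.positivelyTransverse hQ hst).1 hr) ho
    · exact fun o ho => hf.crossing _ _ o ((h.positivelyTransverse hQ hst).2 hr) ho

end LinkDiagram

/-! ### Gluing colourings along the boundary of the disc -/

universe v

namespace LinkDiagram

variable {X : OrientedSurface.{u}} {n k : ℕ} {L L' : LinkDiagram X n} {T T' : Fin k → ℝ → ℂ}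
  {e : OpenPartialHomeomorph X ℂ} {c : Fin k → Circles n} {r : Fin k → ℝ}
  {Q Q' : Fin k → ℝ → Fin k → ℝ → Prop} {N : Type*} {P : N → N → N → N → Prop}

/-- The diagrams `L` and `L'` coincide outside of the square of the chart `e`. -/
def AgreeOutside (e : OpenPartialHomeomorph X ℂ) (L L' : LinkDiagram X n) : Prop :=
  ∀ x, L.γ x ∉ e.symm '' square → L.γ x = L'.γ x ∧ (x ∈ L.overPass ↔ x ∈ L'.overPass)

theorem Shows.mem_iff_mem (h : L.Shows T e c r) (h' : L'.Shows T' e c r) (x : Circles n) :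
    L'.γ x ∈ e.symm '' square ↔ L.γ x ∈ e.symm '' square := by
  rw [h.mem_iff, h'.mem_iff]

theorem AgreeOutside.symm (hout : AgreeOutside e L L') (h : L.Shows T e c r)
    (h' : L'.Shows T' e c r) : AgreeOutside e L' L := fun x hx =>
  have := hout x fun hx' => hx ((h.mem_iff_mem h' x).2 hx')
  ⟨this.1.symm, this.2.symm⟩

theorem AgreeOutside.mem_doublePreimages (hout : AgreeOutside e L L') {x : Circles n}
    (hx : L.γ x ∉ e.symm '' square) (hD : x ∈ doublePreimages L.γ) :
    x ∈ doublePreimages L'.γ := by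
  obtain ⟨y, hy, hxy⟩ := hD
  exact ⟨y, hy, by rw [← (hout x hx).1, ← (hout y (hxy ▸ hx)).1, hxy]⟩

theorem Shows.eventually_notMem (h : L.Shows T e c r) {x : Circles n}
    (hx : L.γ x ∉ e.symm '' square) :
    ∀ᶠ s : ℝ in 𝓝 0, L.γ (advance x s) ∉ e.symm '' square :=
  (tendsto_advance x).eventually (h.isClosed_preimage.isOpen_compl.mem_nhds hx)

/-- Near a point of a segment the circle meets the square only in the segment. -/
theorem Shows.eventually_mem_Icc (h : L.Shows T e c r) {i : Fin k} {t : ℝ}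
    (ht : t ∈ Icc (-1 : ℝ) 1) :
    ∀ᶠ σ : ℝ in 𝓝 t, L.γ (segmentPoint (c i) (r i) σ) ∈ e.symm '' square →
      σ ∈ Icc (-1 : ℝ) 1 := by
  have hcont : ∀ j, Continuous fun σ => segmentPoint (c j) (r j) σ := fun j =>
    (continuous_advance _).comp (continuous_const_mul _)
  have h1 : ∀ᶠ σ : ℝ in 𝓝 t, ∀ j, j ≠ i →
      segmentPoint (c i) (r i) σ ∉ (fun σ => segmentPoint (c j) (r j) σ) '' Icc (-1) 1 := by
    rw [eventually_all]
    intro j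
    by_cases hj : j = i
    · simp [hj]
    · have hcl := (isCompact_Icc.image (hcont j) (s := Icc (-1 : ℝ) 1)).isClosed
      refine ((hcont i).tendsto t).eventually (hcl.isOpen_compl.mem_nhds ?_) |>.mono
        fun _ h _ => h
      rintro ⟨s, hs, heq⟩
      exact hj (h.disjoint j i s hs t ht heq)
  have h2 : ∀ᶠ σ : ℝ in 𝓝 t, |r i| * (|σ| + 1) < 2 * Real.pi := by
    have hc : Continuous fun σ : ℝ => |r i| * (|σ| + 1) := by fun_prop
    refine (hc.tendsto t).eventually_lt_const ?_
    have := abs_le.2 ht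
    nlinarith [h.r_lt i, abs_nonneg (r i)]
  filter_upwards [h1, h2] with σ h1 h2 hσ
  obtain ⟨j, s, hs, heq⟩ := (h.mem_iff _).1 hσ
  have hj : j = i := by
    by_contra hj
    exact h1 j hj ⟨s, hs, heq.symm⟩
  subst hj
  have : r j * σ = r j * s := by
    refine advance_inj heq ?_
    rw [← mul_sub, abs_mul]
    refine lt_of_le_of_lt (mul_le_mul_of_nonneg_left ?_ (abs_nonneg _)) h2
    exact (abs_sub _ _).trans (add_le_add_right (abs_le.2 hs) _)
  rwa [mul_left_cancel₀ (h.r_ne j) this]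

/-- A colouring of a diagram can be changed inside of the disc: there it may be replaced by a
colouring of the other picture that has the same values at the ends of the strands. -/
theorem IsColouring.exists_glue (h : L.Shows T e c r) (h' : L'.Shows T' e c r)
    (hQ : IsCrossingList T Q) (hQ' : IsCrossingList T' Q') (hout : AgreeOutside e L L')
    {f : Circles n → N} (hf : L.IsColouring P f) {ε : Fin k → Bool}
    (hε : ∀ i, ε i = true ↔ 0 < r i) {o : Fin k → ℝ → Bool}
    (ho : ∀ i s, o i s = true ↔ segmentPoint (c i) (r i) s ∈ L'.overPass) {g : Fin k → ℝ → N}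
    (hg : IsLocalColouring P Q' ε o g)
    (hends : ∀ i, ∀ t : ℝ, t = -1 ∨ t = 1 → g i t = f (segmentPoint (c i) (r i) t)) :
    ∃ f', L'.IsColouring P f' ∧ ∀ x, L.γ x ∉ e.symm '' square → f' x = f x := by
  classical
  obtain ⟨f', hseg, hext⟩ : ∃ f' : Circles n → N,
      (∀ i, ∀ t ∈ Icc (-1 : ℝ) 1, f' (segmentPoint (c i) (r i) t) = g i t) ∧
      ∀ x, L.γ x ∉ e.symm '' square → f' x = f x := by
    refine ⟨fun x => if hx : ∃ p : Fin k × ℝ, p.2 ∈ Icc (-1 : ℝ) 1 ∧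
      x = segmentPoint (c p.1) (r p.1) p.2 then g hx.choose.1 hx.choose.2 else f x,
      fun i t ht => ?_, fun x hx => ?_⟩
    · have hx : ∃ p : Fin k × ℝ, p.2 ∈ Icc (-1 : ℝ) 1 ∧
          segmentPoint (c i) (r i) t = segmentPoint (c p.1) (r p.1) p.2 := ⟨(i, t), ht, rfl⟩
      obtain ⟨h1, h2⟩ := h.injective ht hx.choose_spec.1 hx.choose_spec.2
      exact (dif_pos hx).trans (by rw [← h1, ← h2])
    · refine dif_neg ?_
      rintro ⟨p, hp, rfl⟩
      exact hx (h.segmentPoint_mem p.1 hp)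
  refine ⟨f', ⟨fun x hx => ?_, fun x y p hxy hp => ?_⟩, hext⟩
  · -- the new colouring is locally constant; at an end of a strand both colourings are involved
    by_cases hxS : L.γ x ∈ e.symm '' square
    · obtain ⟨i, t, ht, rfl⟩ := (h.mem_iff x).1 hxS
      have hno : ∀ j s, ¬ Q' i t j s ∧ ¬ Q' j s i t := by
        intro j s
        rw [h'.mem_doublePreimages_iff hQ' ht] at hx
        exact ⟨fun h => hx ⟨j, s, Or.inl h⟩, fun h => hx ⟨j, s, Or.inr h⟩⟩
      have h1 := hg.eventually_eq i t ht hno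
      simp only [advance_segmentPoint _ (h.r_ne i)]
      rw [eventually_nhds_segmentPoint_iff (h.r_ne i)
        (p := fun σ => f' (segmentPoint (c i) (r i) σ) = f' (segmentPoint (c i) (r i) t)),
        hseg i t ht]
      by_cases hint : t ∈ Ioo (-1 : ℝ) 1
      · filter_upwards [h1, isOpen_Ioo.mem_nhds hint] with σ h1 hσ
        have hσ := Ioo_subset_Icc_self hσ
        rw [hseg i σ hσ, h1 hσ]
      · have hend : t = -1 ∨ t = 1 := by
          by_contra! hne
          exact hint ⟨lt_of_le_of_ne ht.1 hne.1.symm, lt_of_le_of_ne ht.2 hne.2⟩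
        have h2 := hf.eventually_eq _ (h.end_notMem_doublePreimages hQ i hend)
        simp only [advance_segmentPoint _ (h.r_ne i)] at h2
        rw [eventually_nhds_segmentPoint_iff (h.r_ne i) (p := fun σ =>
          f (segmentPoint (c i) (r i) σ) = f (segmentPoint (c i) (r i) t))] at h2
        filter_upwards [h1, h2, h.eventually_mem_Icc ht] with σ h1 h2 h3
        by_cases hσ : L.γ (segmentPoint (c i) (r i) σ) ∈ e.symm '' square
        · rw [hseg i σ (h3 hσ), h1 (h3 hσ)]
        · rw [hext _ hσ, h2, hends i t hend]
    · have hxD : x ∉ doublePreimages L.γ := fun hD => hx (hout.mem_doublePreimages hxS hD)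
      filter_upwards [hf.eventually_eq x hxD, h.eventually_notMem hxS] with s h1 h2
      rw [hext _ h2, hext _ hxS, h1]
  · by_cases hxS : L.γ x ∈ e.symm '' square
    · have hxS' := (h.mem_iff_mem h' x).2 hxS
      obtain ⟨i, s, hs, rfl⟩ := (h.mem_iff x).1 hxS
      obtain ⟨j, t, rfl, ht, hst⟩ := h'.exists_crossing hQ' hs hxy.1.symm hxy.2.1.symm
      have key : ∀ i s j t, Q' i s j t →
          (0 < r i * r j → CrossingRelation P L' f' (segmentPoint (c i) (r i) s)
            (segmentPoint (c j) (r j) t)) ∧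
          (r i * r j < 0 → CrossingRelation P L' f' (segmentPoint (c j) (r j) t)
            (segmentPoint (c i) (r i) s)) := by
        intro i s j t hst
        refine (h'.crossingRelation_iff hQ' hst f' hε (ho i s)).1 ?_
        have near : ∀ {i s}, s ∈ Ioo (-1 : ℝ) 1 →
            ∀ᶠ σ in 𝓝 s, f' (segmentPoint (c i) (r i) σ) = g i σ := by
          intro i s hs
          filter_upwards [isOpen_Ioo.mem_nhds hs] with σ hσ
          exact hseg i σ (Ioo_subset_Icc_self hσ)
        have near_s := near (i := i) (hQ'.mem_left hst)
        have near_t := near (i := j) (hQ'.mem_right hst)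
        intro x y x' y' h1 h2 h3 h4
        refine hg.crossing i s j t hst x y x' y' ?_ ?_ ?_ ?_
        · filter_upwards [h1, nhdsWithin_le_nhds near_s] with σ h1 h2
          rw [← h2, h1]
        · filter_upwards [h2, nhdsWithin_le_nhds near_t] with σ h1 h2
          rw [← h2, h1]
        · filter_upwards [h3, nhdsWithin_le_nhds near_s] with σ h1 h2
          rw [← h2, h1]
        · filter_upwards [h4, nhdsWithin_le_nhds near_t] with σ h1 h2
          rw [← h2, h1]
      -- the positive order of the branches decides which half of `key` applies
      have hpt := hxy.asymm L'.continuous_γ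
      rcases hst with hst | hst
      · rcases lt_or_gt_of_ne (mul_ne_zero (h.r_ne i) (h.r_ne j)) with hr | hr
        · exact absurd ((h'.positivelyTransverse hQ' hst).2 hr) hpt
        · exact (key i s j t hst).1 hr p hp
      · rcases lt_or_gt_of_ne (mul_ne_zero (h.r_ne j) (h.r_ne i)) with hr | hr
        · exact (key j t i s hst).2 hr p hp
        · exact absurd ((h'.positivelyTransverse hQ' hst).1 hr) hpt
    · have hyS : L.γ y ∉ e.symm '' square := by
        rw [← h.mem_iff_mem h', ← hxy.2.1, h.mem_iff_mem h']
        exact hxS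
      have hx := hout x hxS
      have hy := hout y hyS
      have nearx := h.eventually_notMem hxS
      have neary := h.eventually_notMem hyS
      have hxyL : PositivelyTransverse L.γ x y := by
        refine hxy.transport L'.continuous_γ hxy.1 (by rw [hx.1, hy.1, hxy.2.1]) id continuous_id
          strictMono_id rfl continuous_id strictMono_id rfl
          (nearx.mono fun s hs => (hout _ hs).1) (neary.mono fun s hs => (hout _ hs).1) ?_
        exact fun e' he' hxe' => ⟨_, e'.open_source.mem_nhds hxe', e', he', hxe', fun _ _ => rfl⟩
      intro a b a' b' h1 h2 h3 h4
      refine hf.crossing x y p hxyL (by rw [hp, hx.2]) a b a' b' ?_ ?_ ?_ ?_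
      · filter_upwards [h1, (tendsto_neg_nhdsGT_zero.mono_right nhdsWithin_le_nhds).eventually
          nearx] with s h1 h2
        rw [← hext _ h2, h1]
      · filter_upwards [h2, (tendsto_neg_nhdsGT_zero.mono_right nhdsWithin_le_nhds).eventually
          neary] with s h1 h2
        rw [← hext _ h2, h1]
      · filter_upwards [h3, nhdsWithin_le_nhds nearx] with s h1 h2
        rw [← hext _ h2, h1]
      · filter_upwards [h4, nhdsWithin_le_nhds neary] with s h1 h2
        rw [← hext _ h2, h1]

/-- Colourings which agree outside of the disc agree at the ends of its strands. -/
theorem IsColouring.eq_end (h : L.Shows T e c r) (hQ : IsCrossingList T Q)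
    {f g : Circles n → N} (hf : L.IsColouring P f) (hg : L.IsColouring P g)
    (hfg : ∀ x, L.γ x ∉ e.symm '' square ∧ x ∉ doublePreimages L.γ → f x = g x) (i : Fin k)
    {t : ℝ} (ht : t = -1 ∨ t = 1) :
    f (segmentPoint (c i) (r i) t) = g (segmentPoint (c i) (r i) t) := by
  have hD := h.end_notMem_doublePreimages hQ i ht
  have h1 := (hf.eventually_eq _ hD).and ((hg.eventually_eq _ hD).and
    ((tendsto_advance _).eventually (L.finite_double.isClosed.isOpen_compl.mem_nhds hD)))
  simp only [advance_segmentPoint _ (h.r_ne i)] at h1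
  rw [eventually_nhds_segmentPoint_iff (h.r_ne i) (p := fun σ =>
    f (segmentPoint (c i) (r i) σ) = f (segmentPoint (c i) (r i) t) ∧
    g (segmentPoint (c i) (r i) σ) = g (segmentPoint (c i) (r i) t) ∧
    segmentPoint (c i) (r i) σ ∉ doublePreimages L.γ)] at h1
  have h2 := h1.and (h.eventually_mem_Icc (i := i) (t := t)
    (by rcases ht with rfl | rfl <;> norm_num))
  have hfreq : ∃ᶠ σ in 𝓝 t, σ ∉ Icc (-1 : ℝ) 1 := by
    rcases ht with rfl | rfl
    · have : ∀ᶠ σ : ℝ in 𝓝[<] (-1), σ ∉ Icc (-1 : ℝ) 1 := by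
        filter_upwards [self_mem_nhdsWithin] with σ hσ h
        exact absurd h.1 (not_le.2 hσ)
      exact this.frequently.filter_mono nhdsWithin_le_nhds
    · have : ∀ᶠ σ : ℝ in 𝓝[>] 1, σ ∉ Icc (-1 : ℝ) 1 := by
        filter_upwards [self_mem_nhdsWithin] with σ hσ h
        exact absurd h.2 (not_le.2 hσ)
      exact this.frequently.filter_mono nhdsWithin_le_nhds
  obtain ⟨σ, hσ, ⟨h3, h4, h5⟩, h6⟩ := (hfreq.and_eventually h2).exists
  rw [← h3, ← h4]
  exact hfg _ ⟨fun h => hσ (h6 h), h5⟩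

/-- A colouring of the picture with crossings `Q` is determined by the colours of the ends of the
strands. -/
def DeterminedByEnds (P : N → N → N → N → Prop) (Q : Fin k → ℝ → Fin k → ℝ → Prop)
    (ε : Fin k → Bool) (o : Fin k → ℝ → Bool) : Prop :=
  ∀ g g', IsLocalColouring P Q ε o g → IsLocalColouring P Q ε o g' →
    (∀ i, ∀ t : ℝ, t = -1 ∨ t = 1 → g i t = g' i t) →
    ∀ i, ∀ t ∈ Icc (-1 : ℝ) 1, (∀ j s, ¬ Q i t j s ∧ ¬ Q j s i t) → g i t = g' i t

/-- Every colouring of the picture with crossings `Q` has a partner for `Q'` with the same colours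
of the ends of the strands. -/
def ExtendsTo (P : N → N → N → N → Prop) (Q Q' : Fin k → ℝ → Fin k → ℝ → Prop)
    (ε : Fin k → Bool) (o o' : Fin k → ℝ → Bool) : Prop :=
  ∀ g, IsLocalColouring P Q ε o g → ∃ g', IsLocalColouring P Q' ε o' g' ∧
    ∀ i, ∀ t : ℝ, t = -1 ∨ t = 1 → g' i t = g i t

/-- The over strand at every crossing of different strands of the picture is the higher one. -/
def IsOverFlag (Q : Fin k → ℝ → Fin k → ℝ → Prop) (height : Equiv.Perm (Fin k))
    (o : Fin k → ℝ → Bool) : Prop :=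
  ∀ i s j t, Q i s j t → i ≠ j → (o i s = true ↔ height j < height i)

theorem IsColouring.eq_of_eq_outside (h : L.Shows T e c r) (hQ : IsCrossingList T Q)
    {ε : Fin k → Bool} (hε : ∀ i, ε i = true ↔ 0 < r i) {o : Fin k → ℝ → Bool}
    (ho : ∀ i s, o i s = true ↔ segmentPoint (c i) (r i) s ∈ L.overPass)
    (hdet : DeterminedByEnds P Q ε o) {f g : Circles n → N} (hf : L.IsColouring P f)
    (hg : L.IsColouring P g)
    (hfg : ∀ x, L.γ x ∉ e.symm '' square ∧ x ∉ doublePreimages L.γ → f x = g x)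
    {x : Circles n} (hx : x ∉ doublePreimages L.γ) : f x = g x := by
  by_cases hxS : L.γ x ∈ e.symm '' square
  · obtain ⟨i, t, ht, rfl⟩ := (h.mem_iff x).1 hxS
    refine hdet _ _ (hf.isLocalColouring h hQ hε ho) (hg.isLocalColouring h hQ hε ho)
      (fun i t ht => hf.eq_end h hQ hg hfg i ht) i t ht fun j s => ?_
    rw [h.mem_doublePreimages_iff hQ ht] at hx
    exact ⟨fun h => hx ⟨j, s, Or.inl h⟩, fun h => hx ⟨j, s, Or.inr h⟩⟩
  · exact hfg x ⟨hxS, hx⟩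

/-- A local move leaves the module of a diagram unchanged if the colourings of the two pictures
correspond to each other. -/
theorem _root_.LocalMove.nonempty_linkModule_equiv {R : Type v} [Ring R] {A B C D : R}
    (hmove : LocalMove T T' L L') (hQ : IsCrossingList T Q) (hQ' : IsCrossingList T' Q')
    (hloc : ∀ (M : Type v) [AddCommGroup M] [Module R M] (ε : Fin k → Bool)
      (height : Equiv.Perm (Fin k)) (o o' : Fin k → ℝ → Bool), IsOverFlag Q height o →
      IsOverFlag Q' height o' →
      ExtendsTo (switchRel A B C D (N := M)) Q Q' ε o o' ∧
      ExtendsTo (switchRel A B C D (N := M)) Q' Q ε o' o ∧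
      DeterminedByEnds (switchRel A B C D (N := M)) Q ε o ∧
      DeterminedByEnds (switchRel A B C D (N := M)) Q' ε o') :
    Nonempty (LinkModule A B C D L ≃ₗ[R] LinkModule A B C D L') := by
  classical
  obtain ⟨e, he, c, r, height, hsq, hr, hdisj, hL, hL', hγ, hout, hover⟩ := hmove
  have h : L.Shows T e c r := ⟨he, hsq, fun i => (hr i).1, fun i => (hr i).2, hdisj, hL,
    fun i t ht => (hγ i t ht).1⟩
  have h' : L'.Shows T' e c r := ⟨he, hsq, fun i => (hr i).1, fun i => (hr i).2, hdisj, hL',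
    fun i t ht => (hγ i t ht).2⟩
  have hout : AgreeOutside e L L' := hout
  have hout' := hout.symm h h'
  obtain ⟨ε, hε⟩ : ∃ ε : Fin k → Bool, ∀ i, ε i = true ↔ 0 < r i :=
    ⟨fun i => decide (0 < r i), fun i => by simp⟩
  obtain ⟨o, ho⟩ : ∃ o : Fin k → ℝ → Bool, ∀ i s, o i s = true ↔
      segmentPoint (c i) (r i) s ∈ L.overPass :=
    ⟨fun i s => decide (segmentPoint (c i) (r i) s ∈ L.overPass), fun i s => by simp⟩
  obtain ⟨o', ho'⟩ : ∃ o : Fin k → ℝ → Bool, ∀ i s, o i s = true ↔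
      segmentPoint (c i) (r i) s ∈ L'.overPass :=
    ⟨fun i s => decide (segmentPoint (c i) (r i) s ∈ L'.overPass), fun i s => by simp⟩
  have hflag : IsOverFlag Q height o := fun i s j t hst hij => (ho i s).trans <|
    (hover i j hij s (Ioo_subset_Icc_self (hQ.mem_left hst)) t
      (Ioo_subset_Icc_self (hQ.mem_right hst))).1 (hQ.eq hst)
  have hflag' : IsOverFlag Q' height o' := fun i s j t hst hij => (ho' i s).trans <|
    (hover i j hij s (Ioo_subset_Icc_self (hQ'.mem_left hst)) t
      (Ioo_subset_Icc_self (hQ'.mem_right hst))).2 (hQ'.eq hst)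
  have hsquare := h.mem_iff_mem h'
  refine LinkDiagram.nonempty_linkModule_equiv L L'
    (fun x x' => x = x' ∧ L.γ x ∉ e.symm '' square ∧ x ∉ doublePreimages L.γ)
    (fun f hf => ?_) (fun f hf => ?_) (fun f g hf hg hfg x hx => ?_)
    (fun f g hf hg hfg x hx => ?_) ?_
  · obtain ⟨g, hg, hends⟩ := (hloc _ ε height o o' hflag hflag').1 _
      (hf.isLocalColouring h hQ hε ho)
    obtain ⟨f', hf', hext⟩ := hf.exists_glue h h' hQ hQ' hout hε ho' hg hends
    refine ⟨f', hf', ?_⟩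
    rintro x x' ⟨rfl, hx, -⟩
    exact (hext x hx).symm
  · obtain ⟨g, hg, hends⟩ := (hloc _ ε height o o' hflag hflag').2.1 _
      (hf.isLocalColouring h' hQ' hε ho')
    obtain ⟨f', hf', hext⟩ := hf.exists_glue h' h hQ' hQ hout' hε ho hg hends
    refine ⟨f', hf', ?_⟩
    rintro x x' ⟨rfl, hx, -⟩
    exact hext x (by rwa [hsquare])
  · exact hf.eq_of_eq_outside h hQ hε ho (hloc _ ε height o o' hflag hflag').2.2.1 hg
      (fun x hx => hfg x x ⟨rfl, hx⟩) hx
  · refine hf.eq_of_eq_outside h' hQ' hε ho' (hloc _ ε height o o' hflag hflag').2.2.2 hg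
      (fun x hx => hfg x x ⟨rfl, ?_, fun hD => hx.2 ?_⟩) hx
    · rw [← hsquare]
      exact hx.1
    · exact hout.mem_doublePreimages (by rw [← hsquare]; exact hx.1) hD
  · rintro x x' ⟨rfl, hx, hD⟩
    exact ⟨hD, fun hD' => hD (hout'.mem_doublePreimages (by rwa [hsquare]) hD')⟩

end LinkDiagram

/-! ### Colourings of the pictures of the Reidemeister moves -/

/-- The function `g` on `[-1, 1]` has the value `w 0` before the time `τ 0`, the value `w 1` between
the times `τ 0` and `τ 1`, and the value `w 2` after the time `τ 1`. -/
structure IsStep {N : Type*} (τ : Fin 2 → ℝ) (w : Fin 3 → N) (g : ℝ → N) : Prop where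
  before : ∀ t ∈ Ico (-1 : ℝ) (τ 0), g t = w 0
  between : ∀ t ∈ Ioo (τ 0) (τ 1), g t = w 1
  after : ∀ t ∈ Ioc (τ 1) 1, g t = w 2

/-- The times of two crossings in the interior of a strand, in their order. -/
structure IsTimes (τ : Fin 2 → ℝ) : Prop where
  lt_zero : -1 < τ 0
  zero_lt_one : τ 0 < τ 1
  one_lt : τ 1 < 1

section Step

variable {N : Type*} {τ : Fin 2 → ℝ} {w : Fin 3 → N} {g : ℝ → N}

theorem IsTimes.mem_Ioo (hτ : IsTimes τ) (a : Fin 2) : τ a ∈ Ioo (-1 : ℝ) 1 := by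
  obtain ⟨h1, h2, h3⟩ := hτ
  fin_cases a
  · exact ⟨h1, h2.trans h3⟩
  · exact ⟨h1.trans h2, h3⟩

theorem IsTimes.injective (hτ : IsTimes τ) : Function.Injective τ := by
  intro a b hab
  have := hτ.zero_lt_one
  fin_cases a <;> fin_cases b <;> simp_all

theorem IsStep.left (hg : IsStep τ w g) (hτ : IsTimes τ) (a : Fin 2) :
    ∀ᶠ σ in 𝓝[<] (τ a), g σ = w a.castSucc := by
  fin_cases a
  · filter_upwards [Ioo_mem_nhdsLT hτ.lt_zero] with σ hσ
    exact hg.before σ ⟨hσ.1.le, hσ.2⟩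
  · filter_upwards [Ioo_mem_nhdsLT hτ.zero_lt_one] with σ hσ
    exact hg.between σ hσ

theorem IsStep.right (hg : IsStep τ w g) (hτ : IsTimes τ) (a : Fin 2) :
    ∀ᶠ σ in 𝓝[>] (τ a), g σ = w a.succ := by
  fin_cases a
  · filter_upwards [Ioo_mem_nhdsGT hτ.zero_lt_one] with σ hσ
    exact hg.between σ hσ
  · filter_upwards [Ioo_mem_nhdsGT hτ.one_lt] with σ hσ
    exact hg.after σ ⟨hσ.1, hσ.2.le⟩

theorem IsStep.apply_neg_one (hg : IsStep τ w g) (hτ : IsTimes τ) : g (-1) = w 0 :=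
  hg.before _ ⟨le_rfl, hτ.lt_zero⟩

theorem IsStep.apply_one (hg : IsStep τ w g) (hτ : IsTimes τ) : g 1 = w 2 :=
  hg.after _ ⟨hτ.one_lt, le_rfl⟩

theorem exists_isStep (hτ : IsTimes τ) (w : Fin 3 → N) : ∃ g : ℝ → N, IsStep τ w g ∧
    ∀ t, (∀ a, t ≠ τ a) → ∀ᶠ σ in 𝓝 t, g σ = g t := by
  refine ⟨fun t => if t < τ 0 then w 0 else if t < τ 1 then w 1 else w 2,
    ⟨fun t ht => ?_, fun t ht => ?_, fun t ht => ?_⟩, fun t ht => ?_⟩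
  · exact if_pos ht.2
  · exact (if_neg ht.1.not_gt).trans (if_pos ht.2)
  · exact (if_neg (hτ.zero_lt_one.trans ht.1).not_gt).trans (if_neg ht.1.not_gt)
  · have h0 : ∀ a, ∀ᶠ σ in 𝓝 t, (σ < τ a ↔ t < τ a) := by
      intro a
      rcases lt_or_gt_of_ne (ht a) with h | h
      · filter_upwards [Iio_mem_nhds h] with σ hσ
        exact iff_of_true hσ h
      · filter_upwards [Ioi_mem_nhds h] with σ hσ
        exact iff_of_false (not_lt.2 hσ.le) h.not_gt
    filter_upwards [h0 0, h0 1] with σ h0 h1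
    simp only [h0, h1]

end Step

/-- The list of crossings of a picture in which every strand has two crossings, at the times
`τ i 0` and `τ i 1`. For `(i, a, j, b) ∈ V` the crossing number `a` of the strand `i` is the
crossing number `b` of the strand `j`. -/
def crossingList {k : ℕ} (τ : Fin k → Fin 2 → ℝ) (V : List (Fin k × Fin 2 × Fin k × Fin 2)) :
    Fin k → ℝ → Fin k → ℝ → Prop :=
  fun i s j t => ∃ a b, (i, a, j, b) ∈ V ∧ s = τ i a ∧ t = τ j b

section TwoCrossings

variable {k : ℕ} {N : Type*} {P : N → N → N → N → Prop} {τ : Fin k → Fin 2 → ℝ}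
  {V : List (Fin k × Fin 2 × Fin k × Fin 2)} {ε : Fin k → Bool} {o : Fin k → ℝ → Bool}

/-- The relations between the colours of the parts of the strands. -/
def CrossingRelations (P : N → N → N → N → Prop) (τ : Fin k → Fin 2 → ℝ)
    (V : List (Fin k × Fin 2 × Fin k × Fin 2)) (ε : Fin k → Bool) (o : Fin k → ℝ → Bool)
    (w : Fin k → Fin 3 → N) : Prop :=
  ∀ v ∈ V, CrossingRel.cross P (ε v.1) (ε v.2.2.1) (o v.1 (τ v.1 v.2.1))
    (w v.1 v.2.1.castSucc) (w v.2.2.1 v.2.2.2.castSucc) (w v.1 v.2.1.succ) (w v.2.2.1 v.2.2.2.succ)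

theorem IsLocalColouring.exists_isStep (hτ : ∀ i, IsTimes (τ i)) {g : Fin k → ℝ → N}
    (hg : IsLocalColouring P (crossingList τ V) ε o g) :
    ∃ w, (∀ i, IsStep (τ i) (w i) (g i)) ∧ CrossingRelations P τ V ε o w := by
  have hno : ∀ i t, (∀ a, t ≠ τ i a) → ∀ j s,
      ¬ crossingList τ V i t j s ∧ ¬ crossingList τ V j s i t := by
    intro i t ht j s
    constructor
    · rintro ⟨a, -, -, h, -⟩
      exact ht a h
    · rintro ⟨-, a, -, -, h⟩
      exact ht a h
  have hconst : ∀ i (I : Set ℝ), IsPreconnected I → I ⊆ Icc (-1) 1 → (∀ t ∈ I, ∀ a, t ≠ τ i a) →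
      ∃ w, ∀ t ∈ I, g i t = w := by
    intro i I hI hsub h
    rcases I.eq_empty_or_nonempty with rfl | ⟨s, hs⟩
    · exact ⟨g i 0, by simp⟩
    · exact ⟨g i s, fun t ht => hg.eq_of_isPreconnected hI hsub (fun t ht => hno i t (h t ht)) ht hs⟩
  have hstep : ∀ i, ∃ w, IsStep (τ i) w (g i) := by
    intro i
    obtain ⟨h1, h2, h3⟩ := hτ i
    obtain ⟨w0, h0⟩ := hconst i (Ico (-1) (τ i 0)) isPreconnected_Ico
      (fun t ht => ⟨ht.1, by linarith [ht.2]⟩)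
      (fun t ht => Fin.forall_fin_two.2 ⟨ht.2.ne, (ht.2.trans h2).ne⟩)
    obtain ⟨w1, h1⟩ := hconst i (Ioo (τ i 0) (τ i 1)) isPreconnected_Ioo
      (fun t ht => ⟨by linarith [ht.1], by linarith [ht.2]⟩)
      (fun t ht => Fin.forall_fin_two.2 ⟨ht.1.ne', ht.2.ne⟩)
    obtain ⟨w2, h2⟩ := hconst i (Ioc (τ i 1) 1) isPreconnected_Ioc
      (fun t ht => ⟨by linarith [ht.1], ht.2⟩)
      (fun t ht => Fin.forall_fin_two.2 ⟨(h2.trans ht.1).ne', ht.1.ne'⟩)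
    exact ⟨![w0, w1, w2], h0, h1, h2⟩
  choose w hw using hstep
  refine ⟨w, hw, ?_⟩
  rintro ⟨i, a, j, b⟩ hv
  exact hg.crossing i (τ i a) j (τ j b) ⟨a, b, hv, rfl, rfl⟩ _ _ _ _ ((hw i).left (hτ i) a)
    ((hw j).left (hτ j) b) ((hw i).right (hτ i) a) ((hw j).right (hτ j) b)

/-- Colours of the parts of the strands which satisfy the relations form a colouring. -/
theorem exists_isLocalColouring (hτ : ∀ i, IsTimes (τ i))
    (hV : ∀ i a, ∃ j b, (i, a, j, b) ∈ V ∨ (j, b, i, a) ∈ V) {w : Fin k → Fin 3 → N}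
    (hw : CrossingRelations P τ V ε o w) :
    ∃ g, IsLocalColouring P (crossingList τ V) ε o g ∧ ∀ i, IsStep (τ i) (w i) (g i) := by
  choose g hg hloc using fun i => _root_.exists_isStep (hτ i) (w i)
  refine ⟨g, ⟨fun i t _ hno => ?_, ?_⟩, hg⟩
  · refine (hloc i t fun a hta => ?_).mono fun σ h _ => h
    obtain ⟨j, b, h | h⟩ := hV i a
    · exact (hno j (τ j b)).1 ⟨a, b, h, hta, rfl⟩
    · exact (hno j (τ j b)).2 ⟨b, a, h, rfl, hta⟩
  · rintro i _ j _ ⟨a, b, hv, rfl, rfl⟩ x y x' y' h1 h2 h3 h4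
    obtain ⟨_, e1, e1'⟩ := (h1.and ((hg i).left (hτ i) a)).exists
    obtain ⟨_, e2, e2'⟩ := (h2.and ((hg j).left (hτ j) b)).exists
    obtain ⟨_, e3, e3'⟩ := (h3.and ((hg i).right (hτ i) a)).exists
    obtain ⟨_, e4, e4'⟩ := (h4.and ((hg j).right (hτ j) b)).exists
    rw [← e1, e1', ← e2, e2', ← e3, e3', ← e4, e4']
    exact hw _ hv

/-- If the colours of the ends of the strands determine the colours of their middle parts, then they
determine the colouring. -/
theorem determinedByEnds_crossingList (hτ : ∀ i, IsTimes (τ i))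
    (hV : ∀ i a, ∃ j b, (i, a, j, b) ∈ V ∨ (j, b, i, a) ∈ V)
    (h : ∀ w w', CrossingRelations P τ V ε o w → CrossingRelations P τ V ε o w' →
      (∀ i, w i 0 = w' i 0 ∧ w i 2 = w' i 2) → ∀ i, w i 1 = w' i 1) :
    LinkDiagram.DeterminedByEnds P (crossingList τ V) ε o := by
  intro g g' hg hg' hends i t ht hno
  obtain ⟨w, hw, hr⟩ := hg.exists_isStep hτ
  obtain ⟨w', hw', hr'⟩ := hg'.exists_isStep hτ
  have h02 : ∀ i, w i 0 = w' i 0 ∧ w i 2 = w' i 2 := by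
    intro i
    rw [← (hw i).apply_neg_one (hτ i), ← (hw i).apply_one (hτ i),
      ← (hw' i).apply_neg_one (hτ i), ← (hw' i).apply_one (hτ i)]
    exact ⟨hends i _ (Or.inl rfl), hends i _ (Or.inr rfl)⟩
  have h1 := h w w' hr hr' h02
  have hne : ∀ a, t ≠ τ i a := by
    rintro a rfl
    obtain ⟨j, b, h | h⟩ := hV i a
    · exact (hno j (τ j b)).1 ⟨a, b, h, rfl, rfl⟩
    · exact (hno j (τ j b)).2 ⟨b, a, h, rfl, rfl⟩
  rcases lt_or_gt_of_ne (hne 0) with h | h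
  · rw [(hw i).before t ⟨ht.1, h⟩, (hw' i).before t ⟨ht.1, h⟩, (h02 i).1]
  · rcases lt_or_gt_of_ne (hne 1) with h' | h'
    · rw [(hw i).between t ⟨h, h'⟩, (hw' i).between t ⟨h, h'⟩, h1]
    · rw [(hw i).after t ⟨h', ht.2⟩, (hw' i).after t ⟨h', ht.2⟩, (h02 i).2]

/-- The list of crossings of a picture is correct if the strands are straight at the given times and
meet only there. -/
theorem isCrossingList_crossingList {T : Fin k → ℝ → ℂ} (hτ : ∀ i, IsTimes (τ i))
    (d : Fin k → Fin 2 → ℂ) (hsq : ∀ i, ∀ t ∈ Icc (-1 : ℝ) 1, T i t ∈ square)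
    (hd : ∀ i a, ∀ᶠ σ in 𝓝 (τ i a), T i σ = T i (τ i a) + (σ - τ i a : ℝ) * d i a)
    (hV : ∀ v ∈ V, (v.1 = v.2.2.1 → v.2.1 ≠ v.2.2.2) ∧
      T v.1 (τ v.1 v.2.1) = T v.2.2.1 (τ v.2.2.1 v.2.2.2) ∧
      0 < (d v.1 v.2.1).re * (d v.2.2.1 v.2.2.2).im - (d v.1 v.2.1).im * (d v.2.2.1 v.2.2.2).re)
    (heq : ∀ i, ∀ s ∈ Icc (-1 : ℝ) 1, ∀ j, ∀ t ∈ Icc (-1 : ℝ) 1, (i = j → s ≠ t) →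
      T i s = T j t → crossingList τ V i s j t ∨ crossingList τ V j t i s) :
    IsCrossingList T (crossingList τ V) := by
  refine ⟨hsq, heq, ?_, ?_, ?_, ?_, ?_⟩
  · rintro i _ j _ ⟨a, b, -, rfl, rfl⟩
    exact (hτ i).mem_Ioo a
  · rintro i _ j _ ⟨a, b, -, rfl, rfl⟩
    exact (hτ j).mem_Ioo b
  · rintro i _ j _ ⟨a, b, hv, rfl, rfl⟩ rfl h
    exact (hV _ hv).1 rfl ((hτ i).injective h)
  · rintro i _ j _ ⟨a, b, hv, rfl, rfl⟩
    exact (hV _ hv).2.1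
  · rintro i _ j _ ⟨a, b, hv, rfl, rfl⟩
    exact ⟨_, _, (hV _ hv).2.2, hd i a, hd j b⟩

end TwoCrossings

/-! ### Pictures without crossings -/

section NoCrossings

variable {k : ℕ} {N : Type*} {P : N → N → N → N → Prop} {ε : Fin k → Bool} {o : Fin k → ℝ → Bool}

/-- The empty list of crossings. -/
def noCrossing (k : ℕ) : Fin k → ℝ → Fin k → ℝ → Prop := fun _ _ _ _ => False

theorem IsLocalColouring.eq_of_noCrossing {g : Fin k → ℝ → N}
    (hg : IsLocalColouring P (noCrossing k) ε o g) (i : Fin k) {s t : ℝ}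
    (hs : s ∈ Icc (-1 : ℝ) 1) (ht : t ∈ Icc (-1 : ℝ) 1) : g i s = g i t :=
  hg.eq_of_isPreconnected isPreconnected_Icc subset_rfl (fun _ _ _ _ => ⟨id, id⟩) hs ht

theorem isLocalColouring_const (w : Fin k → N) :
    IsLocalColouring P (noCrossing k) ε o fun i _ => w i :=
  ⟨fun _ _ _ _ => .of_forall fun _ _ => rfl, fun _ _ _ _ h => h.elim⟩

theorem determinedByEnds_noCrossing : LinkDiagram.DeterminedByEnds P (noCrossing k) ε o := by
  intro g g' hg hg' hends i t ht _
  have h1 : (1 : ℝ) ∈ Icc (-1 : ℝ) 1 := by norm_num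
  rw [hg.eq_of_noCrossing i ht h1, hg'.eq_of_noCrossing i ht h1, hends i 1 (Or.inr rfl)]

theorem isCrossingList_noCrossing {T : Fin k → ℝ → ℂ}
    (hsq : ∀ i, ∀ t ∈ Icc (-1 : ℝ) 1, T i t ∈ square)
    (hne : ∀ i, ∀ s ∈ Icc (-1 : ℝ) 1, ∀ j, ∀ t ∈ Icc (-1 : ℝ) 1, T i s = T j t → i = j ∧ s = t) :
    IsCrossingList T (noCrossing k) :=
  ⟨hsq, fun i s hs j t ht h heq => absurd (hne i s hs j t ht heq).2 (h (hne i s hs j t ht heq).1),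
    fun h => h.elim, fun h => h.elim, fun h => h.elim, fun h => h.elim, fun h => h.elim⟩

/-- A picture with two crossings on every strand can be replaced by a picture without crossings, if
the colours of the two ends of a strand agree, and are otherwise arbitrary. -/
theorem noCrossing_crossingList {τ : Fin k → Fin 2 → ℝ}
    {V : List (Fin k × Fin 2 × Fin k × Fin 2)} {o' : Fin k → ℝ → Bool} (hτ : ∀ i, IsTimes (τ i))
    (hV : ∀ i a, ∃ j b, (i, a, j, b) ∈ V ∨ (j, b, i, a) ∈ V)
    (hex : ∀ w : Fin k → N, ∃ m : Fin k → N,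
      CrossingRelations P τ V ε o' fun i => ![w i, m i, w i])
    (heq : ∀ w, CrossingRelations P τ V ε o' w → ∀ i, w i 0 = w i 2)
    (huniq : ∀ w w', CrossingRelations P τ V ε o' w → CrossingRelations P τ V ε o' w' →
      (∀ i, w i 0 = w' i 0 ∧ w i 2 = w' i 2) → ∀ i, w i 1 = w' i 1) :
    LinkDiagram.ExtendsTo P (noCrossing k) (crossingList τ V) ε o o' ∧
    LinkDiagram.ExtendsTo P (crossingList τ V) (noCrossing k) ε o' o ∧
    LinkDiagram.DeterminedByEnds P (noCrossing k) ε o ∧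
    LinkDiagram.DeterminedByEnds P (crossingList τ V) ε o' := by
  have h1 : (1 : ℝ) ∈ Icc (-1 : ℝ) 1 := by norm_num
  have h2 : (-1 : ℝ) ∈ Icc (-1 : ℝ) 1 := by norm_num
  refine ⟨fun g hg => ?_, fun g hg => ?_, determinedByEnds_noCrossing,
    determinedByEnds_crossingList hτ hV huniq⟩
  · obtain ⟨m, hm⟩ := hex fun i => g i 1
    obtain ⟨g', hg', hstep⟩ := exists_isLocalColouring hτ hV hm
    refine ⟨g', hg', ?_⟩
    rintro i t (rfl | rfl)
    · rw [(hstep i).apply_neg_one (hτ i), hg.eq_of_noCrossing i h2 h1]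
      rfl
    · rw [(hstep i).apply_one (hτ i)]
      rfl
  · obtain ⟨w, hw, hr⟩ := hg.exists_isStep hτ
    refine ⟨_, isLocalColouring_const fun i => g i 1, ?_⟩
    rintro i t (rfl | rfl)
    · rw [(hw i).apply_neg_one (hτ i), (hw i).apply_one (hτ i), heq w hr i]
    · rfl

end NoCrossings

/-! ### The Reidemeister moves -/

theorem isTimes_half : IsTimes ![-1 / 2, 1 / 2] := by
  constructor <;> norm_num

theorem Complex.eq_add_mul_of_re_im {z z₀ d : ℂ} {s : ℝ} (hre : z.re = z₀.re + s * d.re)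
    (him : z.im = z₀.im + s * d.im) : z = z₀ + s * d := by
  apply Complex.ext
  · rw [Complex.add_re, Complex.re_ofReal_mul, hre]
  · rw [Complex.add_im, Complex.im_ofReal_mul, him]

section One

theorem isCrossingList_reidemeisterOne : IsCrossingList reidemeisterOne (noCrossing 1) := by
  refine isCrossingList_noCrossing (fun i t ht => ?_) (fun i s hs j t ht h => ?_)
  · have := abs_le.2 ht
    refine ⟨?_, ?_⟩ <;> simp only [reidemeisterOne, abs_abs]
    · rw [abs_div, abs_two]
      linarith
    · exact this
  · have := congrArg Complex.re h
    simp only [reidemeisterOne] at this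
    exact ⟨Subsingleton.elim _ _, by linarith⟩

/-- The self-crossing of the kink. -/
def kinkVertices : List (Fin 1 × Fin 2 × Fin 1 × Fin 2) := [(0, 0, 0, 1)]

theorem isCrossingList_reidemeisterOne' :
    IsCrossingList reidemeisterOne' (crossingList (fun _ => ![-1 / 2, 1 / 2]) kinkVertices) := by
  refine isCrossingList_crossingList (fun _ => isTimes_half)
    (fun _ => ![⟨1, -1⟩, ⟨1, 1⟩]) (fun i t ht => ?_) (fun i a => ?_) ?_ (fun i s hs j t ht hne h => ?_)
  · refine ⟨?_, ?_⟩ <;> simp only [reidemeisterOne', abs_abs]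
    · rw [abs_le]
      rcases abs_cases (t + 1 / 4) with h1 | h1 <;> rcases abs_cases (t - 1 / 4) with h2 | h2 <;>
        constructor <;> linarith [ht.1, ht.2]
    · exact abs_le.2 ht
  · fin_cases a
    · filter_upwards [Iio_mem_nhds (show ![-1 / 2, 1 / 2] 0 < (-1 / 4 : ℝ) by norm_num)] with σ hσ
      have hσ : σ < -1 / 4 := hσ
      apply Complex.eq_add_mul_of_re_im <;> simp only [reidemeisterOne', Fin.zero_eta,
        Matrix.cons_val_zero]
      · rw [abs_of_neg (show σ + 1 / 4 < 0 by linarith), abs_of_neg (show σ - 1 / 4 < 0 by linarith)]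
        norm_num [abs_of_neg]
        ring
      · rw [abs_of_neg (show σ < 0 by linarith)]
        norm_num [abs_of_neg]
    · filter_upwards [Ioi_mem_nhds (show (1 / 4 : ℝ) < ![-1 / 2, 1 / 2] 1 by norm_num)] with σ hσ
      have hσ : 1 / 4 < σ := hσ
      apply Complex.eq_add_mul_of_re_im <;> simp only [reidemeisterOne', Fin.mk_one,
        Matrix.cons_val_one, Matrix.cons_val_zero]
      · rw [abs_of_pos (show 0 < σ + 1 / 4 by linarith), abs_of_pos (show 0 < σ - 1 / 4 by linarith)]
        norm_num [abs_of_pos]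
        ring
      · rw [abs_of_pos (show 0 < σ by linarith)]
        norm_num [abs_of_pos]
  · simp only [kinkVertices, List.mem_singleton, forall_eq]
    norm_num [reidemeisterOne', abs_of_neg, abs_of_pos]
  · obtain rfl := Subsingleton.elim i 0
    obtain rfl := Subsingleton.elim j 0
    have hne := hne rfl
    have hre := congrArg Complex.re h
    have him := congrArg Complex.im h
    simp only [reidemeisterOne'] at hre him
    have hst : s = -t := (abs_eq_abs.1 him).resolve_left hne
    have ht : t = 1 / 2 ∨ t = -1 / 2 := by
      rw [hst] at hre hne
      have ht0 : t ≠ 0 := by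
        rintro rfl
        simp at hne
      rcases abs_cases (-t + 1 / 4) with h1 | h1 <;> rcases abs_cases (-t - 1 / 4) with h2 | h2 <;>
        rcases abs_cases (t + 1 / 4) with h3 | h3 <;>
        rcases abs_cases (t - 1 / 4) with h4 | h4 <;>
        first
          | exact Or.inl (by linarith)
          | exact Or.inr (by linarith)
          | exact absurd (show t = 0 by linarith) ht0
    rcases ht with rfl | rfl
    · exact Or.inl ⟨0, 1, by simp [kinkVertices], by rw [hst]; norm_num, by norm_num⟩
    · exact Or.inr ⟨0, 1, by simp [kinkVertices], by norm_num, by rw [hst]; norm_num⟩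

/-- The colours of the ends of a kink agree, and they determine the colour of the loop. -/
theorem reidemeisterOne_local {N : Type*} {P : N → N → N → N → Prop}
    (hP : CrossingRel.IsBiquandle P) (ε : Fin 1 → Bool) (o o' : Fin 1 → ℝ → Bool) :
    LinkDiagram.ExtendsTo P (noCrossing 1)
      (crossingList (fun _ => ![-1 / 2, 1 / 2]) kinkVertices) ε o o' ∧
    LinkDiagram.ExtendsTo P (crossingList (fun _ => ![-1 / 2, 1 / 2]) kinkVertices)
      (noCrossing 1) ε o' o ∧
    LinkDiagram.DeterminedByEnds P (noCrossing 1) ε o ∧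
    LinkDiagram.DeterminedByEnds P
      (crossingList (fun _ => ![-1 / 2, 1 / 2]) kinkVertices) ε o' := by
  have hrel : ∀ w : Fin 1 → Fin 3 → N,
      CrossingRelations P (fun _ => ![-1 / 2, 1 / 2]) kinkVertices ε o' w →
      CrossingRel.cross P (ε 0) (ε 0) (o' 0 (-1 / 2)) (w 0 0) (w 0 1) (w 0 1) (w 0 2) :=
    fun w hw => hw (0, 0, 0, 1) (by simp [kinkVertices])
  have heq : ∀ w, CrossingRelations P (fun _ => ![-1 / 2, 1 / 2]) kinkVertices ε o' w →
      ∀ i, w i 0 = w i 2 := by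
    intro w hw i
    obtain rfl := Subsingleton.elim i 0
    exact hP.cross_kink (hrel w hw)
  refine noCrossing_crossingList (fun _ => isTimes_half) (by decide) (fun w => ?_) heq
    (fun w w' hw hw' h i => ?_)
  · obtain ⟨l, hl⟩ := hP.exists_cross_kink (ε 0) (o' 0 (-1 / 2)) (w 0)
    refine ⟨fun _ => l, fun v hv => ?_⟩
    obtain rfl := List.mem_singleton.1 hv
    exact hl
  · obtain rfl := Subsingleton.elim i 0
    have h1 := hrel w hw
    have h2 := hrel w' hw'
    rw [← heq w hw] at h1
    rw [← (h 0).1, ← (h 0).2, ← heq w hw] at h2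
    exact hP.cross_kink_unique h1 h2

end One

section Two

theorem isCrossingList_reidemeisterTwo : IsCrossingList reidemeisterTwo (noCrossing 2) := by
  refine isCrossingList_noCrossing (fun i t ht => ?_) (fun i s hs j t ht h => ?_)
  · have h1 := abs_le.2 ht
    have h2 := abs_nonneg t
    fin_cases i
    · exact ⟨h1, abs_le.2 ⟨show -1 ≤ (1 + |t|) / 2 by linarith, show (1 + |t|) / 2 ≤ 1 by linarith⟩⟩
    · exact ⟨h1, show |(0 : ℝ)| ≤ 1 by norm_num⟩
  · have hre := congrArg Complex.re h
    have him := congrArg Complex.im h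
    have h1 := abs_nonneg s
    have h2 := abs_nonneg t
    fin_cases i <;> fin_cases j <;> simp [reidemeisterTwo] at hre him ⊢
    · exact hre
    · linarith
    · linarith
    · exact hre

/-- The two crossings of the bigon. -/
def bigonVertices : List (Fin 2 × Fin 2 × Fin 2 × Fin 2) := [(0, 0, 1, 0), (1, 1, 0, 1)]

theorem isCrossingList_reidemeisterTwo' :
    IsCrossingList reidemeisterTwo' (crossingList (fun _ => ![-1 / 2, 1 / 2]) bigonVertices) := by
  refine isCrossingList_crossingList (fun _ => isTimes_half)
    ![![⟨1, -2⟩, ⟨1, 2⟩], ![⟨1, 0⟩, ⟨1, 0⟩]] (fun i t ht => ?_) (fun i a => ?_) ?_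
    (fun i s hs j t ht hne h => ?_)
  · have h1 := abs_le.2 ht
    have h2 := abs_nonneg t
    fin_cases i
    · exact ⟨h1, abs_le.2 ⟨show -1 ≤ 2 * |t| - 1 by linarith, show 2 * |t| - 1 ≤ 1 by linarith⟩⟩
    · exact ⟨h1, show |(0 : ℝ)| ≤ 1 by norm_num⟩
  · fin_cases i <;> fin_cases a
    · filter_upwards [Iio_mem_nhds (show ![-1 / 2, 1 / 2] 0 < (0 : ℝ) by norm_num)] with σ hσ
      have hσ : σ < 0 := hσ
      apply Complex.eq_add_mul_of_re_im <;> norm_num [reidemeisterTwo', abs_of_neg hσ, abs_of_neg]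
      ring
    · filter_upwards [Ioi_mem_nhds (show (0 : ℝ) < ![-1 / 2, 1 / 2] 1 by norm_num)] with σ hσ
      have hσ : 0 < σ := hσ
      apply Complex.eq_add_mul_of_re_im <;> norm_num [reidemeisterTwo', abs_of_pos hσ, abs_of_pos]
      ring
    · refine .of_forall fun σ => ?_
      apply Complex.eq_add_mul_of_re_im <;> norm_num [reidemeisterTwo']
    · refine .of_forall fun σ => ?_
      apply Complex.eq_add_mul_of_re_im <;> norm_num [reidemeisterTwo']
  · simp only [bigonVertices, List.mem_cons, List.not_mem_nil, or_false, forall_eq_or_imp, forall_eq]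
    norm_num [reidemeisterTwo', abs_of_neg, abs_of_pos]
  · have hre := congrArg Complex.re h
    have him := congrArg Complex.im h
    have hcase : ∀ {s : ℝ}, 2 * |s| - 1 = 0 → s = -1 / 2 ∨ s = 1 / 2 := by
      intro s h
      rcases abs_cases s with h1 | h1
      · exact Or.inr (by linarith)
      · exact Or.inl (by linarith)
    fin_cases i <;> fin_cases j <;> simp [reidemeisterTwo'] at hre him hne
    · exact absurd hre hne
    · subst hre
      rcases hcase him with rfl | rfl
      · exact Or.inl ⟨0, 0, by decide, by norm_num, by norm_num⟩
      · exact Or.inr ⟨1, 1, by decide, by norm_num, by norm_num⟩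
    · subst hre
      rcases hcase him.symm with rfl | rfl
      · exact Or.inr ⟨0, 0, by decide, by norm_num, by norm_num⟩
      · exact Or.inl ⟨1, 1, by decide, by norm_num, by norm_num⟩
    · exact absurd hre hne

/-- The two crossings of the bigon have mutually inverse relations, because the same strand is above at
both of them. -/
theorem reidemeisterTwo_local {N : Type*} {P : N → N → N → N → Prop}
    (hP : CrossingRel.IsBiquandle P) (ε : Fin 2 → Bool) (height : Equiv.Perm (Fin 2))
    (o o' : Fin 2 → ℝ → Bool)
    (ho' : LinkDiagram.IsOverFlag
      (crossingList (fun _ => ![-1 / 2, 1 / 2]) bigonVertices) height o') :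
    LinkDiagram.ExtendsTo P (noCrossing 2)
      (crossingList (fun _ => ![-1 / 2, 1 / 2]) bigonVertices) ε o o' ∧
    LinkDiagram.ExtendsTo P (crossingList (fun _ => ![-1 / 2, 1 / 2]) bigonVertices)
      (noCrossing 2) ε o' o ∧
    LinkDiagram.DeterminedByEnds P (noCrossing 2) ε o ∧
    LinkDiagram.DeterminedByEnds P
      (crossingList (fun _ => ![-1 / 2, 1 / 2]) bigonVertices) ε o' := by
  have hflag : o' 1 (1 / 2) = !o' 0 (-1 / 2) := by
    have h1 := ho' 0 (-1 / 2) 1 (-1 / 2) ⟨0, 0, by decide, by norm_num, by norm_num⟩ (by decide)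
    have h2 := ho' 1 (1 / 2) 0 (1 / 2) ⟨1, 1, by decide, by norm_num, by norm_num⟩ (by decide)
    have hne : height 0 ≠ height 1 := height.injective.ne (by decide)
    rw [Bool.eq_iff_iff, Bool.not_eq_true', Bool.eq_false_iff, ne_eq, h1, h2]
    omega
  have hrel : ∀ w : Fin 2 → Fin 3 → N,
      CrossingRelations P (fun _ => ![-1 / 2, 1 / 2]) bigonVertices ε o' w ↔
      CrossingRel.cross P (ε 0) (ε 1) (o' 0 (-1 / 2)) (w 0 0) (w 1 0) (w 0 1) (w 1 1) ∧
      CrossingRel.cross P (ε 0) (ε 1) (o' 0 (-1 / 2)) (w 0 2) (w 1 2) (w 0 1) (w 1 1) := by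
    intro w
    have hswap := congrFun (congrFun (congrFun (congrFun
      (CrossingRel.cross_swap (P := P) (ε 0) (ε 1) (o' 0 (-1 / 2))) (w 1 1)) (w 0 1)) (w 1 2)) (w 0 2)
    rw [← hflag] at hswap
    rw [← hswap]
    simp only [CrossingRelations, bigonVertices, List.mem_cons, List.not_mem_nil, or_false,
      forall_eq_or_imp, forall_eq]
    rfl
  have hb := hP.cross_bijective (ε 0) (ε 1) (o' 0 (-1 / 2))
  refine noCrossing_crossingList (fun _ => isTimes_half) (by decide) (fun w => ?_) (fun w hw => ?_)
    (fun w w' hw hw' h => ?_)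
  · obtain ⟨m₀, m₁, hm⟩ := hb.exists_right (w 0) (w 1)
    exact ⟨![m₀, m₁], (hrel _).2 ⟨hm, hm⟩⟩
  · obtain ⟨h1, h2⟩ := (hrel w).1 hw
    exact Fin.forall_fin_two.2 (hb.unique_left h1 h2)
  · have h1 := ((hrel w).1 hw).1
    have h2 := ((hrel w').1 hw').1
    rw [(h 0).1, (h 1).1] at h1
    exact Fin.forall_fin_two.2 (hb.unique_right h1 h2)

end Two

section Three

/-- The times of the crossings on the three strands, if the strand `0` is above the centre. -/
noncomputable def upperTimes : Fin 3 → Fin 2 → ℝ := ![![-1 / 3, 1 / 3], ![0, 1 / 3], ![-1 / 3, 0]]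

/-- The times of the crossings on the three strands, if the strand `0` is below the centre. -/
noncomputable def lowerTimes : Fin 3 → Fin 2 → ℝ := ![![-1 / 3, 1 / 3], ![-1 / 3, 0], ![0, 1 / 3]]

theorem isTimes_upperTimes (i : Fin 3) : IsTimes (upperTimes i) := by
  fin_cases i <;> constructor <;> norm_num [upperTimes]

theorem isTimes_lowerTimes (i : Fin 3) : IsTimes (lowerTimes i) := by
  fin_cases i <;> constructor <;> norm_num [lowerTimes]

/-- The three crossings, if the strand `0` is above the centre. -/
def upperVertices : List (Fin 3 × Fin 2 × Fin 3 × Fin 2) :=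
  [(2, 0, 0, 0), (2, 1, 1, 0), (0, 1, 1, 1)]

/-- The three crossings, if the strand `0` is below the centre. -/
def lowerVertices : List (Fin 3 × Fin 2 × Fin 3 × Fin 2) :=
  [(0, 0, 1, 0), (2, 0, 1, 1), (2, 1, 0, 1)]

theorem eq_of_half_eq_self {s : ℝ} (h : (1 - |s|) / 2 = s) : s = 1 / 3 := by
  rcases abs_cases s with h1 | h1 <;> linarith

theorem eq_of_half_eq_neg {s : ℝ} (h : (1 - |s|) / 2 = -s) : s = -1 / 3 := by
  rcases abs_cases s with h1 | h1 <;> linarith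

theorem vecCons_two {α : Type*} (a : α) (f : Fin 2 → α) : Matrix.vecCons a f 2 = f 1 := rfl

theorem isCrossingList_reidemeisterThree :
    IsCrossingList reidemeisterThree (crossingList upperTimes upperVertices) := by
  refine isCrossingList_crossingList isTimes_upperTimes
    ![![⟨1, 1 / 2⟩, ⟨1, -1 / 2⟩], ![⟨1, 1⟩, ⟨1, 1⟩], ![⟨1, -1⟩, ⟨1, -1⟩]] (fun i t ht => ?_)
    (fun i a => ?_) ?_ (fun i s hs j t ht hne h => ?_)
  · have h1 := abs_le.2 ht
    have h2 := abs_nonneg t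
    fin_cases i
    · exact ⟨h1, abs_le.2 ⟨show -1 ≤ (1 - |t|) / 2 by linarith, show (1 - |t|) / 2 ≤ 1 by linarith⟩⟩
    · exact ⟨h1, h1⟩
    · exact ⟨h1, show |-t| ≤ 1 by rwa [abs_neg]⟩
  · fin_cases i
    · fin_cases a
      · filter_upwards [Iio_mem_nhds (show upperTimes 0 0 < 0 by norm_num [upperTimes])] with σ hσ
        have hσ : σ < 0 := hσ
        apply Complex.eq_add_mul_of_re_im <;>
          norm_num [reidemeisterThree, upperTimes, abs_of_neg hσ, abs_of_neg]
        ring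
      · filter_upwards [Ioi_mem_nhds (show 0 < upperTimes 0 1 by norm_num [upperTimes])] with σ hσ
        have hσ : 0 < σ := hσ
        apply Complex.eq_add_mul_of_re_im <;>
          norm_num [reidemeisterThree, upperTimes, abs_of_pos hσ, abs_of_pos]
        ring
    · refine .of_forall fun σ => ?_
      fin_cases a <;> apply Complex.eq_add_mul_of_re_im <;>
        norm_num [reidemeisterThree, upperTimes]
    · refine .of_forall fun σ => ?_
      fin_cases a <;> apply Complex.eq_add_mul_of_re_im <;>
        norm_num [reidemeisterThree, upperTimes]
  · simp only [upperVertices, List.mem_cons, List.not_mem_nil, or_false, forall_eq_or_imp, forall_eq]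
    norm_num [reidemeisterThree, upperTimes, vecCons_two, abs_of_neg, abs_of_pos]
    decide
  · have hre := congrArg Complex.re h
    have him := congrArg Complex.im h
    fin_cases i <;> fin_cases j <;> simp [reidemeisterThree] at hre him hne <;> try subst hre
    · exact absurd rfl hne
    · have := eq_of_half_eq_self him
      exact Or.inl ⟨1, 1, by decide, by simpa [upperTimes] using this,
        by simpa [upperTimes] using this⟩
    · have := eq_of_half_eq_neg him
      exact Or.inr ⟨0, 0, by decide, by simpa [upperTimes] using this,
        by simpa [upperTimes] using this⟩
    · have := eq_of_half_eq_self him.symm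
      exact Or.inr ⟨1, 1, by decide, by simpa [upperTimes] using this,
        by simpa [upperTimes] using this⟩
    · exact absurd rfl hne
    · have : s = 0 := by linarith
      exact Or.inr ⟨1, 0, by decide, by simpa [upperTimes] using this,
        by simpa [upperTimes] using this⟩
    · have := eq_of_half_eq_neg him.symm
      exact Or.inl ⟨0, 0, by decide, by simpa [upperTimes] using this,
        by simpa [upperTimes] using this⟩
    · have : s = 0 := by linarith
      exact Or.inl ⟨1, 0, by decide, by simpa [upperTimes] using this,
        by simpa [upperTimes] using this⟩
    · exact absurd rfl hne

theorem isCrossingList_reidemeisterThree' :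
    IsCrossingList reidemeisterThree' (crossingList lowerTimes lowerVertices) := by
  refine isCrossingList_crossingList isTimes_lowerTimes
    ![![⟨1, -1 / 2⟩, ⟨1, 1 / 2⟩], ![⟨1, 1⟩, ⟨1, 1⟩], ![⟨1, -1⟩, ⟨1, -1⟩]] (fun i t ht => ?_)
    (fun i a => ?_) ?_ (fun i s hs j t ht hne h => ?_)
  · have h1 := abs_le.2 ht
    have h2 := abs_nonneg t
    fin_cases i
    · exact ⟨h1, abs_le.2 ⟨show -1 ≤ -((1 - |t|) / 2) by linarith,
        show -((1 - |t|) / 2) ≤ 1 by linarith⟩⟩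
    · exact ⟨h1, h1⟩
    · exact ⟨h1, show |-t| ≤ 1 by rwa [abs_neg]⟩
  · fin_cases i
    · fin_cases a
      · filter_upwards [Iio_mem_nhds (show lowerTimes 0 0 < 0 by norm_num [lowerTimes])] with σ hσ
        have hσ : σ < 0 := hσ
        apply Complex.eq_add_mul_of_re_im <;>
          norm_num [reidemeisterThree', lowerTimes, abs_of_neg hσ, abs_of_neg]
        ring
      · filter_upwards [Ioi_mem_nhds (show 0 < lowerTimes 0 1 by norm_num [lowerTimes])] with σ hσ
        have hσ : 0 < σ := hσ
        apply Complex.eq_add_mul_of_re_im <;>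
          norm_num [reidemeisterThree', lowerTimes, abs_of_pos hσ, abs_of_pos]
        ring
    · refine .of_forall fun σ => ?_
      fin_cases a <;> apply Complex.eq_add_mul_of_re_im <;>
        norm_num [reidemeisterThree', lowerTimes]
    · refine .of_forall fun σ => ?_
      fin_cases a <;> apply Complex.eq_add_mul_of_re_im <;>
        norm_num [reidemeisterThree', lowerTimes]
      ring
  · simp only [lowerVertices, List.mem_cons, List.not_mem_nil, or_false, forall_eq_or_imp, forall_eq]
    norm_num [reidemeisterThree', lowerTimes, vecCons_two, abs_of_neg, abs_of_pos]
    decide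
  · have hre := congrArg Complex.re h
    have him := congrArg Complex.im h
    fin_cases i <;> fin_cases j <;> simp [reidemeisterThree'] at hre him hne <;> try subst hre
    · exact absurd rfl hne
    · have := eq_of_half_eq_neg (show (1 - |s|) / 2 = -s by linarith)
      exact Or.inl ⟨0, 0, by decide, by simpa [lowerTimes] using this,
        by simpa [lowerTimes] using this⟩
    · have := eq_of_half_eq_self (show (1 - |s|) / 2 = s by linarith)
      exact Or.inr ⟨1, 1, by decide, by simpa [lowerTimes] using this,
        by simpa [lowerTimes] using this⟩
    · have := eq_of_half_eq_neg (show (1 - |s|) / 2 = -s by linarith)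
      exact Or.inr ⟨0, 0, by decide, by simpa [lowerTimes] using this,
        by simpa [lowerTimes] using this⟩
    · exact absurd rfl hne
    · have : s = 0 := by linarith
      exact Or.inr ⟨0, 1, by decide, by simpa [lowerTimes] using this,
        by simpa [lowerTimes] using this⟩
    · have := eq_of_half_eq_self (show (1 - |s|) / 2 = s by linarith)
      exact Or.inl ⟨1, 1, by decide, by simpa [lowerTimes] using this,
        by simpa [lowerTimes] using this⟩
    · have : s = 0 := by linarith
      exact Or.inl ⟨0, 1, by decide, by simpa [lowerTimes] using this,
        by simpa [lowerTimes] using this⟩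
    · exact absurd rfl hne

/-- The colourings of the two pictures correspond to each other by the Yang–Baxter equation. The heights
of the strands exclude the cyclic choices of the over strands. -/
theorem reidemeisterThree_local {N : Type*} {P : N → N → N → N → Prop}
    (hP : CrossingRel.IsBiquandle P) (ε : Fin 3 → Bool) (height : Equiv.Perm (Fin 3))
    (o o' : Fin 3 → ℝ → Bool)
    (ho : LinkDiagram.IsOverFlag (crossingList upperTimes upperVertices) height o)
    (ho' : LinkDiagram.IsOverFlag (crossingList lowerTimes lowerVertices) height o') :
    LinkDiagram.ExtendsTo P (crossingList upperTimes upperVertices)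
      (crossingList lowerTimes lowerVertices) ε o o' ∧
    LinkDiagram.ExtendsTo P (crossingList lowerTimes lowerVertices)
      (crossingList upperTimes upperVertices) ε o' o ∧
    LinkDiagram.DeterminedByEnds P (crossingList upperTimes upperVertices) ε o ∧
    LinkDiagram.DeterminedByEnds P (crossingList lowerTimes lowerVertices) ε o' := by
  have hV : ∀ i a, ∃ j b, (i, a, j, b) ∈ upperVertices ∨ (j, b, i, a) ∈ upperVertices := by decide
  have hV' : ∀ i a, ∃ j b, (i, a, j, b) ∈ lowerVertices ∨ (j, b, i, a) ∈ lowerVertices := by decide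
  have hflag : ∀ i a j b, (i, a, j, b) ∈ upperVertices → i ≠ j →
      o i (upperTimes i a) = decide (height j < height i) := fun i a j b h hij => by
    rw [Bool.eq_iff_iff, ho i _ j _ ⟨a, b, h, rfl, rfl⟩ hij, decide_eq_true_iff]
  have hflag' : ∀ i a j b, (i, a, j, b) ∈ lowerVertices → i ≠ j →
      o' i (lowerTimes i a) = decide (height j < height i) := fun i a j b h hij => by
    rw [Bool.eq_iff_iff, ho' i _ j _ ⟨a, b, h, rfl, rfl⟩ hij, decide_eq_true_iff]
  obtain ⟨F, hF⟩ : ∃ F, F = CrossingRel.cross P (ε 2) (ε 0) (decide (height 0 < height 2)) :=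
    ⟨_, rfl⟩
  obtain ⟨G, hG⟩ : ∃ G, G = CrossingRel.cross P (ε 2) (ε 1) (decide (height 1 < height 2)) :=
    ⟨_, rfl⟩
  obtain ⟨H, hH⟩ : ∃ H, H = CrossingRel.cross P (ε 0) (ε 1) (decide (height 1 < height 0)) :=
    ⟨_, rfl⟩
  have hFb : CrossingRel.IsBijective F := hF ▸ hP.cross_bijective _ _ _
  have hGb : CrossingRel.IsBijective G := hG ▸ hP.cross_bijective _ _ _
  have hHb : CrossingRel.IsBijective H := hH ▸ hP.cross_bijective _ _ _
  have hYB : CrossingRel.YangBaxter F G H := by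
    rw [hF, hG, hH]
    refine hP.yangBaxter_cross _ _ _ _ _ _ fun h => ?_
    have h20 : height 2 ≠ height 0 := height.injective.ne (by decide)
    have h21 : height 2 ≠ height 1 := height.injective.ne (by decide)
    have h01 : height 0 ≠ height 1 := height.injective.ne (by decide)
    rw [decide_eq_decide] at h ⊢
    omega
  have hrel : ∀ w : Fin 3 → Fin 3 → N, CrossingRelations P upperTimes upperVertices ε o w ↔
      F (w 2 0) (w 0 0) (w 2 1) (w 0 1) ∧ G (w 2 1) (w 1 0) (w 2 2) (w 1 1) ∧
      H (w 0 1) (w 1 1) (w 0 2) (w 1 2) := by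
    intro w
    rw [hF, hG, hH, ← hflag 2 0 0 0 (by decide) (by decide), ← hflag 2 1 1 0 (by decide) (by decide),
      ← hflag 0 1 1 1 (by decide) (by decide)]
    simp only [CrossingRelations, upperVertices, List.mem_cons, List.not_mem_nil, or_false,
      forall_eq_or_imp, forall_eq]
    rfl
  have hrel' : ∀ w : Fin 3 → Fin 3 → N, CrossingRelations P lowerTimes lowerVertices ε o' w ↔
      H (w 0 0) (w 1 0) (w 0 1) (w 1 1) ∧ G (w 2 0) (w 1 1) (w 2 1) (w 1 2) ∧
      F (w 2 1) (w 0 1) (w 2 2) (w 0 2) := by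
    intro w
    rw [hF, hG, hH, ← hflag' 0 0 1 0 (by decide) (by decide),
      ← hflag' 2 0 1 1 (by decide) (by decide), ← hflag' 2 1 0 1 (by decide) (by decide)]
    simp only [CrossingRelations, lowerVertices, List.mem_cons, List.not_mem_nil, or_false,
      forall_eq_or_imp, forall_eq]
    rfl
  refine ⟨fun g hg => ?_, fun g hg => ?_, determinedByEnds_crossingList isTimes_upperTimes hV
    fun w w' hw hw' h => ?_, determinedByEnds_crossingList isTimes_lowerTimes hV'
    fun w w' hw hw' h => ?_⟩
  · obtain ⟨w, hw, hr⟩ := hg.exists_isStep isTimes_upperTimes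
    obtain ⟨z₂, z₀, z₁, hz⟩ := (hYB _ _ _ _ _ _).1 ⟨_, _, _, (hrel w).1 hr⟩
    obtain ⟨g', hg', hstep⟩ := exists_isLocalColouring (P := P) (ε := ε) (o := o')
      isTimes_lowerTimes hV'
      (w := ![![w 0 0, z₀, w 0 2], ![w 1 0, z₁, w 1 2], ![w 2 0, z₂, w 2 2]]) ((hrel' _).2 hz)
    refine ⟨g', hg', fun i t ht => ?_⟩
    rcases ht with rfl | rfl
    · rw [(hstep i).apply_neg_one (isTimes_lowerTimes i), (hw i).apply_neg_one (isTimes_upperTimes i)]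
      fin_cases i <;> rfl
    · rw [(hstep i).apply_one (isTimes_lowerTimes i), (hw i).apply_one (isTimes_upperTimes i)]
      fin_cases i <;> rfl
  · obtain ⟨w, hw, hr⟩ := hg.exists_isStep isTimes_lowerTimes
    obtain ⟨z₂, z₀, z₁, hz⟩ := (hYB _ _ _ _ _ _).2 ⟨_, _, _, (hrel' w).1 hr⟩
    obtain ⟨g', hg', hstep⟩ := exists_isLocalColouring (P := P) (ε := ε) (o := o)
      isTimes_upperTimes hV
      (w := ![![w 0 0, z₀, w 0 2], ![w 1 0, z₁, w 1 2], ![w 2 0, z₂, w 2 2]]) ((hrel _).2 hz)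
    refine ⟨g', hg', fun i t ht => ?_⟩
    rcases ht with rfl | rfl
    · rw [(hstep i).apply_neg_one (isTimes_upperTimes i), (hw i).apply_neg_one (isTimes_lowerTimes i)]
      fin_cases i <;> rfl
    · rw [(hstep i).apply_one (isTimes_upperTimes i), (hw i).apply_one (isTimes_lowerTimes i)]
      fin_cases i <;> rfl
  · obtain ⟨f1, g1, -⟩ := (hrel w).1 hw
    obtain ⟨f2, g2, -⟩ := (hrel w').1 hw'
    rw [(h 2).1, (h 0).1] at f1
    obtain ⟨e2, e0⟩ := hFb.unique_right f1 f2
    rw [(h 1).1, e2] at g1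
    intro i
    fin_cases i
    exacts [e0, (hGb.unique_right g1 g2).2, e2]
  · obtain ⟨f1, g1, -⟩ := (hrel' w).1 hw
    obtain ⟨f2, g2, -⟩ := (hrel' w').1 hw'
    rw [(h 1).1, (h 0).1] at f1
    obtain ⟨e0, e1⟩ := hHb.unique_right f1 f2
    rw [(h 2).1, e1] at g1
    intro i
    fin_cases i
    exacts [e0, e1, (hGb.unique_right g1 g2).1]

end Three

/-! ### Stable equivalence -/

theorem ReidemeisterMove.nonempty_linkModule_equiv {K : Type*} [CommRing K] {q : K} (hq : IsUnit q)
    {X : OrientedSurface.{u}} {n : ℕ} {L L' : LinkDiagram X n} (h : ReidemeisterMove L L') :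
    Nonempty (LinkDiagram.LinkModule (QuantumWeyl.A K q) (QuantumWeyl.B K q) (QuantumWeyl.C K q)
        (QuantumWeyl.D K q) L ≃ₗ[QuantumWeyl K q]
      LinkDiagram.LinkModule (QuantumWeyl.A K q) (QuantumWeyl.B K q) (QuantumWeyl.C K q)
        (QuantumWeyl.D K q) L') := by
  rcases h with h | h | h
  · exact h.nonempty_linkModule_equiv isCrossingList_reidemeisterOne isCrossingList_reidemeisterOne'
      fun M _ _ ε _ o o' _ _ => reidemeisterOne_local (QuantumWeyl.isBiquandle hq) ε o o'
  · exact h.nonempty_linkModule_equiv isCrossingList_reidemeisterTwo isCrossingList_reidemeisterTwo'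
      fun M _ _ ε height o o' _ ho' =>
        reidemeisterTwo_local (QuantumWeyl.isBiquandle hq) ε height o o' ho'
  · exact h.nonempty_linkModule_equiv isCrossingList_reidemeisterThree
      isCrossingList_reidemeisterThree' fun M _ _ ε height o o' ho ho' =>
        reidemeisterThree_local (QuantumWeyl.isBiquandle hq) ε height o o' ho ho'

theorem theorem5p5 {K : Type*} [CommRing K] (q : K) (hq : IsUnit q)
    (L L' : SurfaceLink.{u}) (h : StablyEquivalent L L') :
    Nonempty (LinkDiagram.LinkModule (QuantumWeyl.A K q) (QuantumWeyl.B K q) (QuantumWeyl.C K q)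
        (QuantumWeyl.D K q) L.diagram ≃ₗ[QuantumWeyl K q]
      LinkDiagram.LinkModule (QuantumWeyl.A K q) (QuantumWeyl.B K q) (QuantumWeyl.C K q)
        (QuantumWeyl.D K q) L'.diagram) := by
  induction h with
  | rel L L' h =>
    cases h with
    | reidemeister L L' h => exact h.nonempty_linkModule_equiv hq
    | transfer L L' h => exact h.nonempty_linkModule_equiv
    | handle L L' h => exact h.nonempty_linkModule_equiv
  | refl L => exact ⟨LinearEquiv.refl _ _⟩
  | symm L L' _ ih => exact ih.map LinearEquiv.symm
  | trans L L' L'' _ _ ih ih' =>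
    obtain ⟨φ⟩ := ih
    obtain ⟨ψ⟩ := ih'
    exact ⟨φ.trans ψ⟩
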